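/- Let $\tilde M$ be a pseudo-Riemannian manifold (finite-dimensional, arbitrary signature) of constant curvature $\kappa\in\mathbb{R}$, i.e. $\tilde R(X,Y)Z=\kappa(\langle Y,Z\rangle X-\langle X,Z\rangle Y)$ for the curvature $\tilde R$ of its Levi-Civita connection, and let $M$ be a spacelike (immersed) submanifold of $\tilde M$, i.e. the induced metric on $M$ is positive definite. Let $\nabla^{\perp}$ be the induced connection on the normal bundle $NM$ (the normal component of the Levi-Civita derivative), let $p\in M$, and let $\mathfrak{hol}^{\perp}\subset\mathfrak{so}(N_pM)$ be the Lie algebra of the restricted holonomy group of $\nabla^{\perp}$ at $p$, i.e. of the group of parallel displacements along null-homotopic piecewise smooth loops at $p$. Let $\Xi\subset N_pM$ be a $\mathfrak{hol}^{\perp}$-invariant totally isotropic subspace of maximal dimension, in the sense that $N_pM$ has a basis $(v_1,\dots,v_r,e_1,\dots,e_q,w_1,\dots,w_r)$ with $\Xi=\mathrm{span}\{v_1,\dots,v_r\}$, $$\langle v_i,v_j\rangle=\langle w_i,w_j\rangle=\langle v_i,e_j\rangle=\langle w_i,e_j\rangle=0,\qquad \langle e_i,e_j\rangle=\langle v_i,w_j\rangle=\delta_{ij}$$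 ($r,q\ge 0$). Put $\mathcal{E}=\mathrm{span}\{e_1,\dots,e_q\}\cong\mathbb{R}^q$ and let $pr_{\mathcal{E}}:N_pM\to\mathcal{E}$ be the projection $\xi\mapsto\sum_k\langle\xi,e_k\rangle e_k$. The normal screen holonomy algebra is $$\mathfrak{g}=\{pr_{\mathcal{E}}\circ B|_{\mathcal{E}} : B\in\mathfrak{hol}^{\perp}\}\subset\mathfrak{so}(\mathcal{E}).$$ Assume that $\mathfrak{g}$ has the Borel–Lichnérowicz property: there are direct sum decompositions $\mathcal{E}=E_0\oplus E_1\oplus\dots\oplus E_\ell$ into subspaces and $\mathfrak{g}=\mathfrak{g}_1\oplus\dots\oplus\mathfrak{g}_\ell$ into Lie subalgebras such that, for $j=1,\dots,\ell$, $\mathfrak{g}_j$ acts irreducibly and nontrivially on $E_j$ and trivially on $E_i$ for all $i\neq j$. Then, for every $j=1,\dots,\ell$, the space of algebraic curvature tensors with values in $\mathfrak{g}_j$ is nonzero: $$\mathcal{K}(\mathfrak{g}_j):=\{R\in\Lambda^2\mathcal{E}^*\otimes\mathfrak{g}_j : R(x,y)z+R(y,z)x+R(z,x)y=0\ \text{ for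 all } x,y,z\in\mathcal{E}\}\neq 0.$$ -/

import Mathlib

open Set Bundle
open scoped Manifold ContDiff Topology

attribute [local instance 100] LieRing.ofAssociativeRing

noncomputable section

namespace NormalHolonomy

/-! ### Pseudo-Riemannian metrics, the Levi-Civita connection, constant curvature -/

section Ambient

variable {F : Type*} [NormedAddCommGroup F] [NormedSpace ℝ F]
  {N : Type*} [TopologicalSpace N] [ChartedSpace F N] [IsManifold 𝓘(ℝ, F) ∞ N]

variable (F N) in
/-- A smooth pseudo-Riemannian metric on the (finite-dimensional) manifold `N`: a smooth field of
nondegenerate symmetric bilinear forms on the tangent spaces, of arbitrary signature. -/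
structure PseudoRiemannianMetric where
  /-- The scalar product on the tangent space at `x`. -/
  inner (x : N) : TangentSpace 𝓘(ℝ, F) x →L[ℝ] TangentSpace 𝓘(ℝ, F) x →L[ℝ] ℝ
  symm (x : N) (v w : TangentSpace 𝓘(ℝ, F) x) : inner x v w = inner x w v
  nondegenerate (x : N) (v : TangentSpace 𝓘(ℝ, F) x) (hv : ∀ w, inner x v w = 0) : v = 0
  contMDiff : ContMDiff 𝓘(ℝ, F) (𝓘(ℝ, F).prod 𝓘(ℝ, F →L[ℝ] F →L[ℝ] ℝ)) ∞
    (fun x : N ↦ TotalSpace.mk' (F →L[ℝ] F →L[ℝ] ℝ) x (inner x))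

/-- `cov` is the Levi-Civita connection of `g`: a smooth covariant derivative on the tangent
bundle which is torsion-free and metric. In Mathlib's argument order `cov Y x (X x)` is the value
of `∇_X Y` at `x`. -/
structure IsLeviCivita (g : PseudoRiemannianMetric F N)
    (cov : CovariantDerivative 𝓘(ℝ, F) F (TangentSpace 𝓘(ℝ, F) : N → Type _)) : Prop where
  smooth : CovariantDerivative.ContMDiffCovariantDerivative cov ∞
  torsion_free : ∀ (X Y : Π x : N, TangentSpace 𝓘(ℝ, F) x) (x : N),
    MDifferentiableAt 𝓘(ℝ, F) 𝓘(ℝ, F).tangent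
      (fun y ↦ (⟨y, X y⟩ : TangentBundle 𝓘(ℝ, F) N)) x →
    MDifferentiableAt 𝓘(ℝ, F) 𝓘(ℝ, F).tangent
      (fun y ↦ (⟨y, Y y⟩ : TangentBundle 𝓘(ℝ, F) N)) x →
    cov Y x (X x) - cov X x (Y x) = VectorField.mlieBracket 𝓘(ℝ, F) X Y x
  metric : ∀ (Y Z : Π x : N, TangentSpace 𝓘(ℝ, F) x) (x : N) (v : TangentSpace 𝓘(ℝ, F) x),
    MDifferentiableAt 𝓘(ℝ, F) 𝓘(ℝ, F).tangent
      (fun y ↦ (⟨y, Y y⟩ : TangentBundle 𝓘(ℝ, F) N)) x →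
    MDifferentiableAt 𝓘(ℝ, F) 𝓘(ℝ, F).tangent
      (fun y ↦ (⟨y, Z y⟩ : TangentBundle 𝓘(ℝ, F) N)) x →
    mvfderiv 𝓘(ℝ, F) (fun y ↦ g.inner y (Y y) (Z y)) x v =
      g.inner x (cov Y x v) (Z x) + g.inner x (Y x) (cov Z x v)

/-- The curvature `R(X, Y) Z = ∇_X ∇_Y Z - ∇_Y ∇_X Z - ∇_[X, Y] Z` at the point `x`. -/
def curvature (cov : CovariantDerivative 𝓘(ℝ, F) F (TangentSpace 𝓘(ℝ, F) : N → Type _))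
    (X Y Z : Π x : N, TangentSpace 𝓘(ℝ, F) x) (x : N) : TangentSpace 𝓘(ℝ, F) x :=
  cov (fun y ↦ cov Z y (Y y)) x (X x) - cov (fun y ↦ cov Z y (X y)) x (Y x)
    - cov Z x (VectorField.mlieBracket 𝓘(ℝ, F) X Y x)

/-- The metric `g` with Levi-Civita connection `cov` has constant curvature `κ`:
`R(X, Y) Z = κ (⟨Y, Z⟩ X - ⟨X, Z⟩ Y)` for all smooth vector fields. -/
def HasConstantCurvature (g : PseudoRiemannianMetric F N)
    (cov : CovariantDerivative 𝓘(ℝ, F) F (TangentSpace 𝓘(ℝ, F) : N → Type _)) (κ : ℝ) : Prop :=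
  ∀ X Y Z : Π x : N, TangentSpace 𝓘(ℝ, F) x,
    ContMDiff 𝓘(ℝ, F) 𝓘(ℝ, F).tangent ∞ (fun y ↦ (⟨y, X y⟩ : TangentBundle 𝓘(ℝ, F) N)) →
    ContMDiff 𝓘(ℝ, F) 𝓘(ℝ, F).tangent ∞ (fun y ↦ (⟨y, Y y⟩ : TangentBundle 𝓘(ℝ, F) N)) →
    ContMDiff 𝓘(ℝ, F) 𝓘(ℝ, F).tangent ∞ (fun y ↦ (⟨y, Z y⟩ : TangentBundle 𝓘(ℝ, F) N)) →
    ∀ x, curvature cov X Y Z x = κ • (g.inner x (Y x) (Z x) • X x - g.inner x (X x) (Z x) • Y x)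

/-- The covariant derivative `(D/dt) V` at time `t` of a vector field `V` along the curve `c`.
The trivialization `e` of the tangent bundle at `c t` provides a local frame of constant fields;
the coefficients of `V` are differentiated, and `∇_{c'(t)}` is applied to the field having
the coefficients of `V t`, frozen at time `t`. -/
def covDerivAlong (cov : CovariantDerivative 𝓘(ℝ, F) F (TangentSpace 𝓘(ℝ, F) : N → Type _))
    (c : ℝ → N) (V : Π t : ℝ, TangentSpace 𝓘(ℝ, F) (c t)) (t : ℝ) :
    TangentSpace 𝓘(ℝ, F) (c t) :=
  let e := trivializationAt F (TangentSpace 𝓘(ℝ, F) : N → Type _) (c t)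
  e.symm (c t) (deriv (fun s ↦ (e (⟨c s, V s⟩ : TangentBundle 𝓘(ℝ, F) N)).2) t)
    + cov (FiberBundle.extend F (V t)) (c t) (mfderiv 𝓘(ℝ, ℝ) 𝓘(ℝ, F) c t (1 : ℝ))

end Ambient

/-! ### Spacelike submanifolds and the normal connection -/

section Submanifold

variable {E : Type*} [NormedAddCommGroup E] [NormedSpace ℝ E]
  {M : Type*} [TopologicalSpace M] [ChartedSpace E M]
  {F : Type*} [NormedAddCommGroup F] [NormedSpace ℝ F]
  {N : Type*} [TopologicalSpace N] [ChartedSpace F N] [IsManifold 𝓘(ℝ, F) ∞ N]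

/-- `f : M → N` is a spacelike (immersed) submanifold: `f` is smooth and the induced form on `M` is
positive definite (hence each differential of `f` is injective). -/
structure IsSpacelikeImmersion (g : PseudoRiemannianMetric F N) (f : M → N) : Prop where
  smooth : ContMDiff 𝓘(ℝ, E) 𝓘(ℝ, F) ∞ f
  spacelike : ∀ (x : M) (v : TangentSpace 𝓘(ℝ, E) x), v ≠ 0 →
    0 < g.inner (f x) (mfderiv 𝓘(ℝ, E) 𝓘(ℝ, F) f x v) (mfderiv 𝓘(ℝ, E) 𝓘(ℝ, F) f x v)

/-- The image of the tangent space of `M` at `x` in the tangent space of `N` at `f x`. -/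
def tangentImage (E : Type*) [NormedAddCommGroup E] [NormedSpace ℝ E] [ChartedSpace E M]
    (f : M → N) (x : M) : Submodule ℝ (TangentSpace 𝓘(ℝ, F) (f x)) :=
  LinearMap.range (mfderiv 𝓘(ℝ, E) 𝓘(ℝ, F) f x).toLinearMap

/-- The normal space of `M` at `x`: the orthogonal complement of the tangent space of `M`. -/
def normalSpace (E : Type*) [NormedAddCommGroup E] [NormedSpace ℝ E] [ChartedSpace E M]
    (g : PseudoRiemannianMetric F N) (f : M → N) (x : M) :
    Submodule ℝ (TangentSpace 𝓘(ℝ, F) (f x)) where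
  carrier := {ξ | ∀ u ∈ tangentImage E f x, g.inner (f x) u ξ = 0}
  add_mem' := by
    intro a b ha hb u hu
    simp [ha u hu, hb u hu]
  zero_mem' := by
    intro u _
    simp
  smul_mem' := by
    intro c a ha u hu
    simp [ha u hu]

/-- The continuous curve `γ : [0, 1] → M` is piecewise smooth. -/
def IsPiecewiseSmooth (E : Type*) [NormedAddCommGroup E] [NormedSpace ℝ E] [ChartedSpace E M]
    {x y : M} (γ : Path x y) : Prop :=
  ∃ (n : ℕ) (a : ℕ → ℝ), Monotone a ∧ a 0 = 0 ∧ a n = 1 ∧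
    ∀ i < n, ContMDiffOn 𝓘(ℝ, ℝ) 𝓘(ℝ, E) ∞ γ.extend (Icc (a i) (a (i + 1)))

/-- `V` is a normal vector field along `γ` which is parallel for the normal connection: `V` is
continuous and, off finitely many times, differentiable with `(∇^⊥/dt) V = 0`. As
`(∇^⊥/dt) V` is the normal component of `(D/dt) V`, this says that `(D/dt) V` is tangent to `M`. -/
structure IsNormalParallel (E : Type*) [NormedAddCommGroup E] [NormedSpace ℝ E] [ChartedSpace E M]
    (g : PseudoRiemannianMetric F N)
    (cov : CovariantDerivative 𝓘(ℝ, F) F (TangentSpace 𝓘(ℝ, F) : N → Type _))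
    (f : M → N) {x y : M} (γ : Path x y)
    (V : Π t : ℝ, TangentSpace 𝓘(ℝ, F) (f (γ.extend t))) : Prop where
  normal : ∀ t ∈ Icc (0 : ℝ) 1, V t ∈ normalSpace E g f (γ.extend t)
  continuousOn :
    ContinuousOn (fun t ↦ (⟨f (γ.extend t), V t⟩ : TangentBundle 𝓘(ℝ, F) N)) (Icc 0 1)
  parallel : ∃ S : Set ℝ, S.Finite ∧ ∀ t ∈ Ioo (0 : ℝ) 1 \ S,
    MDifferentiableAt 𝓘(ℝ, ℝ) 𝓘(ℝ, F).tangent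
      (fun s ↦ (⟨f (γ.extend s), V s⟩ : TangentBundle 𝓘(ℝ, F) N)) t ∧
    covDerivAlong cov (fun s ↦ f (γ.extend s)) V t ∈ tangentImage E f (γ.extend t)

/-- The endomorphism `φ` of the normal space at `p` is the parallel displacement `τ_γ` of the normal
connection along the loop `γ`. -/
def IsNormalTransport (E : Type*) [NormedAddCommGroup E] [NormedSpace ℝ E] [ChartedSpace E M]
    (g : PseudoRiemannianMetric F N)
    (cov : CovariantDerivative 𝓘(ℝ, F) F (TangentSpace 𝓘(ℝ, F) : N → Type _))
    (f : M → N) {p : M} (γ : Path p p) (φ : Module.End ℝ (normalSpace E g f p)) : Prop :=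
  ∀ ξ : normalSpace E g f p, ∃ V : Π t : ℝ, TangentSpace 𝓘(ℝ, F) (f (γ.extend t)),
    IsNormalParallel E g cov f γ V ∧
    (⟨f (γ.extend 0), V 0⟩ : TangentBundle 𝓘(ℝ, F) N) = ⟨f p, (ξ : TangentSpace 𝓘(ℝ, F) (f p))⟩ ∧
    (⟨f (γ.extend 1), V 1⟩ : TangentBundle 𝓘(ℝ, F) N) = ⟨f p, (φ ξ : TangentSpace 𝓘(ℝ, F) (f p))⟩

/-- The restricted normal holonomy group at `p`: all parallel displacements along null-homotopic
piecewise smooth loops at `p`. -/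
def restrictedNormalHolonomy (E : Type*) [NormedAddCommGroup E] [NormedSpace ℝ E]
    [ChartedSpace E M] (g : PseudoRiemannianMetric F N)
    (cov : CovariantDerivative 𝓘(ℝ, F) F (TangentSpace 𝓘(ℝ, F) : N → Type _))
    (f : M → N) (p : M) : Set (Module.End ℝ (normalSpace E g f p)) :=
  {φ | ∃ γ : Path p p, IsPiecewiseSmooth E γ ∧ γ.Homotopic (Path.refl p) ∧
    IsNormalTransport E g cov f γ φ}

/-- The tangent vectors at the identity of the restricted normal holonomy group: the velocities
at time `0` of the `C¹` curves in the space of endomorphisms which stay in the group and start at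
the identity. -/
def holonomyVelocities (E : Type*) [NormedAddCommGroup E] [NormedSpace ℝ E]
    [ChartedSpace E M] (g : PseudoRiemannianMetric F N)
    (cov : CovariantDerivative 𝓘(ℝ, F) F (TangentSpace 𝓘(ℝ, F) : N → Type _))
    (f : M → N) (p : M) : Set (Module.End ℝ (normalSpace E g f p)) :=
  {X | ∃ c c' : ℝ → Module.End ℝ (normalSpace E g f p),
    (∀ t, c t ∈ restrictedNormalHolonomy E g cov f p) ∧ c 0 = 1 ∧ c' 0 = X ∧
    ∀ ξ, Continuous (fun t ↦ c' t ξ) ∧ ∀ t, HasDerivAt (fun s ↦ c s ξ) (c' t ξ) t}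

/-- The normal holonomy algebra: the Lie algebra of the restricted normal holonomy group. The set
of tangent vectors at the identity of a group of matrices is a Lie algebra already; taking
the Lie algebra which it spans only packages this. -/
def normalHolonomyAlgebra (E : Type*) [NormedAddCommGroup E] [NormedSpace ℝ E]
    [ChartedSpace E M] (g : PseudoRiemannianMetric F N)
    (cov : CovariantDerivative 𝓘(ℝ, F) F (TangentSpace 𝓘(ℝ, F) : N → Type _))
    (f : M → N) (p : M) : LieSubalgebra ℝ (Module.End ℝ (normalSpace E g f p)) :=
  LieSubalgebra.lieSpan ℝ _ (holonomyVelocities E g cov f p)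

/-! ### The normal screen holonomy algebra -/

/-- `(v, e, w)` is a pseudo-orthonormal basis of the normal space at `p` adapted to the totally
isotropic subspace `Ξ = span v`, which is of the maximal dimension `r` and is invariant under the
normal holonomy algebra. -/
structure IsScreenBasis (E : Type*) [NormedAddCommGroup E] [NormedSpace ℝ E]
    [ChartedSpace E M] (g : PseudoRiemannianMetric F N)
    (cov : CovariantDerivative 𝓘(ℝ, F) F (TangentSpace 𝓘(ℝ, F) : N → Type _))
    (f : M → N) (p : M) {r q : ℕ} (v : Fin r → normalSpace E g f p)
    (e : Fin q → normalSpace E g f p) (w : Fin r → normalSpace E g f p) : Prop where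
  vv : ∀ i j, g.inner (f p) (v i) (v j) = 0
  ww : ∀ i j, g.inner (f p) (w i) (w j) = 0
  ve : ∀ i j, g.inner (f p) (v i) (e j) = 0
  we : ∀ i j, g.inner (f p) (w i) (e j) = 0
  ee : ∀ i j, g.inner (f p) (e i) (e j) = if i = j then 1 else 0
  vw : ∀ i j, g.inner (f p) (v i) (w j) = if i = j then 1 else 0
  span_eq_top : Submodule.span ℝ (range v ∪ range e ∪ range w) = ⊤
  invariant : ∀ B ∈ normalHolonomyAlgebra E g cov f p, ∀ x ∈ Submodule.span ℝ (range v),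
    B x ∈ Submodule.span ℝ (range v)

/-- For an endomorphism `B` of the normal space, the endomorphism `pr ∘ B ∘ ι` of Euclidean space,
where `ι` is the inclusion onto `span e` and `pr` the projection onto it, that is, the
middle block `(⟨B eⱼ, eᵢ⟩)ᵢⱼ` of `B` in the basis `(v, e, w)`. -/
def screenProjection {g : PseudoRiemannianMetric F N} {f : M → N} {p : M} {q : ℕ}
    (e : Fin q → normalSpace E g f p) :
    Module.End ℝ (normalSpace E g f p) →ₗ[ℝ] Module.End ℝ (EuclideanSpace ℝ (Fin q)) where
  toFun B :=
    { toFun := fun x ↦ WithLp.toLp 2 fun i ↦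
        g.inner (f p) (B (∑ j, x j • e j) : normalSpace E g f p) (e i)
      map_add' := by
        intro x y
        ext i
        simp [add_smul, Finset.sum_add_distrib]
      map_smul' := by
        intro c x
        ext i
        simp [mul_smul, Finset.mul_sum] }
  map_add' := by
    intro A B
    ext x i
    simp [Finset.sum_add_distrib]
  map_smul' := by
    intro c B
    ext x i
    simp [Finset.mul_sum, mul_left_comm]

/-- The normal screen holonomy algebra `pr_{so(q)}(hol^⊥)`, acting on Euclidean space
`ℝ^q ≅ span e`. -/
def screenHolonomyAlgebra {g : PseudoRiemannianMetric F N}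
    (cov : CovariantDerivative 𝓘(ℝ, F) F (TangentSpace 𝓘(ℝ, F) : N → Type _))
    {f : M → N} {p : M} {q : ℕ} (e : Fin q → normalSpace E g f p) :
    Submodule ℝ (Module.End ℝ (EuclideanSpace ℝ (Fin q))) :=
  (normalHolonomyAlgebra E g cov f p).toSubmodule.map (screenProjection e)

end Submanifold

/-! ### Algebraic curvature tensors and the Borel-Lichnérowicz property -/

section Algebra

variable {V : Type*} [AddCommGroup V] [Module ℝ V]

/-- The space of algebraic curvature tensors on `V` with values in `h`: alternating bilinear maps
`R : V × V → h` with `R(x, y) z + R(y, z) x + R(z, x) y = 0`. -/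
def curvatureTensors (h : LieSubalgebra ℝ (Module.End ℝ V)) :
    Submodule ℝ (V →ₗ[ℝ] V →ₗ[ℝ] Module.End ℝ V) where
  carrier := {R | (∀ x, R x x = 0) ∧ (∀ x y, R x y ∈ h) ∧
    ∀ x y z, R x y z + R y z x + R z x y = 0}
  add_mem' := by
    rintro R S ⟨h1, h2, h3⟩ ⟨k1, k2, k3⟩
    refine ⟨fun x ↦ by simp [h1, k1], fun x y ↦ h.add_mem (h2 x y) (k2 x y), fun x y z ↦ ?_⟩
    have := congrArg₂ (· + ·) (h3 x y z) (k3 x y z)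
    simp only [add_zero] at this
    rw [← this]
    simp only [LinearMap.add_apply]
    abel
  zero_mem' := ⟨by simp, fun x y ↦ h.zero_mem, by simp⟩
  smul_mem' := by
    rintro c R ⟨h1, h2, h3⟩
    refine ⟨fun x ↦ by simp [h1], fun x y ↦ h.smul_mem c (h2 x y), fun x y z ↦ ?_⟩
    simp only [LinearMap.smul_apply, ← smul_add, h3, smul_zero]

/-- `h` acts irreducibly on the subspace `W`: `W` is invariant, the action on `W` is not trivial,
and `W` has no invariant subspaces but `0` and `W`. -/
structure ActsIrreducibly (h : LieSubalgebra ℝ (Module.End ℝ V)) (W : Submodule ℝ V) : Prop where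
  invariant : ∀ A ∈ h, ∀ x ∈ W, A x ∈ W
  nontrivial : ∃ A ∈ h, ∃ x ∈ W, A x ≠ 0
  irreducible : ∀ U ≤ W, (∀ A ∈ h, ∀ x ∈ U, A x ∈ U) → U = ⊥ ∨ U = W

/-- `V = W 0 ⊕ ⋯ ⊕ W ℓ` and `𝔤 = h 1 ⊕ ⋯ ⊕ h ℓ` are decompositions as in the Borel-Lichnérowicz
property: each `h j` acts irreducibly on `W j` and trivially on `W i` for `i ≠ j`. The factors `h`
are indexed by `Fin ℓ`, so that `h j` belongs to the summand `W j.succ`. -/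
structure IsBorelLichnerowicz (𝔤 : Submodule ℝ (Module.End ℝ V)) {ℓ : ℕ}
    (W : Fin (ℓ + 1) → Submodule ℝ V) (h : Fin ℓ → LieSubalgebra ℝ (Module.End ℝ V)) : Prop where
  isInternal : DirectSum.IsInternal W
  iSup_eq : ⨆ j, (h j).toSubmodule = 𝔤
  independent : iSupIndep fun j ↦ (h j).toSubmodule
  irreducible : ∀ j, ActsIrreducibly (h j) (W j.succ)
  trivial : ∀ j i, i ≠ j.succ → ∀ A ∈ h j, ∀ x ∈ W i, A x = 0

end Algebra

end NormalHolonomy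

end

open Set Bundle
open scoped Manifold ContDiff Topology

noncomputable section

/-! The argument is by contradiction: if $\mathcal K(\mathfrak g_j)=0$, then $\mathfrak g$ acts
trivially on $E_j$.

The algebraic core is Olmos' construction. Since the ambient curvature is constant, the Ricci
equation says that the normal curvature is given by commutators of shape operators. Let $\tau$ be a
normal parallel displacement from $p$ to a point $x$, let $(b_i)$ be an orthonormal tangent basis at
$x$, and put $B_{ik}=\tau^{-1}R^\perp(b_k,b_i)\tau$. Then $\langle
B_{ik}\eta,\zeta\rangle=[A_{\tau\eta},A_{\tau\zeta}]_{ik}$ with symmetric matrices $A$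
(`IsImmersedConnection.exists_matrix`), and $B_{ik}$ belongs to $\mathfrak{hol}^\perp$
(`IsTransport.exists_mem_normalHolonomyAlgebra`). On the screen, $R(a,b)=\sum_{i,k}[A_{\tau
a},A_{\tau b}]_{ik}\,pr_{\mathcal E}B_{ik}$ takes values in $\mathfrak g$, has the pair symmetry,
and satisfies the Bianchi identity by the Jacobi identity (`sum_commutator_mul_commutator_cyclic`).
Composed with the projection to $E_j$ it lies in $\mathcal K(\mathfrak g_j)$, hence vanishes. For
$z\in E_j$ the number $\langle R(z,u)z,u\rangle$ is a sum of squares of all $\langle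
B_{ik}z,u\rangle$, so $pr_{\mathcal E}B_{ik}z=0$
(`IsBorelLichnerowicz.apply_eq_zero_of_curvatureTensors_eq_bot`). Because $B_{ik}$ is skew and
preserves $\Xi$, it follows that $B_{ik}z\in\Xi$ (`IsScreenBasis.isFlatOn`).

So every displaced curvature operator maps $z$ and $\Xi$ into $\Xi$. It remains to deduce that
$\mathfrak{hol}^\perp$ itself maps $z$ into $\Xi$. One could quote the Ambrose–Singer theorem; here
it is replaced by two direct arguments. In one direction, transport around small parallelograms,
differentiated twice, shows that displaced curvature is in the holonomy algebra
(`exists_hasDerivAt_squareTransport`). In the other, the affine class $z+\Xi$ is shown to have no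
monodromy. Inside a chart ball, the derivative of radial transport along a curve is an integral of
curvature (`cone_formula`), so a parallel field that starts in the displaced class remains in it
(`segTransportInv_sub_mem`). Over a null-homotopic loop the local statements are glued along a grid
subdividing the homotopy (`IsFlatSystem.of_homotopic`), which gives $\varphi z-z\in\Xi$ for every
$\varphi$ in the restricted holonomy group (`restrictedNormalHolonomy_sub_mem`).

Differentiating, each $B\in\mathfrak{hol}^\perp$ maps $z$ into $\Xi$
(`IsScreenBasis.apply_mem_of_holonomy`), so $pr_{\mathcal E}Bz=0$ for all $z\in E_j$, contrary to
the nontrivial action of $\mathfrak g_j$ on $E_j$. -/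

namespace NormalHolonomy

set_option linter.unusedSectionVars false

/-! ### Linear differential equations with a parameter. -/

section LinearODE

variable {X : Type*} [NormedAddCommGroup X] [NormedSpace ℝ X]

/-- The Picard iterates of a linear equation depending on a parameter. -/
def picardTerm (L : ℝ → ℝ → X →L[ℝ] X) (x₀ : X) : ℕ → ℝ → ℝ → X
  | 0 => fun _ _ ↦ x₀
  | n + 1 => fun t s ↦ ∫ σ in (0 : ℝ)..s, L t σ (picardTerm L x₀ n t σ)

theorem continuous_picardTerm {L : ℝ → ℝ → X →L[ℝ] X} (hL : Continuous (Function.uncurry L))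
    (x₀ : X) (n : ℕ) : Continuous (Function.uncurry (picardTerm L x₀ n)) := by
  induction n with
  | zero => exact continuous_const
  | succ n ih =>
    have h : Continuous (Function.uncurry fun (p : ℝ × ℝ) (σ : ℝ) ↦
        L p.1 σ (picardTerm L x₀ n p.1 σ)) := by
      have h1 : Continuous fun q : (ℝ × ℝ) × ℝ ↦ L q.1.1 q.2 :=
        hL.comp (by fun_prop : Continuous fun q : (ℝ × ℝ) × ℝ ↦ (q.1.1, q.2))
      have h2 : Continuous fun q : (ℝ × ℝ) × ℝ ↦ picardTerm L x₀ n q.1.1 q.2 :=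
        ih.comp (by fun_prop : Continuous fun q : (ℝ × ℝ) × ℝ ↦ (q.1.1, q.2))
      exact h1.clm_apply h2
    exact intervalIntegral.continuous_parametric_intervalIntegral_of_continuous h continuous_snd

theorem hasDerivAt_picardTerm [CompleteSpace X] {L : ℝ → ℝ → X →L[ℝ] X} (hL : Continuous (Function.uncurry L))
    (x₀ : X) (n : ℕ) (t s : ℝ) :
    HasDerivAt (picardTerm L x₀ (n + 1) t) (L t s (picardTerm L x₀ n t s)) s := by
  have h : Continuous fun σ ↦ L t σ (picardTerm L x₀ n t σ) :=
    (hL.comp (by fun_prop : Continuous fun σ : ℝ ↦ (t, σ))).clm_apply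
      ((continuous_picardTerm hL x₀ n).comp (by fun_prop : Continuous fun σ : ℝ ↦ (t, σ)))
  exact intervalIntegral.integral_hasDerivAt_right (h.intervalIntegrable _ _)
    (h.stronglyMeasurableAtFilter _ _) h.continuousAt

/-- Each integration raises the power of $|s|$ by one and divides by the new exponent, so the terms
are dominated by the exponential series. -/
theorem norm_picardTerm_le {L : ℝ → ℝ → X →L[ℝ] X} {C T : ℝ} {t : ℝ}
    (hC : ∀ s, |s| ≤ T → ‖L t s‖ ≤ C) (x₀ : X) (n : ℕ) :
    ∀ s, |s| ≤ T → ‖picardTerm L x₀ n t s‖ ≤ ‖x₀‖ * ((C * |s|) ^ n / n.factorial) := by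
  induction n with
  | zero => intro s _; simp [picardTerm]
  | succ n ih =>
    intro s hs
    have hC0 : 0 ≤ C := (norm_nonneg _).trans (hC 0 (by simpa using (abs_nonneg s).trans hs))
    -- The factor is written `|σ - 0|` to fit `integral_pow_abs_sub_uIoc`.
    have hb : ∀ σ ∈ Set.uIoc (0 : ℝ) s, ‖L t σ (picardTerm L x₀ n t σ)‖ ≤
        C * (‖x₀‖ * (C ^ n / n.factorial)) * |σ - 0| ^ n := by
      intro σ hσ
      have hσs : |σ| ≤ |s| := by
        rcases le_total 0 s with h | h
        · rw [uIoc_of_le h] at hσ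
          rw [abs_of_pos hσ.1, abs_of_nonneg h]; exact hσ.2
        · rw [uIoc_of_ge h] at hσ
          rw [abs_of_nonpos hσ.2, abs_of_nonpos h]; linarith [hσ.1]
      have h1 := hC σ (hσs.trans hs)
      have h2 := ih σ (hσs.trans hs)
      calc _ ≤ ‖L t σ‖ * ‖picardTerm L x₀ n t σ‖ := ContinuousLinearMap.le_opNorm _ _
        _ ≤ C * (‖x₀‖ * ((C * |σ|) ^ n / n.factorial)) := by gcongr
        _ = _ := by rw [sub_zero, mul_pow]; ring
    calc ‖picardTerm L x₀ (n + 1) t s‖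
        ≤ ∫ σ in Set.uIoc (0 : ℝ) s, ‖L t σ (picardTerm L x₀ n t σ)‖ :=
          intervalIntegral.norm_integral_le_integral_norm_uIoc
      _ ≤ ∫ σ in Set.uIoc (0 : ℝ) s, C * (‖x₀‖ * (C ^ n / n.factorial)) * |σ - 0| ^ n := by
          refine MeasureTheory.integral_mono_of_nonneg (Filter.Eventually.of_forall fun _ ↦
            norm_nonneg _) ?_ ?_
          · have : Continuous fun σ : ℝ ↦ C * (‖x₀‖ * (C ^ n / n.factorial)) * |σ - 0| ^ n := by
              fun_prop
            exact (this.integrableOn_uIcc (a := 0) (b := s)).mono_set uIoc_subset_uIcc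
          · exact (MeasureTheory.ae_restrict_iff' measurableSet_uIoc).2
              (Filter.Eventually.of_forall hb)
      _ = _ := by
          rw [MeasureTheory.integral_const_mul, integral_pow_abs_sub_uIoc, sub_zero,
            Nat.factorial_succ, mul_pow]
          push_cast
          field_simp
          ring

/-- The solution is the sum of the Picard terms. Locally uniform domination by the exponential
series gives joint continuity. The derivative of the $(n+1)$-st term is $L$ applied to the $n$-th,
so termwise differentiation reproduces the equation. -/
theorem exists_linearODE_solution [CompleteSpace X] {L : ℝ → ℝ → X →L[ℝ] X} (hL : Continuous (Function.uncurry L))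
    (x₀ : X) : ∃ x : ℝ → ℝ → X, Continuous (Function.uncurry x) ∧ (∀ t, x t 0 = x₀) ∧
      ∀ t s, HasDerivAt (x t) (L t s (x t s)) s := by
  have hbound : ∀ T : ℝ, ∃ C : ℝ, 0 ≤ C ∧ ∀ t s, |t| ≤ T → |s| ≤ T → ‖L t s‖ ≤ C := by
    intro T
    obtain ⟨C, hC⟩ := (((isCompact_Icc (a := -T) (b := T)).prod
      (isCompact_Icc (a := -T) (b := T))).bddAbove_image hL.norm.continuousOn)
    refine ⟨max C 0, le_max_right _ _, fun t s ht hs ↦ le_max_of_le_left (hC ⟨(t, s), ⟨?_, ?_⟩, rfl⟩)⟩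
    · exact abs_le.1 ht
    · exact abs_le.1 hs
  have hterm : ∀ T C : ℝ, 0 ≤ C → (∀ t s, |t| ≤ T → |s| ≤ T → ‖L t s‖ ≤ C) → ∀ n t s, |t| ≤ T → |s| ≤ T →
      ‖picardTerm L x₀ n t s‖ ≤ ‖x₀‖ * ((C * T) ^ n / n.factorial) := by
    intro T C hC0 hC n t s ht hs
    refine (norm_picardTerm_le (fun s hs ↦ hC t s ht hs) x₀ n s hs).trans ?_
    gcongr
  have hsum : ∀ T C : ℝ, Summable fun n : ℕ ↦ ‖x₀‖ * ((C * T) ^ n / n.factorial) := fun T C ↦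
    (Real.summable_pow_div_factorial _).mul_left _
  have hcontL : ∀ t, Continuous (L t) := fun t ↦
    hL.comp (by fun_prop : Continuous fun σ : ℝ ↦ (t, σ))
  have hsummable : ∀ t s, Summable fun n ↦ picardTerm L x₀ n t s := by
    intro t s
    obtain ⟨C, hC0, hC⟩ := hbound (max |t| |s|)
    exact Summable.of_norm_bounded (hsum _ C)
      fun n ↦ hterm _ C hC0 hC n t s (le_max_left _ _) (le_max_right _ _)
  refine ⟨fun t s ↦ ∑' n, picardTerm L x₀ n t s, ?_, ?_, ?_⟩
  · rw [continuous_iff_continuousAt]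
    rintro ⟨t, s⟩
    -- The added `1` leaves room for an open neighbourhood of `(t, s)` on which one constant serves.
    obtain ⟨C, hC0, hC⟩ := hbound (max |t| |s| + 1)
    have ho : IsOpen {p : ℝ × ℝ | |p.1| < max |t| |s| + 1 ∧ |p.2| < max |t| |s| + 1} :=
      (isOpen_lt (f := fun p : ℝ × ℝ ↦ |p.1|) (by fun_prop) continuous_const).inter
        (isOpen_lt (f := fun p : ℝ × ℝ ↦ |p.2|) (by fun_prop) continuous_const)
    have hmem : (t, s) ∈ {p : ℝ × ℝ | |p.1| < max |t| |s| + 1 ∧ |p.2| < max |t| |s| + 1} :=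
      ⟨by simpa using (le_max_left |t| |s|).trans_lt (lt_add_one _),
       by simpa using (le_max_right |t| |s|).trans_lt (lt_add_one _)⟩
    refine ContinuousOn.continuousAt (s := _) ?_ (ho.mem_nhds hmem)
    exact continuousOn_tsum (fun n ↦ (continuous_picardTerm hL x₀ n).continuousOn) (hsum _ C)
      fun n p hp ↦ hterm _ C hC0 hC n p.1 p.2 hp.1.le hp.2.le
  · intro t
    show ∑' n, picardTerm L x₀ n t 0 = x₀
    rw [tsum_eq_single 0]
    · rfl
    · intro n hn
      obtain ⟨m, rfl⟩ := Nat.exists_eq_succ_of_ne_zero hn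
      simp [picardTerm]
  · intro t s
    obtain ⟨C, hC0, hC⟩ := hbound (max |t| (|s| + 1))
    have hT : |t| ≤ max |t| (|s| + 1) := le_max_left _ _
    have hderiv : ∀ n y, HasDerivAt (picardTerm L x₀ (n + 1) t) (L t y (picardTerm L x₀ n t y)) y :=
      fun n y ↦ hasDerivAt_picardTerm hL x₀ n t y
    have hb : ∀ n y, y ∈ Metric.ball (0 : ℝ) (|s| + 1) → ‖L t y (picardTerm L x₀ n t y)‖ ≤
        C * (‖x₀‖ * ((C * max |t| (|s| + 1)) ^ n / n.factorial)) := by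
      intro n y hy
      have hy' : |y| ≤ max |t| (|s| + 1) := by
        rw [Metric.mem_ball, dist_zero_right, Real.norm_eq_abs] at hy
        exact hy.le.trans (le_max_right _ _)
      refine (ContinuousLinearMap.le_opNorm _ _).trans ?_
      gcongr
      · exact hC t y hT hy'
      · exact hterm _ C hC0 hC n t y hT hy'
    have hs : s ∈ Metric.ball (0 : ℝ) (|s| + 1) := by simp
    have hmain := hasDerivAt_tsum_of_isPreconnected (g := fun n ↦ picardTerm L x₀ (n + 1) t)
      (g' := fun n y ↦ L t y (picardTerm L x₀ n t y))
      ((hsum (max |t| (|s| + 1)) C).mul_left C) Metric.isOpen_ball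
      (convex_ball _ _).isPreconnected (fun n y _ ↦ hderiv n y) hb hs
      ((summable_nat_add_iff 1).2 (hsummable t s)) hs
    rw [← ContinuousLinearMap.map_tsum _ (hsummable t s)] at hmain
    have heq : (fun s ↦ ∑' n, picardTerm L x₀ n t s) =
        fun s ↦ x₀ + ∑' n, picardTerm L x₀ (n + 1) t s := by
      funext y
      rw [(hsummable t y).tsum_eq_zero_add]
      rfl
    show HasDerivAt (fun s ↦ ∑' n, picardTerm L x₀ n t s) _ s
    rw [heq]
    simpa using hmain.const_add x₀

end LinearODE

/-! ### Propagators and their dependence on the parameter. -/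

section Propagator

variable {𝔸 : Type*} [NormedRing 𝔸] [NormedAlgebra ℝ 𝔸]

theorem eq_of_hasDerivAt_zero {X : Type*} [NormedAddCommGroup X] [NormedSpace ℝ X] {f : ℝ → X}
    (h : ∀ s, HasDerivAt f 0 s) (s t : ℝ) : f s = f t :=
  is_const_of_deriv_eq_zero (fun s ↦ (h s).differentiableAt) (fun s ↦ (h s).deriv) s t

/-- `P` is the propagator of the equation `P' = A P`, depending on a parameter, and `Q` its
inverse. The parameter is the first argument, the time the second. -/
structure IsPropagator (A P Q : ℝ → ℝ → 𝔸) : Prop where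
  continuous : Continuous (Function.uncurry P)
  continuous_inv : Continuous (Function.uncurry Q)
  zero : ∀ t, P t 0 = 1
  zero_inv : ∀ t, Q t 0 = 1
  hasDerivAt : ∀ t s, HasDerivAt (P t) (A t s * P t s) s
  hasDerivAt_inv : ∀ t s, HasDerivAt (Q t) (-(Q t s * A t s)) s
  inv_mul : ∀ t s, Q t s * P t s = 1
  mul_inv : ∀ t s, P t s * Q t s = 1

/-- `P` and `Q` are solved for separately; $(QP)'=0$ gives $QP=1$, and in finite dimension a left
inverse is also a right inverse. -/
theorem exists_isPropagator {F : Type*} [NormedAddCommGroup F] [NormedSpace ℝ F]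
    [FiniteDimensional ℝ F] {A : ℝ → ℝ → F →L[ℝ] F}
    (hA : Continuous (Function.uncurry A)) : ∃ P Q, IsPropagator A P Q := by
  have : CompleteSpace F := FiniteDimensional.complete ℝ F
  have h1 : Continuous (Function.uncurry fun t s ↦ ContinuousLinearMap.mul ℝ (F →L[ℝ] F) (A t s)) :=
    (ContinuousLinearMap.mul ℝ (F →L[ℝ] F)).continuous.comp hA
  have h2 : Continuous (Function.uncurry fun t s ↦ -(ContinuousLinearMap.mul ℝ (F →L[ℝ] F)).flip (A t s)) :=
    ((ContinuousLinearMap.mul ℝ (F →L[ℝ] F)).flip.continuous.comp hA).neg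
  obtain ⟨P, hP, hP0, hP'⟩ := exists_linearODE_solution h1 (1 : F →L[ℝ] F)
  obtain ⟨Q, hQ, hQ0, hQ'⟩ := exists_linearODE_solution h2 (1 : F →L[ℝ] F)
  have hP'' : ∀ t s, HasDerivAt (P t) (A t s * P t s) s := fun t s ↦ by simpa using hP' t s
  have hQ'' : ∀ t s, HasDerivAt (Q t) (-(Q t s * A t s)) s := fun t s ↦ by simpa using hQ' t s
  have hQP : ∀ t s, Q t s * P t s = 1 := by
    intro t s
    have h : ∀ s, HasDerivAt (fun s ↦ Q t s * P t s) 0 s := by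
      intro s
      have := (hQ'' t s).mul (hP'' t s)
      rw [neg_mul, mul_assoc, neg_add_cancel] at this
      exact this
    simpa [hP0, hQ0] using eq_of_hasDerivAt_zero h s 0
  have hPQ : ∀ t s, P t s * Q t s = 1 := by
    intro t s
    have h := congrArg (fun f : F →L[ℝ] F ↦ (f : F →ₗ[ℝ] F)) (hQP t s)
    ext v
    exact congrArg (fun f : F →ₗ[ℝ] F ↦ f v) ((mul_eq_one_comm (M := Module.End ℝ F)).1 h)
  exact ⟨P, Q, hP, hQ, hP0, hQ0, hP'', hQ'', hQP, hPQ⟩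

/-- The factor `K` extends the difference quotient continuously to `t₀`. -/
theorem hasDerivAt_of_eq_add_smul {X : Type*} [NormedAddCommGroup X] [NormedSpace ℝ X] {f K : ℝ → X}
    {t₀ : ℝ} (h : ∀ t, f t = f t₀ + (t - t₀) • K t) (hK : ContinuousAt K t₀) :
    HasDerivAt f (K t₀) t₀ := by
  rw [hasDerivAt_iff_tendsto_slope]
  refine (hK.tendsto.mono_left nhdsWithin_le_nhds).congr' ?_
  filter_upwards [self_mem_nhdsWithin] with t ht
  have ht' : t - t₀ ≠ 0 := sub_ne_zero.2 ht
  rw [slope_def_module, h t, add_sub_cancel_left, smul_smul, inv_mul_cancel₀ ht', one_smul]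

/-- Differentiation of the propagator with respect to the parameter. -/
theorem IsPropagator.hasDerivAt_param [CompleteSpace 𝔸] {A A' P Q : ℝ → ℝ → 𝔸}
    (h : IsPropagator A P Q) (hA : Continuous (Function.uncurry A))
    (hA' : Continuous (Function.uncurry A'))
    (hder : ∀ t s, HasDerivAt (fun t ↦ A t s) (A' t s) t) (t₀ s₀ : ℝ) :
    HasDerivAt (fun t ↦ P t s₀)
      (P t₀ s₀ * ∫ σ in (0 : ℝ)..s₀, Q t₀ σ * A' t₀ σ * P t₀ σ) t₀ := by
  have hP := h.continuous
  have hQ := h.continuous_inv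
  have hcP : ∀ t, Continuous (P t) := fun t ↦ hP.comp (by fun_prop : Continuous fun s : ℝ ↦ (t, s))
  have hcQ : ∀ t, Continuous (Q t) := fun t ↦ hQ.comp (by fun_prop : Continuous fun s : ℝ ↦ (t, s))
  have hcA : ∀ t, Continuous (A t) := fun t ↦ hA.comp (by fun_prop : Continuous fun s : ℝ ↦ (t, s))
  -- the difference quotient of `A`
  set D : ℝ → ℝ → 𝔸 := fun t σ ↦ ∫ θ in (0 : ℝ)..1, A' (t₀ + θ * (t - t₀)) σ with hD
  have hDc : Continuous (Function.uncurry D) := by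
    have : Continuous (Function.uncurry fun (p : ℝ × ℝ) (θ : ℝ) ↦ A' (t₀ + θ * (p.1 - t₀)) p.2) :=
      hA'.comp (by fun_prop :
        Continuous fun q : (ℝ × ℝ) × ℝ ↦ (t₀ + q.2 * (q.1.1 - t₀), q.1.2))
    exact intervalIntegral.continuous_parametric_intervalIntegral_of_continuous' this 0 1
  have hAD : ∀ t σ, A t σ - A t₀ σ = (t - t₀) • D t σ := by
    intro t σ
    have h1 : ∀ θ, HasDerivAt (fun θ ↦ A (t₀ + θ * (t - t₀)) σ)
        ((t - t₀) • A' (t₀ + θ * (t - t₀)) σ) θ := by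
      intro θ
      have h2 : HasDerivAt (fun θ : ℝ ↦ t₀ + θ * (t - t₀)) (t - t₀) θ := by
        simpa using ((hasDerivAt_id θ).mul_const (t - t₀)).const_add t₀
      exact HasDerivAt.scomp θ (hder (t₀ + θ * (t - t₀)) σ) h2
    have hc : Continuous fun θ ↦ A' (t₀ + θ * (t - t₀)) σ :=
      hA'.comp (by fun_prop : Continuous fun θ : ℝ ↦ (t₀ + θ * (t - t₀), σ))
    have h3 := intervalIntegral.integral_eq_sub_of_hasDerivAt (a := 0) (b := 1)
      (fun θ _ ↦ h1 θ) ((hc.const_smul (t - t₀)).intervalIntegrable _ _)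
    rw [intervalIntegral.integral_smul] at h3
    simp only [one_mul, zero_mul, add_zero, add_sub_cancel] at h3
    exact h3.symm
  -- Duhamel's formula
  have hduh : ∀ t, Q t₀ s₀ * P t s₀ = 1 + ∫ σ in (0 : ℝ)..s₀, Q t₀ σ * (A t σ - A t₀ σ) * P t σ := by
    intro t
    have h1 : ∀ s, HasDerivAt (fun s ↦ Q t₀ s * P t s) (Q t₀ s * (A t s - A t₀ s) * P t s) s := by
      intro s
      refine ((h.hasDerivAt_inv t₀ s).mul (h.hasDerivAt t s)).congr_deriv ?_
      noncomm_ring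
    have hc : Continuous fun s ↦ Q t₀ s * (A t s - A t₀ s) * P t s :=
      ((hcQ t₀).mul ((hcA t).sub (hcA t₀))).mul (hcP t)
    rw [intervalIntegral.integral_eq_sub_of_hasDerivAt (fun s _ ↦ h1 s)
      (hc.intervalIntegrable _ _), h.zero, h.zero_inv]
    simp
  have hK : Continuous fun t ↦ ∫ σ in (0 : ℝ)..s₀, Q t₀ σ * D t σ * P t σ := by
    have : Continuous (Function.uncurry fun t σ ↦ Q t₀ σ * D t σ * P t σ) :=
      (((hcQ t₀).comp continuous_snd).mul hDc).mul hP
    exact intervalIntegral.continuous_parametric_intervalIntegral_of_continuous' this 0 s₀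
  have hDA : ∀ σ, D t₀ σ = A' t₀ σ := by
    intro σ
    simp [hD]
  -- The expansion is exact, with `P t σ` still taken at the moving parameter, so continuity of the
  -- integrand replaces any remainder estimate.
  have := hasDerivAt_of_eq_add_smul (f := fun t ↦ P t s₀) (t₀ := t₀)
    (K := fun t ↦ P t₀ s₀ * ∫ σ in (0 : ℝ)..s₀, Q t₀ σ * D t σ * P t σ) ?_
    (continuous_const.mul hK).continuousAt
  · simpa only [hDA] using this
  · intro t
    have h1 : P t s₀ = P t₀ s₀ * (Q t₀ s₀ * P t s₀) := by rw [← mul_assoc, h.mul_inv, one_mul]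
    have h2 : (∫ σ in (0 : ℝ)..s₀, Q t₀ σ * (A t σ - A t₀ σ) * P t σ) =
        (t - t₀) • ∫ σ in (0 : ℝ)..s₀, Q t₀ σ * D t σ * P t σ := by
      rw [← intervalIntegral.integral_smul]
      simp only [hAD, mul_smul_comm, smul_mul_assoc]
    show P t s₀ = _
    rw [h1, hduh t, h2, mul_add, mul_one, mul_smul_comm]

theorem IsPropagator.hasDerivAt_inv_param [CompleteSpace 𝔸] {A P Q : ℝ → ℝ → 𝔸}
    (h : IsPropagator A P Q) {t₀ s₀ : ℝ} {P' : 𝔸} (hP : HasDerivAt (fun t ↦ P t s₀) P' t₀) :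
    HasDerivAt (fun t ↦ Q t s₀) (-(Q t₀ s₀ * P' * Q t₀ s₀)) t₀ := by
  let u : 𝔸ˣ := ⟨P t₀ s₀, Q t₀ s₀, h.mul_inv _ _, h.inv_mul _ _⟩
  have h1 := (hasFDerivAt_ringInverse (𝕜 := ℝ) u).comp_hasDerivAt t₀ (f := fun t ↦ P t s₀) hP
  have h2 : ∀ t, Ring.inverse (P t s₀) = Q t s₀ := fun t ↦
    Ring.inverse_unit ⟨P t s₀, Q t s₀, h.mul_inv _ _, h.inv_mul _ _⟩
  have h3 : (Ring.inverse ∘ fun t ↦ P t s₀) = fun t ↦ Q t s₀ := funext h2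
  rw [h3] at h1
  simpa [u] using h1

end Propagator

/-! ### Parallel transport along segments. -/

section SegmentTransport

/-- The product $QP_1$ has derivative zero and starts at $1$. The two parameters may differ, because
only the coefficient along each fixed parameter enters. -/
theorem IsPropagator.unique {𝔸 : Type*} [NormedRing 𝔸] [NormedAlgebra ℝ 𝔸] {A A₁ P Q P₁ Q₁ : ℝ → ℝ → 𝔸} (h : IsPropagator A P Q)
    (h₁ : IsPropagator A₁ P₁ Q₁) {t t₁ : ℝ} (hA : ∀ s, A t s = A₁ t₁ s) (s : ℝ) :
    P t s = P₁ t₁ s ∧ Q t s = Q₁ t₁ s := by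
  have h0 : ∀ s, HasDerivAt (fun s ↦ Q t s * P₁ t₁ s) 0 s := by
    intro s
    refine ((h.hasDerivAt_inv t s).mul (h₁.hasDerivAt t₁ s)).congr_deriv ?_
    rw [hA]
    noncomm_ring
  have h1 : Q t s * P₁ t₁ s = 1 := by
    rw [eq_of_hasDerivAt_zero h0 s 0, h.zero_inv, h₁.zero, one_mul]
  constructor
  · rw [← mul_one (P t s), ← h1, ← mul_assoc, h.mul_inv, one_mul]
  · rw [← one_mul (Q₁ t₁ s), ← h1, mul_assoc, h₁.mul_inv, mul_one]

theorem IsPropagator.rescale {𝔸 : Type*} [NormedRing 𝔸]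
    [NormedAlgebra ℝ 𝔸] {A P Q : ℝ → ℝ → 𝔸} (h : IsPropagator A P Q) (t s : ℝ) :
    IsPropagator (fun _ σ ↦ s • A t (σ * s)) (fun _ σ ↦ P t (σ * s)) (fun _ σ ↦ Q t (σ * s)) where
  continuous := h.continuous.comp (by fun_prop : Continuous fun p : ℝ × ℝ ↦ (t, p.2 * s))
  continuous_inv := h.continuous_inv.comp (by fun_prop : Continuous fun p : ℝ × ℝ ↦ (t, p.2 * s))
  zero _ := by simp [h.zero]
  zero_inv _ := by simp [h.zero_inv]
  hasDerivAt _ σ := by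
    have h1 : HasDerivAt (fun σ : ℝ ↦ σ * s) s σ := by simpa using (hasDerivAt_id σ).mul_const s
    refine (HasDerivAt.scomp σ (h.hasDerivAt t (σ * s)) h1).congr_deriv ?_
    rw [smul_mul_assoc]
  hasDerivAt_inv _ σ := by
    have h1 : HasDerivAt (fun σ : ℝ ↦ σ * s) s σ := by simpa using (hasDerivAt_id σ).mul_const s
    refine (HasDerivAt.scomp σ (h.hasDerivAt_inv t (σ * s)) h1).congr_deriv ?_
    rw [mul_smul_comm, smul_neg]
  inv_mul _ σ := h.inv_mul _ _
  mul_inv _ σ := h.mul_inv _ _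

variable {E : Type*} [NormedAddCommGroup E] [NormedSpace ℝ E]
  {F : Type*} [NormedAddCommGroup F] [NormedSpace ℝ F] [FiniteDimensional ℝ F]

theorem exists_segPropagator {Ω : E → E →L[ℝ] F →L[ℝ] F} (hΩ : Continuous Ω) (o w : E) :
    ∃ P Q, IsPropagator (fun _ s ↦ -Ω (o + s • w) w) P Q := by
  refine exists_isPropagator ?_
  have h1 : Continuous fun p : ℝ × ℝ ↦ o + p.2 • w := by fun_prop
  exact ((hΩ.comp h1).clm_apply continuous_const).neg

open Classical in
/-- The parallel transport of the connection `d + Ω` from `o` to `o + w` along the segment. -/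
def segTransport (Ω : E → E →L[ℝ] F →L[ℝ] F) (o w : E) : F →L[ℝ] F :=
  -- The value `1` for discontinuous `Ω` is a default that keeps the definition free of a proof
  -- argument.
  if h : Continuous Ω then (exists_segPropagator h o w).choose 0 1 else 1

open Classical in
/-- The inverse of `segTransport`. -/
def segTransportInv (Ω : E → E →L[ℝ] F →L[ℝ] F) (o w : E) : F →L[ℝ] F :=
  if h : Continuous Ω then (exists_segPropagator h o w).choose_spec.choose 0 1 else 1

/-- Running for time $s$ in direction $w$ is running for time $1$ in direction $sw$; uniqueness then
identifies any propagator with the chosen one. This lets families of segments be treated by one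
propagator depending on a parameter. -/
theorem IsPropagator.eq_segTransport {Ω : E → E →L[ℝ] F →L[ℝ] F} (hΩ : Continuous Ω)
    {A P Q : ℝ → ℝ → F →L[ℝ] F} (h : IsPropagator A P Q) {t s : ℝ} {o w : E}
    (hA : ∀ s, A t s = -Ω (o + s • w) w) :
    P t s = segTransport Ω o (s • w) ∧ Q t s = segTransportInv Ω o (s • w) := by
  have h1 := (exists_segPropagator hΩ o (s • w)).choose_spec.choose_spec
  have h2 := (h.rescale t s).unique h1 (t := 0) (t₁ := 0) (fun σ ↦ by
    rw [hA, map_smul, smul_neg, mul_smul]) 1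
  simp only [one_mul] at h2
  simpa only [segTransport, segTransportInv, hΩ, dite_true] using h2

theorem segTransportInv_mul {Ω : E → E →L[ℝ] F →L[ℝ] F} (hΩ : Continuous Ω) (o w : E) :
    segTransportInv Ω o w * segTransport Ω o w = 1 := by
  simpa only [segTransport, segTransportInv, hΩ, dite_true] using
    (exists_segPropagator hΩ o w).choose_spec.choose_spec.inv_mul 0 1

theorem segTransport_mul_inv {Ω : E → E →L[ℝ] F →L[ℝ] F} (hΩ : Continuous Ω) (o w : E) :
    segTransport Ω o w * segTransportInv Ω o w = 1 := by
  simpa only [segTransport, segTransportInv, hΩ, dite_true] using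
    (exists_segPropagator hΩ o w).choose_spec.choose_spec.mul_inv 0 1

theorem segTransport_zero {Ω : E → E →L[ℝ] F →L[ℝ] F} (hΩ : Continuous Ω) (o : E) :
    segTransport Ω o 0 = 1 := by
  obtain ⟨P, Q, h⟩ := exists_segPropagator hΩ o 0
  have := (h.eq_segTransport hΩ (t := 0) (s := 0) (fun _ ↦ rfl)).1
  rw [zero_smul] at this
  rw [← this, h.zero]

end SegmentTransport

/-! ### Uniqueness for solutions with finitely many exceptional times. -/

section Uniqueness

/-- The fundamental theorem of calculus tolerates a countable exceptional set. This matches parallel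
fields along piecewise smooth curves, which are differentiable only off a finite set. -/
theorem eq_of_hasDerivAt_zero_off_finite {X : Type*} [NormedAddCommGroup X] [NormedSpace ℝ X]
    [CompleteSpace X] {f : ℝ → X} {a b : ℝ} (hab : a ≤ b) (hf : ContinuousOn f (Icc a b)) {S : Set ℝ}
    (hS : S.Finite) (h : ∀ t ∈ Ioo a b \ S, HasDerivAt f 0 t) : f b = f a := by
  have := MeasureTheory.integral_eq_of_hasDerivAt_off_countable_of_le f (fun _ ↦ 0) hab
    hS.countable hf h (by simp)
  simpa [sub_eq_zero, eq_comm] using this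

/-- Variation of constants: the inverse propagator applied to a solution is constant. -/
theorem IsPropagator.inv_apply_eq {F : Type*} [NormedAddCommGroup F] [NormedSpace ℝ F]
    [CompleteSpace F] {A P Q : ℝ → ℝ → F →L[ℝ] F} (h : IsPropagator A P Q) {f : ℝ → F}
    {a b : ℝ} (hab : a ≤ b) (hf : ContinuousOn f (Icc a b)) {S : Set ℝ} (hS : S.Finite) (t : ℝ)
    (hf' : ∀ s ∈ Ioo a b \ S, HasDerivAt f (A t s (f s)) s) : Q t b (f b) = Q t a (f a) := by
  have hcQ : Continuous (Q t) := h.continuous_inv.comp (by fun_prop : Continuous fun s : ℝ ↦ (t, s))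
  refine eq_of_hasDerivAt_zero_off_finite (f := fun s ↦ Q t s (f s)) hab
    (hcQ.continuousOn.clm_apply hf) hS fun s hs ↦ ?_
  refine ((h.hasDerivAt_inv t s).clm_apply (hf' s hs)).congr_deriv ?_
  simp

theorem eq_zero_of_linearODE {F : Type*} [NormedAddCommGroup F] [NormedSpace ℝ F]
    [FiniteDimensional ℝ F] {M : ℝ → F →L[ℝ] F} (hM : Continuous M) {f : ℝ → F}
    {a b : ℝ} (hab : a ≤ b) (hf : ContinuousOn f (Icc a b)) {S : Set ℝ} (hS : S.Finite)
    (hf' : ∀ s ∈ Ioo a b \ S, HasDerivAt f (M s (f s)) s) (ha : f a = 0) : f b = 0 := by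
  have : CompleteSpace F := FiniteDimensional.complete ℝ F
  obtain ⟨P, Q, h⟩ := exists_isPropagator (A := fun _ s ↦ M s) (hM.comp continuous_snd)
  have h1 := h.inv_apply_eq hab hf hS 0 hf'
  rw [ha, map_zero] at h1
  have h2 := congrArg (P 0 b) h1
  have h3 := congrArg (fun T : F →L[ℝ] F ↦ T (f b)) (h.mul_inv 0 b)
  simpa [h1] using h3.symm

end Uniqueness

/-! ### Curvature and transport along a cone of segments. -/

section Cone

variable {E : Type*} [NormedAddCommGroup E] [NormedSpace ℝ E]
  {𝔸 : Type*} [NormedRing 𝔸] [NormedAlgebra ℝ 𝔸]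

/-- The curvature of the connection `d + Ω` on a trivial bundle over `E`. -/
def connCurvature (Ω : E → E →L[ℝ] 𝔸) (x X Y : E) : 𝔸 :=
  fderiv ℝ Ω x X Y - fderiv ℝ Ω x Y X + (Ω x X * Ω x Y - Ω x Y * Ω x X)

theorem hasDerivAt_conn_line {Ω : E → E →L[ℝ] 𝔸} (hΩ : ContDiff ℝ 1 Ω) {x : ℝ → E} {x' : E}
    {X : ℝ → E} {X' : E} {s : ℝ} (hx : HasDerivAt x x' s) (hX : HasDerivAt X X' s) :
    HasDerivAt (fun s ↦ Ω (x s) (X s)) (fderiv ℝ Ω (x s) x' (X s) + Ω (x s) X') s := by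
  have h1 := (hΩ.differentiable one_ne_zero (x s)).hasFDerivAt
  have h2 := h1.comp_hasDerivAt s hx
  exact h2.clm_apply hX

/-- `P` transports along the segments from `o` to `γ t`, in time `1`. The covariant derivative of
`P` along `γ` is an integral over the curvature. -/
theorem cone_formula [CompleteSpace 𝔸] {Ω : E → E →L[ℝ] 𝔸} (hΩ : ContDiff ℝ 1 Ω)
    (o : E) {γ γ' : ℝ → E} (hγ : ∀ t, HasDerivAt γ (γ' t) t) (hγ' : Continuous γ')
    {P Q : ℝ → ℝ → 𝔸}
    (h : IsPropagator (fun t s ↦ -Ω (o + s • (γ t - o)) (γ t - o)) P Q) (t : ℝ) :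
    HasDerivAt (fun t ↦ Q t 1)
      (Q t 1 * Ω (γ t) (γ' t) - (∫ s in (0 : ℝ)..1,
        Q t s * connCurvature Ω (o + s • (γ t - o)) (γ t - o) (s • γ' t) * P t s) * Q t 1) t := by
  have hγc : Continuous γ := continuous_iff_continuousAt.2 fun t ↦ (hγ t).continuousAt
  have hΩc := hΩ.continuous
  have hdΩ : Continuous (fderiv ℝ Ω) := hΩ.continuous_fderiv one_ne_zero
  set A' : ℝ → ℝ → 𝔸 := fun t s ↦
    -(fderiv ℝ Ω (o + s • (γ t - o)) (s • γ' t) (γ t - o) + Ω (o + s • (γ t - o)) (γ' t)) with hA'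
  have hA'c : Continuous (Function.uncurry A') := by
    simp only [hA', Function.uncurry_def]
    have e1 : Continuous fun p : ℝ × ℝ ↦ o + p.2 • (γ p.1 - o) := by fun_prop
    have e2 := hdΩ.comp e1
    have e3 := hΩc.comp e1
    exact (((e2.clm_apply (by fun_prop)).clm_apply (by fun_prop)).add
      (e3.clm_apply (by fun_prop))).neg
  have hAc : Continuous (Function.uncurry fun (t s : ℝ) ↦ -Ω (o + s • (γ t - o)) (γ t - o)) := by
    simp only [Function.uncurry_def]
    have e1 : Continuous fun p : ℝ × ℝ ↦ o + p.2 • (γ p.1 - o) := by fun_prop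
    exact ((hΩc.comp e1).clm_apply (by fun_prop)).neg
  have hder : ∀ t s, HasDerivAt (fun t ↦ -Ω (o + s • (γ t - o)) (γ t - o)) (A' t s) t := by
    intro t s
    exact (hasDerivAt_conn_line hΩ ((((hγ t).sub_const o).const_smul s).const_add o)
      ((hγ t).sub_const o)).neg
  have hP := h.hasDerivAt_param hAc hA'c hder t 1
  have hQ := h.hasDerivAt_inv_param hP
  have hcP : Continuous (P t) := h.continuous.comp (by fun_prop : Continuous fun s : ℝ ↦ (t, s))
  have hcQ : Continuous (Q t) := h.continuous_inv.comp (by fun_prop : Continuous fun s : ℝ ↦ (t, s))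
  have hcA' : Continuous (A' t) := hA'c.comp (by fun_prop : Continuous fun s : ℝ ↦ (t, s))
  -- The derivative in $s$ of $Q\,\Omega(s\gamma')P$ trades the integrand `A'` of the parameter
  -- derivative for the curvature. The boundary term at $s=0$ vanishes because of the factor $s$,
  -- and the one at $s=1$ yields the term $Q\,\Omega(\gamma')$.
  have hint : ∀ s, HasDerivAt (fun s ↦ Q t s * Ω (o + s • (γ t - o)) (s • γ' t) * P t s)
      (Q t s * connCurvature Ω (o + s • (γ t - o)) (γ t - o) (s • γ' t) * P t s -
        Q t s * A' t s * P t s) s := by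
    intro s
    have h1 : HasDerivAt (fun s : ℝ ↦ o + s • (γ t - o)) (γ t - o) s := by
      simpa using ((hasDerivAt_id s).smul_const (γ t - o)).const_add o
    have h2 : HasDerivAt (fun s : ℝ ↦ s • γ' t) (γ' t) s := by
      simpa using (hasDerivAt_id s).smul_const (γ' t)
    refine (((h.hasDerivAt_inv t s).mul (hasDerivAt_conn_line hΩ h1 h2)).mul
      (h.hasDerivAt t s)).congr_deriv ?_
    simp only [connCurvature, hA', Pi.mul_apply]
    noncomm_ring
  have hcR : Continuous fun s : ℝ ↦ connCurvature Ω (o + s • (γ t - o)) (γ t - o) (s • γ' t) := by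
    have e1 : Continuous fun s : ℝ ↦ o + s • (γ t - o) := by fun_prop
    have e2 := hdΩ.comp e1
    have e3 := hΩc.comp e1
    unfold connCurvature
    exact (((e2.clm_apply (by fun_prop)).clm_apply (by fun_prop)).sub
      ((e2.clm_apply (by fun_prop)).clm_apply (by fun_prop))).add
      (((e3.clm_apply (by fun_prop)).mul (e3.clm_apply (by fun_prop))).sub
      ((e3.clm_apply (by fun_prop)).mul (e3.clm_apply (by fun_prop))))
  have i1 : IntervalIntegrable (fun s ↦ Q t s * connCurvature Ω (o + s • (γ t - o)) (γ t - o)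
      (s • γ' t) * P t s) MeasureTheory.volume 0 1 :=
    ((hcQ.mul hcR).mul hcP).intervalIntegrable 0 1
  have i2 : IntervalIntegrable (fun s ↦ Q t s * A' t s * P t s) MeasureTheory.volume 0 1 :=
    ((hcQ.mul hcA').mul hcP).intervalIntegrable 0 1
  have hI := intervalIntegral.integral_eq_sub_of_hasDerivAt (a := 0) (b := 1)
    (fun s _ ↦ hint s) (i1.sub i2)
  rw [intervalIntegral.integral_sub i1 i2] at hI
  simp only [one_smul, zero_smul, map_zero, mul_zero, zero_mul, sub_zero,
    add_sub_cancel] at hI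
  convert hQ using 1
  rw [← mul_assoc (Q t 1), h.inv_mul, one_mul]
  rw [sub_eq_iff_eq_add] at hI
  rw [hI, add_mul, mul_assoc _ (P t 1), h.mul_inv]
  noncomm_ring

end Cone

/-! ### Parallel fields compared with radial transport, modulo a subspace. -/

section ConeTransport

variable {E : Type*} [NormedAddCommGroup E] [NormedSpace ℝ E]
  {F : Type*} [NormedAddCommGroup F] [NormedSpace ℝ F]

/-- The one-sided derivative is extended by its end values and integrated; `cone_formula` asks for a
curve differentiable on all of `ℝ`. -/
theorem exists_C1_extension [CompleteSpace E] {γ : ℝ → E} {a b : ℝ} (hab : a < b)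
    (hγ : ContDiffOn ℝ 1 γ (Icc a b)) : ∃ c c' : ℝ → E, Continuous c' ∧
      (∀ t, HasDerivAt c (c' t) t) ∧ EqOn c γ (Icc a b) := by
  have hd : ContinuousOn (derivWithin γ (Icc a b)) (Icc a b) :=
    hγ.continuousOn_derivWithin (uniqueDiffOn_Icc hab) le_rfl
  set c' : ℝ → E := IccExtend hab.le ((Icc a b).domRestrict (derivWithin γ (Icc a b))) with hc'
  have hc'c : Continuous c' := hd.domRestrict.Icc_extend' (h := hab.le)
  refine ⟨fun t ↦ γ a + ∫ s in a..t, c' s, c', hc'c, fun t ↦ ?_, fun t ht ↦ ?_⟩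
  · exact (intervalIntegral.integral_hasDerivAt_right (hc'c.intervalIntegrable _ _)
      (hc'c.stronglyMeasurableAtFilter _ _) hc'c.continuousAt).const_add _
  · have h1 : ∫ s in a..t, c' s = γ t - γ a := by
      refine intervalIntegral.integral_eq_sub_of_hasDerivAt_of_le ht.1
        (hγ.continuousOn.mono (Icc_subset_Icc_right ht.2)) (fun s hs ↦ ?_)
        (hc'c.intervalIntegrable _ _)
      have hs' : s ∈ Ioo a b := ⟨hs.1, hs.2.trans_le ht.2⟩
      have h2 := (hγ.differentiableOn one_ne_zero s (Ioo_subset_Icc_self hs')).hasDerivWithinAt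
      rw [hc', IccExtend_of_mem _ _ (Ioo_subset_Icc_self hs')]
      exact h2.hasDerivAt (Icc_mem_nhds hs'.1 hs'.2)
    show γ a + ∫ s in a..t, c' s = γ t
    rw [h1]
    abel

/-- The kernel of `p` is `Ξ`, so congruence modulo `Ξ` becomes an equation in `F` that can be
differentiated, with no quotient space. -/
theorem exists_projection_along [FiniteDimensional ℝ F] (Ξ : Submodule ℝ F) :
    ∃ p : F →L[ℝ] F, (∀ x, p x = 0 ↔ x ∈ Ξ) ∧ ∀ x, x - p x ∈ Ξ := by
  obtain ⟨C, hC⟩ := Ξ.exists_isCompl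
  refine ⟨LinearMap.toContinuousLinearMap
    (C.subtype ∘ₗ Submodule.projectionOnto C Ξ hC.symm), fun x ↦ ?_, fun x ↦ ?_⟩
  · simp
  · have h := Submodule.projection_add_projection_eq_self hC.symm x
    have h1 : x - C.projection Ξ hC.symm x = Ξ.projection C hC x := by
      rw [sub_eq_iff_eq_add', h]
    have h2 : x - C.projection Ξ hC.symm x ∈ Ξ := by
      rw [h1]
      exact Submodule.coe_mem _
    simpa using h2

theorem continuous_connCurvature {𝔸 : Type*} [NormedRing 𝔸] [NormedAlgebra ℝ 𝔸]
    {Ω : E → E →L[ℝ] 𝔸} (hΩ : ContDiff ℝ 1 Ω) {T : Type*} [TopologicalSpace T] {x X Y : T → E}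
    (hx : Continuous x) (hX : Continuous X) (hY : Continuous Y) :
    Continuous fun t ↦ connCurvature Ω (x t) (X t) (Y t) := by
  have e2 : Continuous fun t ↦ fderiv ℝ Ω (x t) := (hΩ.continuous_fderiv one_ne_zero).comp hx
  have e3 : Continuous fun t ↦ Ω (x t) := hΩ.continuous.comp hx
  exact (((e2.clm_apply hX).clm_apply hY).sub ((e2.clm_apply hY).clm_apply hX)).add
    (((e3.clm_apply hX).mul (e3.clm_apply hY)).sub ((e3.clm_apply hY).mul (e3.clm_apply hX)))

/-- A field which is parallel along a curve is compared with the parallel transport along the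
segments from the point `o`, modulo a subspace which absorbs the curvature. -/
theorem segTransportInv_sub_mem [FiniteDimensional ℝ F] [FiniteDimensional ℝ E]
    {Ω : E → E →L[ℝ] F →L[ℝ] F}
    (hΩ : ContDiff ℝ 1 Ω) (o : E) {γ : ℝ → E} {a b : ℝ} (hab : a < b)
    (hγ : ContDiffOn ℝ 1 γ (Icc a b)) {u : ℝ → F} (hu : ContinuousOn u (Icc a b))
    {S : Set ℝ} (hS : S.Finite)
    (hu' : ∀ t ∈ Ioo a b \ S, HasDerivAt u (-Ω (γ t) (deriv γ t) (u t)) t)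
    (z : F) (Ξ : Submodule ℝ F)
    (hflat : ∀ t ∈ Icc a b, ∀ s ∈ Icc (0 : ℝ) 1, ∀ X Y : E, ∀ x : F, (x = z ∨ x ∈ Ξ) →
      segTransportInv Ω o (s • (γ t - o)) (connCurvature Ω (o + s • (γ t - o)) X Y
        (segTransport Ω o (s • (γ t - o)) x)) ∈ Ξ)
    (ha : segTransportInv Ω o (γ a - o) (u a) - z ∈ Ξ) :
    segTransportInv Ω o (γ b - o) (u b) - z ∈ Ξ := by
  have : CompleteSpace F := FiniteDimensional.complete ℝ F
  have : CompleteSpace E := FiniteDimensional.complete ℝ E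
  obtain ⟨c, c', hc', hcd, hcγ⟩ := exists_C1_extension hab hγ
  have hcc : Continuous c := continuous_iff_continuousAt.2 fun t ↦ (hcd t).continuousAt
  have hΩc := hΩ.continuous
  have hAc : Continuous (Function.uncurry fun (t s : ℝ) ↦ -Ω (o + s • (c t - o)) (c t - o)) := by
    simp only [Function.uncurry_def]
    have e1 : Continuous fun p : ℝ × ℝ ↦ o + p.2 • (c p.1 - o) := by fun_prop
    exact ((hΩc.comp e1).clm_apply (by fun_prop)).neg
  obtain ⟨P, Q, h⟩ := exists_isPropagator hAc
  have hPQ : ∀ t s, P t s = segTransport Ω o (s • (c t - o)) ∧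
      Q t s = segTransportInv Ω o (s • (c t - o)) := fun t s ↦
    h.eq_segTransport hΩc (fun _ ↦ rfl)
  obtain ⟨p, hp, hp'⟩ := exists_projection_along Ξ
  set R : ℝ → ℝ → F →L[ℝ] F := fun t s ↦
    Q t s * connCurvature Ω (o + s • (c t - o)) (c t - o) (s • c' t) * P t s with hR
  have hRc : Continuous (Function.uncurry R) := by
    have e1 : Continuous fun q : ℝ × ℝ ↦ o + q.2 • (c q.1 - o) := by fun_prop
    have x1 : Continuous fun q : ℝ × ℝ ↦ c q.1 - o := by fun_prop
    have x2 : Continuous fun q : ℝ × ℝ ↦ q.2 • c' q.1 := by fun_prop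
    have e4 := continuous_connCurvature hΩ e1 x1 x2
    exact (h.continuous_inv.mul e4).mul h.continuous
  set K : ℝ → F →L[ℝ] F := fun t ↦ ∫ s in (0 : ℝ)..1, R t s with hK
  have hKc : Continuous K :=
    intervalIntegral.continuous_parametric_intervalIntegral_of_continuous' hRc 0 1
  have hKmem : ∀ t ∈ Icc a b, ∀ x, (x = z ∨ x ∈ Ξ) → p (K t x) = 0 := by
    intro t ht x hx
    have hRt : Continuous (R t) := hRc.comp (by fun_prop : Continuous fun s : ℝ ↦ (t, s))
    rw [hK, ← ContinuousLinearMap.comp_apply,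
      show p.comp (∫ s in (0 : ℝ)..1, R t s) = ∫ s in (0 : ℝ)..1, p.comp (R t s) from
        ((ContinuousLinearMap.compL ℝ F F F p).intervalIntegral_comp_comm
          (hRt.intervalIntegrable 0 1)).symm,
      ContinuousLinearMap.intervalIntegral_apply
        ((continuous_const.clm_comp hRt).intervalIntegrable 0 1)]
    rw [intervalIntegral.integral_congr (g := fun _ ↦ (0 : F)), intervalIntegral.integral_zero]
    intro s hs
    rw [uIcc_of_le zero_le_one] at hs
    have h1 := hflat t ht s hs (c t - o) (s • c' t) x hx
    rw [← hcγ ht, ← (hPQ t s).1, ← (hPQ t s).2] at h1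
    exact (hp _).2 h1
  have hcone := cone_formula hΩ o hcd hc' h
  have hQc : Continuous fun t ↦ Q t 1 :=
    h.continuous_inv.comp (by fun_prop : Continuous fun t : ℝ ↦ (t, (1 : ℝ)))
  -- Since the curvature integral `K` sends `z` and `Ξ` into `Ξ`, the class of $Qu-z$ satisfies the
  -- closed homogeneous equation $y'=-pKy$, and it starts at zero.
  have hfin : p (Q b 1 (u b) - z) = 0 := by
    refine eq_zero_of_linearODE (M := fun t ↦ -(p.comp (K t))) (f := fun t ↦ p (Q t 1 (u t) - z))
      ((continuous_const.clm_comp hKc).neg) hab.le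
      (p.continuous.comp_continuousOn ((hQc.continuousOn.clm_apply hu).sub continuousOn_const))
      hS (fun t ht ↦ ?_) ?_
    · have htI := Ioo_subset_Icc_self ht.1
      have hev : c =ᶠ[𝓝 t] γ := by
        filter_upwards [Icc_mem_nhds ht.1.1 ht.1.2] with s hs using hcγ hs
      have hder : deriv γ t = c' t := by rw [← hev.deriv_eq]; exact (hcd t).deriv
      have h1 := hu' t ht
      rw [← hcγ htI, hder] at h1
      have h2 := p.hasFDerivAt.comp_hasDerivAt t (((hcone t).clm_apply h1).sub_const z)
      refine h2.congr_deriv ?_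
      -- Splits $Qu$ into the projected difference, a vector of `Ξ`, and `z`; the last two
      -- contribute nothing modulo `Ξ`.
      have h3 : K t (Q t 1 (u t)) = K t (p (Q t 1 (u t) - z)) +
          (K t (Q t 1 (u t) - z - p (Q t 1 (u t) - z)) + K t z) := by
        rw [← map_add, ← map_add]
        congr 1
        abel
      have h4 : p (K t (Q t 1 (u t))) = p (K t (p (Q t 1 (u t) - z))) := by
        rw [h3, map_add, map_add, hKmem t htI z (Or.inl rfl), hKmem t htI _ (Or.inr (hp' _)),
          add_zero, add_zero]
      rw [neg_apply, ContinuousLinearMap.comp_apply, ← h4]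
      simp [hK, hR]
      abel
    · have h1 := (hPQ a 1).2
      rw [one_smul, hcγ (left_mem_Icc.2 hab.le)] at h1
      rw [h1]
      exact (hp _).2 ha
  have h1 := (hPQ b 1).2
  rw [one_smul, hcγ (right_mem_Icc.2 hab.le)] at h1
  rw [h1] at hfin
  exact (hp _).1 hfin

end ConeTransport

/-! ### The curvature tensor built from commutators of shape operators. -/

section ScreenAlgebra

/-- The scalar product of commutators of symmetric matrices satisfies the Bianchi identity. -/
theorem sum_commutator_mul_commutator_cyclic {n : Type*} [Fintype n] {A B C D : Matrix n n ℝ}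
    (hC : C.IsSymm) (hD : D.IsSymm) (hB : B.IsSymm) (hA : A.IsSymm) :
    (∑ i, ∑ k, (A * B - B * A) i k * (C * D - D * C) i k) +
      (∑ i, ∑ k, (B * C - C * B) i k * (A * D - D * A) i k) +
      (∑ i, ∑ k, (C * A - A * C) i k * (B * D - D * B) i k) = 0 := by
  -- A commutator of symmetric matrices is skew, which turns the entrywise product into minus a
  -- trace.
  have h : ∀ X Y U V : Matrix n n ℝ, U.IsSymm → V.IsSymm →
      (∑ i, ∑ k, (X * Y - Y * X) i k * (U * V - V * U) i k) =
        -((X * Y - Y * X) * (U * V - V * U)).trace := by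
    intro X Y U V hU hV
    have ht : (U * V - V * U).transpose = -(U * V - V * U) := by
      rw [Matrix.transpose_sub, Matrix.transpose_mul, Matrix.transpose_mul, hU.eq, hV.eq, neg_sub]
    rw [Matrix.trace, ← Finset.sum_neg_distrib]
    refine Finset.sum_congr rfl fun i _ ↦ ?_
    rw [Matrix.diag_apply, Matrix.mul_apply, ← Finset.sum_neg_distrib]
    refine Finset.sum_congr rfl fun k _ ↦ ?_
    have := congrFun (congrFun ht i) k
    rw [Matrix.transpose_apply, Matrix.neg_apply] at this
    rw [this, mul_neg, neg_neg]
  rw [h _ _ _ _ hC hD, h _ _ _ _ hA hD, h _ _ _ _ hB hD]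
  -- Invariance of the trace form isolates `D`, so that the cyclic sum of what remains is a Jacobi
  -- sum.
  have cyc : ∀ Z U V : Matrix n n ℝ,
      (Z * (U * V - V * U)).trace = ((Z * U - U * Z) * V).trace := by
    intro Z U V
    rw [mul_sub, sub_mul, Matrix.trace_sub, Matrix.trace_sub, mul_assoc Z, mul_assoc U Z V,
      Matrix.trace_mul_comm U, mul_assoc Z V U]
  rw [cyc, cyc, cyc, ← neg_add, ← neg_add, ← Matrix.trace_add, ← Matrix.trace_add, ← add_mul,
    ← add_mul]
  have : (A * B - B * A) * C - C * (A * B - B * A) + ((B * C - C * B) * A - A * (B * C - C * B)) +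
    ((C * A - A * C) * B - B * (C * A - A * C)) = 0 := by noncomm_ring
  rw [this]
  simp

variable {V : Type*} [NormedAddCommGroup V] [InnerProductSpace ℝ V]

/-- The tensor `∑ [𝒜 a, 𝒜 b]ᵢₖ Bᵢₖ`. -/
def commutatorTensor {n : Type*} [Fintype n] (𝒜 : V →ₗ[ℝ] Matrix n n ℝ)
    (B : n → n → Module.End ℝ V) : V →ₗ[ℝ] V →ₗ[ℝ] Module.End ℝ V :=
  LinearMap.mk₂ ℝ
    (fun a b ↦ ∑ i, ∑ k, (𝒜 a * 𝒜 b - 𝒜 b * 𝒜 a) i k • B i k)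
    (by
      intro a a' b
      simp only [← Finset.sum_add_distrib, ← add_smul]
      refine Finset.sum_congr rfl fun i _ ↦ Finset.sum_congr rfl fun k _ ↦ ?_
      congr 1
      simp only [map_add, add_mul, mul_add, Matrix.sub_apply, Matrix.add_apply]
      ring)
    (by
      intro c a b
      simp only [Finset.smul_sum, smul_smul]
      refine Finset.sum_congr rfl fun i _ ↦ Finset.sum_congr rfl fun k _ ↦ ?_
      congr 1
      simp only [map_smul, smul_mul_assoc, mul_smul_comm, Matrix.sub_apply, Matrix.smul_apply,
        smul_eq_mul]
      ring)
    (by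
      intro a b b'
      simp only [← Finset.sum_add_distrib, ← add_smul]
      refine Finset.sum_congr rfl fun i _ ↦ Finset.sum_congr rfl fun k _ ↦ ?_
      congr 1
      simp only [map_add, add_mul, mul_add, Matrix.sub_apply, Matrix.add_apply]
      ring)
    (by
      intro c a b
      simp only [Finset.smul_sum, smul_smul]
      refine Finset.sum_congr rfl fun i _ ↦ Finset.sum_congr rfl fun k _ ↦ ?_
      congr 1
      simp only [map_smul, smul_mul_assoc, mul_smul_comm, Matrix.sub_apply, Matrix.smul_apply,
        smul_eq_mul]
      ring)

/-- Suppose that the operators `B i k` in an algebra with the Borel-Lichnérowicz property have the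
components of the commutators `[𝒜 c, 𝒜 d]` as their matrix coefficients. If there are no algebraic
curvature tensors with values in the `j`-th factor, then these operators vanish on the `j`-th
summand. -/
theorem IsBorelLichnerowicz.apply_eq_zero_of_curvatureTensors_eq_bot
    {𝔤 : Submodule ℝ (Module.End ℝ V)} {ℓ : ℕ}
    {W : Fin (ℓ + 1) → Submodule ℝ V} {h : Fin ℓ → LieSubalgebra ℝ (Module.End ℝ V)}
    (hBL : IsBorelLichnerowicz 𝔤 W h) (j : Fin ℓ) (hK : curvatureTensors (h j) = ⊥)
    {n : Type*} [Fintype n] (𝒜 : V →ₗ[ℝ] Matrix n n ℝ) (h𝒜 : ∀ x, (𝒜 x).IsSymm)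
    (B : n → n → Module.End ℝ V) (hB : ∀ i k, B i k ∈ 𝔤)
    (hB𝒜 : ∀ i k c d, inner ℝ (B i k c) d = (𝒜 c * 𝒜 d - 𝒜 d * 𝒜 c) i k)
    {z : V} (hz : z ∈ W j.succ) (i k : n) : B i k z = 0 := by
  classical
  obtain ⟨hind, htop⟩ :=
    (DirectSum.isInternal_submodule_iff_iSupIndep_and_iSup_eq_top W).1 hBL.isInternal
  set U : Submodule ℝ V := ⨆ (i) (_ : i ≠ j.succ), W i with hU
  have hcompl : IsCompl (W j.succ) U := by
    refine ⟨hind j.succ, codisjoint_iff.2 (top_le_iff.1 ?_)⟩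
    rw [← htop]
    refine iSup_le fun i ↦ ?_
    by_cases hi : i = j.succ
    · rw [hi]; exact le_sup_left
    · exact le_sup_of_le_right (le_iSup₂_of_le i hi le_rfl)
  -- the algebra preserves the summands
  have hpres : ∀ A ∈ 𝔤, ∀ i, ∀ x ∈ W i, A x ∈ W i := by
    intro A hA i x hx
    rw [← hBL.iSup_eq] at hA
    refine Submodule.iSup_induction _ (motive := fun A : Module.End ℝ V ↦ A x ∈ W i) hA ?_ ?_ ?_
    · intro m A hA
      by_cases him : i = m.succ
      · subst him
        exact (hBL.irreducible m).invariant A hA x hx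
      · rw [hBL.trivial m i him A hA x hx]
        exact zero_mem _
    · exact zero_mem _
    · intro A A' h1 h2
      exact add_mem h1 h2
  have hpresU : ∀ A ∈ 𝔤, ∀ x ∈ U, A x ∈ U := by
    intro A hA x hx
    have hle : U ≤ U.comap A := by
      refine iSup₂_le fun i hi y hy ↦ ?_
      exact (le_iSup₂_of_le (f := fun i (_ : i ≠ j.succ) ↦ W i) i hi le_rfl) (hpres A hA i y hy)
    exact hle hx
  set p : Module.End ℝ V := (W j.succ).projection U hcompl with hp
  have hpmem : ∀ x, p x ∈ W j.succ := fun x ↦ Submodule.projection_apply_mem hcompl x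
  have hpid : ∀ x ∈ W j.succ, p x = x := fun x hx ↦
    Submodule.projection_apply_left hcompl ⟨x, hx⟩
  have hpU : ∀ x, x - p x ∈ U := fun x ↦ by
    have h1 := Submodule.projection_add_projection_eq_self hcompl x
    have h2 : x - p x = U.projection _ hcompl.symm x := by
      rw [sub_eq_iff_eq_add', hp, h1]
    rw [h2]
    exact Submodule.projection_apply_mem hcompl.symm x
  -- Composing with the projection extracts the `h j`-component: this factor kills `U`, and the
  -- other factors kill `W j.succ`.
  have hgp : ∀ A ∈ 𝔤, A * p ∈ h j := by
    intro A hA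
    rw [← hBL.iSup_eq] at hA
    refine Submodule.iSup_induction _ (motive := fun A : Module.End ℝ V ↦ A * p ∈ h j) hA ?_ ?_ ?_
    · intro m A hA
      by_cases hm : m = j
      · subst hm
        have h1 : A * p = A := by
          ext x
          have h2 : U ≤ LinearMap.ker A := iSup₂_le fun i hi y hy ↦ hBL.trivial m i hi A hA y hy
          have h3 := h2 (hpU x)
          rw [LinearMap.mem_ker, map_sub, sub_eq_zero] at h3
          exact h3.symm
        rw [h1]
        exact hA
      · have h1 : A * p = 0 := by
          ext x
          refine hBL.trivial m _ (fun h ↦ hm ?_) A hA _ (hpmem x)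
          exact (Fin.succ_injective _ h).symm
        rw [h1]
        exact zero_mem _
    · rw [zero_mul]
      exact zero_mem _
    · intro A A' h1 h2
      rw [add_mul]
      exact add_mem h1 h2
  -- the curvature tensor
  set s : V → V → n → n → ℝ := fun a b i k ↦ (𝒜 a * 𝒜 b - 𝒜 b * 𝒜 a) i k with hs
  set R := commutatorTensor 𝒜 B with hR
  have hRapp : ∀ a b, R a b = ∑ i, ∑ k, s a b i k • B i k := fun a b ↦ rfl
  have hRg : ∀ a b, R a b ∈ 𝔤 := fun a b ↦ by
    rw [hRapp]
    exact sum_mem fun i _ ↦ sum_mem fun k _ ↦ Submodule.smul_mem _ _ (hB i k)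
  have hRin : ∀ a b c d, inner ℝ (R a b c) d = ∑ i, ∑ k, s a b i k * s c d i k := by
    intro a b c d
    rw [hRapp]
    simp only [LinearMap.sum_apply, LinearMap.smul_apply, sum_inner, inner_smul_left, hB𝒜]
    rfl
  -- The same matrices `𝒜` supply both the weights and the matrix coefficients of `B`, which makes
  -- the expression symmetric in the two pairs.
  have hpair : ∀ a b c d, inner ℝ (R a b c) d = inner ℝ (R c d a) b := by
    intro a b c d
    rw [hRin, hRin]
    simp only [mul_comm]
  have hbianchi : ∀ a b c, R a b c + R b c a + R c a b = 0 := by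
    intro a b c
    refine ext_inner_right ℝ fun d ↦ ?_
    rw [inner_add_left, inner_add_left, hRin, hRin, hRin, inner_zero_left]
    exact sum_commutator_mul_commutator_cyclic (h𝒜 c) (h𝒜 d) (h𝒜 b) (h𝒜 a)
  -- All three arguments are projected: this puts the values in `h j` and keeps the Bianchi
  -- identity.
  obtain ⟨R', hR'app'⟩ : ∃ R' : V →ₗ[ℝ] V →ₗ[ℝ] Module.End ℝ V,
      ∀ a b, R' a b = R (p a) (p b) * p :=
    ⟨(R.compl₁₂ p p).compr₂ (LinearMap.mulRight ℝ p), fun a b ↦ rfl⟩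
  have hR'app : ∀ a b c, R' a b c = R (p a) (p b) (p c) := fun a b c ↦ by rw [hR'app']; rfl
  have hR' : R' ∈ curvatureTensors (h j) := by
    refine ⟨fun x ↦ ?_, fun x y ↦ hR'app' x y ▸ hgp _ (hRg _ _), fun x y z ↦ ?_⟩
    · ext c
      rw [hR'app, hRapp]
      simp [hs]
    · rw [hR'app, hR'app, hR'app]
      exact hbianchi _ _ _
  rw [hK, Submodule.mem_bot] at hR'
  have hR0 : ∀ a ∈ W j.succ, ∀ b ∈ W j.succ, ∀ c ∈ W j.succ, R a b c = 0 := by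
    intro a ha b hb c hc
    have := hR'app a b c
    rw [hR', hpid a ha, hpid b hb, hpid c hc] at this
    exact this.symm
  -- The value is in `U` by invariance and in `W j.succ` by the Bianchi identity.
  have hRU : ∀ a ∈ W j.succ, ∀ b ∈ W j.succ, ∀ x ∈ U, R a b x = 0 := by
    intro a ha b hb x hx
    have h1 : R a b x ∈ U := hpresU _ (hRg a b) x hx
    have h2 : R a b x ∈ W j.succ := by
      have h3 := hbianchi a b x
      have h4 : R a b x = -(R b x a + R x a b) := by
        rw [eq_neg_iff_add_eq_zero, ← add_assoc, h3]
      rw [h4]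
      exact neg_mem (add_mem (hpres _ (hRg b x) _ a ha) (hpres _ (hRg x a) _ b hb))
    exact (Submodule.disjoint_def.1 hcompl.disjoint) _ h2 h1
  -- The value is in `W j.succ`, so it suffices to pair it with that summand, and pair symmetry
  -- moves `z` into the first two slots. Orthogonality of the summands is not needed.
  have hRz : ∀ x y, R x y z = 0 := by
    intro x y
    have h1 : R x y z ∈ W j.succ := hpres _ (hRg x y) _ z hz
    have h2 : ∀ u ∈ W j.succ, inner ℝ (R x y z) u = 0 := by
      intro u hu
      rw [hpair]
      have h3 : R z u x = R z u (p x) + R z u (x - p x) := by rw [← map_add]; simp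
      rw [h3, hR0 z hz u hu _ (hpmem x), hRU z hz u hu _ (hpU x), add_zero, inner_zero_left]
    exact inner_self_eq_zero.1 (h2 _ h1)
  refine ext_inner_right ℝ fun u ↦ ?_
  -- Here both pairs coincide and the expression is a sum of squares, so every single commutator
  -- entry vanishes.
  have h1 := hRin z u z u
  rw [hRz, inner_zero_left, eq_comm, Finset.sum_eq_zero_iff_of_nonneg
    (fun i _ ↦ Finset.sum_nonneg fun k _ ↦ mul_self_nonneg _)] at h1
  have h2 := (Finset.sum_eq_zero_iff_of_nonneg (fun k _ ↦ mul_self_nonneg _)).1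
    (h1 i (Finset.mem_univ i)) k (Finset.mem_univ k)
  rw [hB𝒜, inner_zero_left]
  exact mul_self_eq_zero.1 h2

end ScreenAlgebra

/-! ### Metric, connection and curvature in a chart of the ambient space. -/

section Coordinates

variable {F : Type*} [NormedAddCommGroup F] [NormedSpace ℝ F]
  {N : Type*} [TopologicalSpace N] [ChartedSpace F N] [IsManifold 𝓘(ℝ, F) ∞ N]

/-- The coordinates of the tangent vectors at `y` in the chart at `y₀`. -/
def toCoord (y₀ y : N) : TangentSpace 𝓘(ℝ, F) y →L[ℝ] F :=
  (trivializationAt F (TangentSpace 𝓘(ℝ, F) : N → Type _) y₀).continuousLinearMapAt ℝ y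

/-- The tangent vectors at `y` with given coordinates in the chart at `y₀`. -/
def ofCoord (y₀ y : N) : F →L[ℝ] TangentSpace 𝓘(ℝ, F) y :=
  (trivializationAt F (TangentSpace 𝓘(ℝ, F) : N → Type _) y₀).symmL ℝ y

theorem mem_trivializationAt_baseSet {y₀ y : N} (hy : y ∈ (chartAt F y₀).source) :
    y ∈ (trivializationAt F (TangentSpace 𝓘(ℝ, F) : N → Type _) y₀).baseSet := by
  rwa [TangentBundle.trivializationAt_baseSet]

theorem toCoord_ofCoord {y₀ y : N} (hy : y ∈ (chartAt F y₀).source) (a : F) :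
    toCoord y₀ y (ofCoord y₀ y a) = a :=
  Trivialization.continuousLinearMapAt_symmL _ (mem_trivializationAt_baseSet hy) a

theorem ofCoord_toCoord {y₀ y : N} (hy : y ∈ (chartAt F y₀).source)
    (v : TangentSpace 𝓘(ℝ, F) y) : ofCoord y₀ y (toCoord y₀ y v) = v :=
  Trivialization.symmL_continuousLinearMapAt _ (mem_trivializationAt_baseSet hy) v

theorem trivializationAt_snd {y₀ y : N} (hy : y ∈ (chartAt F y₀).source)
    (v : TangentSpace 𝓘(ℝ, F) y) :
    (trivializationAt F (TangentSpace 𝓘(ℝ, F) : N → Type _) y₀ ⟨y, v⟩).2 = toCoord y₀ y v :=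
  (Trivialization.continuousLinearMapAt_apply_of_mem _ _ (mem_trivializationAt_baseSet hy) v).symm

theorem ofCoord_eq_symm {y₀ y : N} (hy : y ∈ (chartAt F y₀).source) (a : F) :
    ofCoord y₀ y a = (trivializationAt F (TangentSpace 𝓘(ℝ, F) : N → Type _) y₀).symm y a :=
  Trivialization.symmL_apply _ (mem_trivializationAt_baseSet hy) a

theorem chart_source_mem_nhds {y₀ y : N} (hy : y ∈ (chartAt F y₀).source) :
    (chartAt F y₀).source ∈ 𝓝 y := (chartAt F y₀).open_source.mem_nhds hy

theorem mdifferentiableAt_ofCoord_iff {y₀ y : N} (hy : y ∈ (chartAt F y₀).source) {β : N → F} :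
    MDifferentiableAt 𝓘(ℝ, F) 𝓘(ℝ, F).tangent
      (fun z ↦ (⟨z, ofCoord y₀ z (β z)⟩ : TangentBundle 𝓘(ℝ, F) N)) y ↔
    MDifferentiableAt 𝓘(ℝ, F) 𝓘(ℝ, F) β y := by
  refine ((trivializationAt F (TangentSpace 𝓘(ℝ, F) : N → Type _) y₀).mdifferentiableAt_section_iff
    𝓘(ℝ, F) (fun z ↦ ofCoord y₀ z (β z)) (mem_trivializationAt_baseSet hy)).trans ?_
  refine Filter.EventuallyEq.mdifferentiableAt_iff ?_
  filter_upwards [chart_source_mem_nhds hy] with z hz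
  rw [trivializationAt_snd hz, toCoord_ofCoord hz]

theorem contMDiffAt_section_iff_toCoord {y₀ y : N} (hy : y ∈ (chartAt F y₀).source)
    {X : Π z : N, TangentSpace 𝓘(ℝ, F) z} {n : ℕ∞} :
    ContMDiffAt 𝓘(ℝ, F) 𝓘(ℝ, F).tangent n
      (fun z ↦ (⟨z, X z⟩ : TangentBundle 𝓘(ℝ, F) N)) y ↔
    ContMDiffAt 𝓘(ℝ, F) 𝓘(ℝ, F) n (fun z ↦ toCoord y₀ z (X z)) y := by
  refine ((trivializationAt F (TangentSpace 𝓘(ℝ, F) : N → Type _) y₀).contMDiffAt_section_iff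
    (IB := 𝓘(ℝ, F)) (s := X) (mem_trivializationAt_baseSet hy)).trans ?_
  refine Filter.EventuallyEq.contMDiffAt_iff ?_
  filter_upwards [chart_source_mem_nhds hy] with z hz
  rw [trivializationAt_snd hz]

/-- The derivative of a function in terms of coordinates. -/
theorem mvfderiv_eq_fderiv_toCoord {X : Type*} [NormedAddCommGroup X] [NormedSpace ℝ X] {y₀ y : N}
    (hy : y ∈ (chartAt F y₀).source) {β : N → X}
    (hβ : MDifferentiableAt 𝓘(ℝ, F) 𝓘(ℝ, X) β y) (v : TangentSpace 𝓘(ℝ, F) y) :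
    mvfderiv 𝓘(ℝ, F) β y v =
      fderiv ℝ (β ∘ (extChartAt 𝓘(ℝ, F) y₀).symm) (extChartAt 𝓘(ℝ, F) y₀ y)
        (toCoord y₀ y v) := by
  have hy' : y ∈ (extChartAt 𝓘(ℝ, F) y₀).source := by rwa [extChartAt_source]
  have h3 : (extChartAt 𝓘(ℝ, F) y₀).symm (extChartAt 𝓘(ℝ, F) y₀ y) = y :=
    (extChartAt 𝓘(ℝ, F) y₀).left_inv hy'
  have h2 := mdifferentiableWithinAt_extChartAt_symm (I := 𝓘(ℝ, F)) (x := y₀)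
    ((extChartAt 𝓘(ℝ, F) y₀).map_source hy')
  simp only [modelWithCornersSelf_coe, range_id, mdifferentiableWithinAt_univ] at h2
  have h4 : MDifferentiableAt 𝓘(ℝ, F) 𝓘(ℝ, X) (β ∘ (extChartAt 𝓘(ℝ, F) y₀).symm)
      (extChartAt 𝓘(ℝ, F) y₀ y) := MDifferentiableAt.comp _ (by rwa [h3]) h2
  have h5 : MDifferentiableAt 𝓘(ℝ, F) 𝓘(ℝ, F) (extChartAt 𝓘(ℝ, F) y₀) y :=
    mdifferentiableAt_extChartAt hy
  have h6 : β =ᶠ[𝓝 y] (β ∘ (extChartAt 𝓘(ℝ, F) y₀).symm) ∘ extChartAt 𝓘(ℝ, F) y₀ := by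
    filter_upwards [extChartAt_source_mem_nhds' (I := 𝓘(ℝ, F)) hy'] with z hz
    simp only [Function.comp_apply, (extChartAt 𝓘(ℝ, F) y₀).left_inv hz]
  have h7 : toCoord y₀ y = mfderiv 𝓘(ℝ, F) 𝓘(ℝ, F) (extChartAt 𝓘(ℝ, F) y₀) y :=
    TangentBundle.continuousLinearMapAt_trivializationAt hy
  rw [h7, ← mfderiv_eq_fderiv]
  have h8 := h6.mfderiv_eq (I := 𝓘(ℝ, F)) (I' := 𝓘(ℝ, X))
  rw [mfderiv_comp y h4 h5] at h8
  have h9 := congrArg (fun L ↦ (L : F →L[ℝ] X) v) h8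
  exact h9

/-- The vector field with constant coordinates in the chart at `y₀`. -/
def constField (y₀ : N) (a : F) : Π y : N, TangentSpace 𝓘(ℝ, F) y := fun y ↦ ofCoord y₀ y a

theorem mdifferentiableAt_constField {y₀ y : N} (hy : y ∈ (chartAt F y₀).source) (a : F) :
    MDifferentiableAt 𝓘(ℝ, F) 𝓘(ℝ, F).tangent
      (fun z ↦ (⟨z, constField y₀ a z⟩ : TangentBundle 𝓘(ℝ, F) N)) y :=
  (mdifferentiableAt_ofCoord_iff hy (β := fun _ ↦ a)).2 mdifferentiableAt_const

theorem cov_sum (cov : CovariantDerivative 𝓘(ℝ, F) F (TangentSpace 𝓘(ℝ, F) : N → Type _))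
    {ι : Type*} (s : Finset ι) (c : ι → N → ℝ) (σ : ι → Π y : N, TangentSpace 𝓘(ℝ, F) y) {y : N}
    (hc : ∀ i, MDifferentiableAt 𝓘(ℝ, F) 𝓘(ℝ, ℝ) (c i) y)
    (hσ : ∀ i, MDifferentiableAt 𝓘(ℝ, F) 𝓘(ℝ, F).tangent
      (fun z ↦ (⟨z, σ i z⟩ : TangentBundle 𝓘(ℝ, F) N)) y) :
    cov (∑ i ∈ s, c i • σ i) y =
      ∑ i ∈ s, (c i y • cov (σ i) y + (mvfderiv 𝓘(ℝ, F) (c i) y).smulRight (σ i y)) := by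
  classical
  induction s using Finset.induction_on with
  | empty => simp
  | insert i s hi ih =>
    rw [Finset.sum_insert hi, Finset.sum_insert hi, ← ih]
    have h1 : MDifferentiableAt 𝓘(ℝ, F) 𝓘(ℝ, F).tangent
      (fun z ↦ (⟨z, (c i • σ i) z⟩ : TangentBundle 𝓘(ℝ, F) N)) y :=
      (hc i).smul_section (hσ i)
    have h2 : MDifferentiableAt 𝓘(ℝ, F) 𝓘(ℝ, F).tangent
      (fun z ↦ (⟨z, (∑ i ∈ s, c i • σ i) z⟩ : TangentBundle 𝓘(ℝ, F) N)) y := by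
      have := MDifferentiableAt.sum_section (I := 𝓘(ℝ, F)) (s := s)
        (t := fun i ↦ c i • σ i) (x₀ := y)
        (fun i _ ↦ (hc i).smul_section (hσ i))
      simpa using this
    rw [(cov.isCovariantDerivativeOn (s := univ)).add h1 h2,
      (cov.isCovariantDerivativeOn (s := univ)).leibniz (hσ i) (hc i)]

variable [FiniteDimensional ℝ F]

theorem ofCoord_eq_sum (y₀ y : N) (a : F) :
    ofCoord y₀ y a =
      ∑ i, (Module.finBasis ℝ F).coord i a • ofCoord y₀ y (Module.finBasis ℝ F i) := by
  conv_lhs => rw [← (Module.finBasis ℝ F).sum_repr a, map_sum]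
  simp only [map_smul, Module.Basis.coord_apply]

/-- The covariant derivative of a vector field given by its coordinates. -/
theorem cov_ofCoord (cov : CovariantDerivative 𝓘(ℝ, F) F (TangentSpace 𝓘(ℝ, F) : N → Type _))
    {y₀ y : N} (hy : y ∈ (chartAt F y₀).source) {β : N → F}
    (hβ : MDifferentiableAt 𝓘(ℝ, F) 𝓘(ℝ, F) β y) (v : TangentSpace 𝓘(ℝ, F) y) :
    cov (fun z ↦ ofCoord y₀ z (β z)) y v =
      cov (constField y₀ (β y)) y v + ofCoord y₀ y (mvfderiv 𝓘(ℝ, F) β y v) := by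
  have key : ∀ γ : N → F, MDifferentiableAt 𝓘(ℝ, F) 𝓘(ℝ, F) γ y →
      cov (fun z ↦ ofCoord y₀ z (γ z)) y v =
        (∑ i, (Module.finBasis ℝ F).coord i (γ y) •
          cov (constField y₀ (Module.finBasis ℝ F i)) y v) +
        ofCoord y₀ y (mvfderiv 𝓘(ℝ, F) γ y v) := by
    intro γ hγ
    let b := Module.finBasis ℝ F
    let L : Fin (Module.finrank ℝ F) → F →L[ℝ] ℝ := fun i ↦ (b.coord i).toContinuousLinearMap
    have hL : ∀ i, MDifferentiableAt 𝓘(ℝ, F) 𝓘(ℝ, ℝ) (fun z ↦ L i (γ z)) y := fun i ↦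
      (L i).mdifferentiableAt.comp y hγ
    have h1 : (fun z ↦ ofCoord y₀ z (γ z)) =
        ∑ i, (fun z ↦ L i (γ z)) • constField y₀ (b i) := by
      funext z
      rw [ofCoord_eq_sum]
      simp [L, b, constField]
    rw [h1, cov_sum cov _ _ _ hL fun i ↦ mdifferentiableAt_constField hy _]
    have h2 : ∀ i, mvfderiv 𝓘(ℝ, F) (fun z ↦ L i (γ z)) y v = L i (mvfderiv 𝓘(ℝ, F) γ y v) := by
      intro i
      have h3 := mfderiv_comp y (L i).mdifferentiableAt hγ
      have h4 := congrArg (fun A ↦ (A : TangentSpace 𝓘(ℝ, F) y →L[ℝ] ℝ) v) h3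
      rw [ContinuousLinearMap.mfderiv_eq] at h4
      exact h4
    have h5 : ofCoord y₀ y (mvfderiv 𝓘(ℝ, F) γ y v) =
        ∑ i, L i (mvfderiv 𝓘(ℝ, F) γ y v) • constField y₀ (b i) y :=
      ofCoord_eq_sum _ _ _
    rw [h5, ← Finset.sum_add_distrib]
    simp only [sum_apply]
    refine Finset.sum_congr rfl fun i _ ↦ ?_
    simp only [add_apply, smul_apply,
      ContinuousLinearMap.smulRight_apply, h2]
    rfl
  rw [key β hβ]
  -- For constant coordinates the derivative term drops out, which identifies the frame sum with the
  -- derivative of the frozen field.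
  have h6 := key (fun _ ↦ β y) mdifferentiableAt_const
  rw [mvfderiv_const] at h6
  simp only [zero_apply, map_zero, add_zero] at h6
  rw [← h6]
  rfl

/-- The Christoffel symbols in the chart at `y₀`: `christoffel cov y₀ z b a` are the coordinates
of the covariant derivative in the direction `a` of the field with constant coordinates `b`. -/
def christoffel (cov : CovariantDerivative 𝓘(ℝ, F) F (TangentSpace 𝓘(ℝ, F) : N → Type _))
    (y₀ : N) (z : F) : F →L[ℝ] F →L[ℝ] F :=
  ∑ i, ((Module.finBasis ℝ F).coord i).toContinuousLinearMap.smulRight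
    (toCoord y₀ ((extChartAt 𝓘(ℝ, F) y₀).symm z) ∘L
      cov (constField y₀ (Module.finBasis ℝ F i)) ((extChartAt 𝓘(ℝ, F) y₀).symm z) ∘L
        ofCoord y₀ ((extChartAt 𝓘(ℝ, F) y₀).symm z))

theorem extChartAt_left_inv_of_mem {y₀ y : N} (hy : y ∈ (chartAt F y₀).source) :
    (extChartAt 𝓘(ℝ, F) y₀).symm (extChartAt 𝓘(ℝ, F) y₀ y) = y :=
  (extChartAt 𝓘(ℝ, F) y₀).left_inv (by rwa [extChartAt_source])

/-- A field with constant coordinates is a constant combination of basis fields, and the Leibniz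
terms of constants vanish. -/
theorem christoffel_apply
    (cov : CovariantDerivative 𝓘(ℝ, F) F (TangentSpace 𝓘(ℝ, F) : N → Type _))
    {y₀ y : N} (hy : y ∈ (chartAt F y₀).source) (a b : F) :
    christoffel cov y₀ (extChartAt 𝓘(ℝ, F) y₀ y) b a =
      toCoord y₀ y (cov (constField y₀ b) y (ofCoord y₀ y a)) := by
  have h1 : constField y₀ b = ∑ i : Fin (Module.finrank ℝ F),
      (fun _ : N ↦ (Module.finBasis ℝ F).coord i b) •
      constField y₀ (Module.finBasis ℝ F i) := by
    funext z
    rw [constField, ofCoord_eq_sum]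
    simp [constField]
  have h2 : ∀ y' ∈ (chartAt F y₀).source,
      (∑ i, ((Module.finBasis ℝ F).coord i).toContinuousLinearMap.smulRight
        (toCoord y₀ y' ∘L cov (constField y₀ (Module.finBasis ℝ F i)) y' ∘L ofCoord y₀ y')) b a =
      toCoord y₀ y' (cov (constField y₀ b) y' (ofCoord y₀ y' a)) := by
    intro y' hy'
    rw [h1, cov_sum cov _ _ _ (fun i ↦ mdifferentiableAt_const)
      fun i ↦ mdifferentiableAt_constField hy' _]
    simp only [mvfderiv_const]
    simp [sum_apply]
  have h3 := h2 _ ((extChartAt_left_inv_of_mem hy).symm ▸ hy)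
  rw [← h2 y hy, christoffel, extChartAt_left_inv_of_mem hy]

theorem toCoord_cov_ofCoord
    (cov : CovariantDerivative 𝓘(ℝ, F) F (TangentSpace 𝓘(ℝ, F) : N → Type _))
    {y₀ y : N} (hy : y ∈ (chartAt F y₀).source) {β : N → F}
    (hβ : MDifferentiableAt 𝓘(ℝ, F) 𝓘(ℝ, F) β y) (v : TangentSpace 𝓘(ℝ, F) y) :
    toCoord y₀ y (cov (fun z ↦ ofCoord y₀ z (β z)) y v) =
      christoffel cov y₀ (extChartAt 𝓘(ℝ, F) y₀ y) (β y) (toCoord y₀ y v) +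
        mvfderiv 𝓘(ℝ, F) β y v := by
  rw [cov_ofCoord cov hy hβ, map_add, toCoord_ofCoord hy, christoffel_apply cov hy,
    ofCoord_toCoord hy]

/-- Constant curvature and smoothness of the connection are tested on globally smooth fields, so
coordinate fields are cut off by a bump function. One function `χ` serves all `a`. -/
theorem exists_contMDiff_eventuallyEq_constField [T2Space N] {y₀ y : N}
    (hy : y ∈ (chartAt F y₀).source) :
    ∃ χ : N → ℝ, (∀ᶠ z in 𝓝 y, χ z = 1) ∧ ∀ a, ContMDiff 𝓘(ℝ, F) 𝓘(ℝ, F).tangent ∞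
      (fun z ↦ (⟨z, (χ • constField y₀ a) z⟩ : TangentBundle 𝓘(ℝ, F) N)) := by
  obtain ⟨χ, hχ⟩ := (SmoothBumpFunction.nhds_basis_tsupport (I := 𝓘(ℝ, F)) y).mem_iff.1
    (chart_source_mem_nhds hy)
  refine ⟨χ, χ.eventuallyEq_one, fun a ↦ ?_⟩
  refine ContMDiffOn.smul_section_of_tsupport (u := (chartAt F y₀).source)
    χ.contMDiff.contMDiffOn (chartAt F y₀).open_source hχ.2 ?_
  intro z hz
  refine ((contMDiffAt_section_iff_toCoord (F := F) hz).2 ?_).contMDiffWithinAt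
  refine contMDiffAt_const (c := a) |>.congr_of_eventuallyEq ?_
  filter_upwards [chart_source_mem_nhds hz] with w hw
  exact toCoord_ofCoord hw a

end Coordinates

theorem hasFDerivAt_clm_apply_apply {E₁ E₂ E₃ X : Type*} [NormedAddCommGroup E₁]
    [NormedSpace ℝ E₁] [NormedAddCommGroup E₂] [NormedSpace ℝ E₂] [NormedAddCommGroup E₃]
    [NormedSpace ℝ E₃] [NormedAddCommGroup X] [NormedSpace ℝ X] {Φ : E₁ → E₂ →L[ℝ] E₃ →L[ℝ] X}
    {z : E₁} (hΦ : DifferentiableAt ℝ Φ z) (b : E₂) (c : E₃) :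
    HasFDerivAt (fun z ↦ Φ z b c) (((fderiv ℝ Φ z).flip b).flip c) z := by
  refine ((hΦ.hasFDerivAt.clm_apply (hasFDerivAt_const b _)).clm_apply
    (hasFDerivAt_const c _)).congr_fderiv ?_
  ext v
  simp

section Coordinates

variable {F : Type*} [NormedAddCommGroup F] [NormedSpace ℝ F]
  {N : Type*} [TopologicalSpace N] [ChartedSpace F N] [IsManifold 𝓘(ℝ, F) ∞ N]
  [FiniteDimensional ℝ F]

theorem inverse_mfderiv_extChartAt {y₀ y : N} (hy : y ∈ (chartAt F y₀).source) (a : F) :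
    (mfderiv 𝓘(ℝ, F) 𝓘(ℝ, F) (extChartAt 𝓘(ℝ, F) y₀) y).inverse a = ofCoord y₀ y a := by
  have h7 : toCoord y₀ y = mfderiv 𝓘(ℝ, F) 𝓘(ℝ, F) (extChartAt 𝓘(ℝ, F) y₀) y :=
    TangentBundle.continuousLinearMapAt_trivializationAt hy
  rw [← h7]
  let e : TangentSpace 𝓘(ℝ, F) y ≃L[ℝ] F := ContinuousLinearEquiv.equivOfInverse
    (toCoord y₀ y) (ofCoord y₀ y) (ofCoord_toCoord hy) (toCoord_ofCoord hy)
  exact congrArg (fun L : F →L[ℝ] TangentSpace 𝓘(ℝ, F) y ↦ L a) (ContinuousLinearMap.inverse_equiv e)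

/-- These fields are pullbacks of constant fields by the chart, and the bracket commutes with
pullback. -/
theorem mlieBracket_constField {y₀ y : N} (hy : y ∈ (chartAt F y₀).source) (a b : F) :
    VectorField.mlieBracket 𝓘(ℝ, F) (constField y₀ a) (constField y₀ b) y = 0 := by
  have h1 : ∀ a : F, constField y₀ a =ᶠ[𝓝 y] VectorField.mpullback 𝓘(ℝ, F) 𝓘(ℝ, F)
      (extChartAt 𝓘(ℝ, F) y₀) (fun _ : F ↦ a) := by
    intro a
    filter_upwards [chart_source_mem_nhds hy] with z hz
    exact (inverse_mfderiv_extChartAt hz a).symm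
  have h0 : ∀ (a z : F), MDifferentiableAt 𝓘(ℝ, F) 𝓘(ℝ, F).tangent
      (fun z ↦ (⟨z, a⟩ : TangentBundle 𝓘(ℝ, F) F)) z := by
    intro a z
    rw [mdifferentiableAt_totalSpace]
    exact ⟨mdifferentiableAt_id, by simpa using mdifferentiableAt_const⟩
  have : IsManifold 𝓘(ℝ, F) (minSmoothness ℝ 2) N := by
    rw [minSmoothness_of_isRCLikeNormedField]
    infer_instance
  rw [(h1 a).mlieBracket_vectorField_eq (h1 b), ← VectorField.mpullback_mlieBracket (n := 2)
    (h0 a _) (h0 b _) (contMDiffAt_extChartAt' hy) (by simp)]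
  have h2 := VectorField.mlieBracketWithin_eq_lieBracketWithin (𝕜 := ℝ) (s := univ)
    (V := fun _ : F ↦ a) (W := fun _ : F ↦ b)
  have h3 : VectorField.lieBracketWithin ℝ (fun _ : F ↦ a) (fun _ ↦ b) univ
      (extChartAt 𝓘(ℝ, F) y₀ y) = 0 := by
    simp [VectorField.lieBracketWithin]
  have h4 := (congrFun (VectorField.mlieBracketWithin_univ (I := 𝓘(ℝ, F)) (V := fun _ : F ↦ a)
    (W := fun _ : F ↦ b)).symm _).trans ((congrFun h2 _).trans h3)
  exact (congrArg _ h4).trans (map_zero _)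

theorem IsLeviCivita.christoffel_symm {g : PseudoRiemannianMetric F N}
    {cov : CovariantDerivative 𝓘(ℝ, F) F (TangentSpace 𝓘(ℝ, F) : N → Type _)}
    (hcov : IsLeviCivita g cov) {y₀ y : N} (hy : y ∈ (chartAt F y₀).source) (a b : F) :
    christoffel cov y₀ (extChartAt 𝓘(ℝ, F) y₀ y) a b =
      christoffel cov y₀ (extChartAt 𝓘(ℝ, F) y₀ y) b a := by
  have h := hcov.torsion_free (constField y₀ b) (constField y₀ a) y
    (mdifferentiableAt_constField hy b) (mdifferentiableAt_constField hy a)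
  rw [mlieBracket_constField hy, sub_eq_zero] at h
  rw [christoffel_apply cov hy, christoffel_apply cov hy]
  exact congrArg (toCoord y₀ y) h

/-- The form `(a, b) ↦ B (L a) (L b)`. -/
def pullbackForm (B : F →L[ℝ] F →L[ℝ] ℝ) (L : F →L[ℝ] F) : F →L[ℝ] F →L[ℝ] ℝ :=
  B.bilinearComp L L

/-- The metric in the chart at `y₀`. -/
def metricCoord (g : PseudoRiemannianMetric F N) (y₀ : N) (z : F) : F →L[ℝ] F →L[ℝ] ℝ :=
  pullbackForm (g.inner ((extChartAt 𝓘(ℝ, F) y₀).symm z))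
    (ofCoord y₀ ((extChartAt 𝓘(ℝ, F) y₀).symm z))

theorem metricCoord_apply (g : PseudoRiemannianMetric F N) {y₀ y : N}
    (hy : y ∈ (chartAt F y₀).source) (a b : F) :
    metricCoord g y₀ (extChartAt 𝓘(ℝ, F) y₀ y) a b =
      g.inner y (ofCoord y₀ y a) (ofCoord y₀ y b) := by
  rw [metricCoord, extChartAt_left_inv_of_mem hy]
  rfl

theorem metricCoord_toCoord (g : PseudoRiemannianMetric F N) {y₀ y : N}
    (hy : y ∈ (chartAt F y₀).source) (v w : TangentSpace 𝓘(ℝ, F) y) :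
    metricCoord g y₀ (extChartAt 𝓘(ℝ, F) y₀ y) (toCoord y₀ y v) (toCoord y₀ y w) =
      g.inner y v w := by
  rw [metricCoord_apply g hy, ofCoord_toCoord hy, ofCoord_toCoord hy]

theorem contDiffOn_comp_extChartAt_symm {X : Type*} [NormedAddCommGroup X] [NormedSpace ℝ X]
    {y₀ : N} {β : N → X}
    (hβ : ∀ y ∈ (chartAt F y₀).source, ContMDiffAt 𝓘(ℝ, F) 𝓘(ℝ, X) ∞ β y) :
    ContDiffOn ℝ ∞ (fun z ↦ β ((extChartAt 𝓘(ℝ, F) y₀).symm z)) (extChartAt 𝓘(ℝ, F) y₀).target := by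
  intro z hz
  have h0 : (extChartAt 𝓘(ℝ, F) y₀).symm z ∈ (chartAt F y₀).source := by
    simpa using (extChartAt 𝓘(ℝ, F) y₀).map_target hz
  have h1 := contMDiffOn_extChartAt_symm (I := 𝓘(ℝ, F)) (n := ∞) y₀ z hz
  rw [← contMDiffWithinAt_iff_contDiffWithinAt]
  exact ContMDiffAt.comp_contMDiffWithinAt z (hβ _ h0) h1

theorem mdifferentiableAt_comp_extChartAt {X : Type*} [NormedAddCommGroup X] [NormedSpace ℝ X]
    {y₀ y : N} (hy : y ∈ (chartAt F y₀).source) {Φ : F → X}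
    (hΦ : DifferentiableAt ℝ Φ (extChartAt 𝓘(ℝ, F) y₀ y)) :
    MDifferentiableAt 𝓘(ℝ, F) 𝓘(ℝ, X) (fun z ↦ Φ (extChartAt 𝓘(ℝ, F) y₀ z)) y :=
  MDifferentiableAt.comp y hΦ.mdifferentiableAt (mdifferentiableAt_extChartAt hy)

theorem mvfderiv_comp_extChartAt {X : Type*} [NormedAddCommGroup X] [NormedSpace ℝ X]
    {y₀ y : N} (hy : y ∈ (chartAt F y₀).source) {Φ : F → X}
    (hΦ : DifferentiableAt ℝ Φ (extChartAt 𝓘(ℝ, F) y₀ y)) (v : TangentSpace 𝓘(ℝ, F) y) :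
    mvfderiv 𝓘(ℝ, F) (fun z ↦ Φ (extChartAt 𝓘(ℝ, F) y₀ z)) y v =
      fderiv ℝ Φ (extChartAt 𝓘(ℝ, F) y₀ y) (toCoord y₀ y v) := by
  rw [mvfderiv_eq_fderiv_toCoord hy (mdifferentiableAt_comp_extChartAt hy hΦ)]
  congr 1
  refine Filter.EventuallyEq.fderiv_eq ?_
  have hy' : y ∈ (extChartAt 𝓘(ℝ, F) y₀).source := by rwa [extChartAt_source]
  filter_upwards [extChartAt_target_mem_nhds' (I := 𝓘(ℝ, F))
    ((extChartAt 𝓘(ℝ, F) y₀).map_source hy')] with z hz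
  simp only [Function.comp_apply, (extChartAt 𝓘(ℝ, F) y₀).right_inv hz]

theorem extChartAt_mem_target {y₀ y : N} (hy : y ∈ (chartAt F y₀).source) :
    extChartAt 𝓘(ℝ, F) y₀ y ∈ (extChartAt 𝓘(ℝ, F) y₀).target :=
  (extChartAt 𝓘(ℝ, F) y₀).map_source (by rwa [extChartAt_source])

theorem differentiableAt_of_contDiffOn_target {X : Type*} [NormedAddCommGroup X] [NormedSpace ℝ X]
    {y₀ y : N} (hy : y ∈ (chartAt F y₀).source) {Φ : F → X}
    (hΦ : ContDiffOn ℝ ∞ Φ (extChartAt 𝓘(ℝ, F) y₀).target) :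
    DifferentiableAt ℝ Φ (extChartAt 𝓘(ℝ, F) y₀ y) :=
  (hΦ.contDiffAt ((isOpen_extChartAt_target y₀).mem_nhds
    (extChartAt_mem_target hy))).differentiableAt (by simp)

variable [T2Space N]

theorem contDiffOn_metricCoord (g : PseudoRiemannianMetric F N) (y₀ : N) :
    ContDiffOn ℝ ∞ (metricCoord g y₀) (extChartAt 𝓘(ℝ, F) y₀).target := by
  rw [contDiffOn_clm_apply]
  intro a
  rw [contDiffOn_clm_apply]
  intro b
  refine contDiffOn_comp_extChartAt_symm (y₀ := y₀)
    (β := fun z ↦ g.inner z (ofCoord y₀ z a) (ofCoord y₀ z b)) fun y hy ↦ ?_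
  obtain ⟨χ, hχ, hX⟩ := exists_contMDiff_eventuallyEq_constField (F := F) hy
  have h2 := ContMDiff.clm_bundle_apply₂ (IM := 𝓘(ℝ, F)) (E₃ := Bundle.Trivial N ℝ) (F₃ := ℝ)
    (b := fun z : N ↦ z) g.contMDiff (hX a) (hX b)
  have h3 := (contMDiffAt_totalSpace.1 (h2 y)).2
  refine ContMDiffAt.congr_of_eventuallyEq (f := fun z ↦ g.inner z
    ((χ • constField y₀ a) z) ((χ • constField y₀ b) z)) h3 ?_
  filter_upwards [hχ] with z hz
  simp [hz, constField]

/-- Locality of the connection, on a neighbourhood and not only at the point, because in the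
curvature the result is differentiated once more. -/
theorem toCoord_cov_eventuallyEq
    (cov : CovariantDerivative 𝓘(ℝ, F) F (TangentSpace 𝓘(ℝ, F) : N → Type _)) {y₀ y : N}
    (hy : y ∈ (chartAt F y₀).source) {X Y : Π z : N, TangentSpace 𝓘(ℝ, F) z} {a b : F}
    (hXa : X =ᶠ[𝓝 y] constField y₀ a) (hYb : Y =ᶠ[𝓝 y] constField y₀ b) :
    ∀ᶠ z in 𝓝 y, cov Y z (X z) =
      ofCoord y₀ z (christoffel cov y₀ (extChartAt 𝓘(ℝ, F) y₀ z) b a) := by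
  filter_upwards [hXa, hYb.eventuallyEq_nhds, chart_source_mem_nhds hy] with z h1 h2 hz
  have h3 : MDifferentiableAt 𝓘(ℝ, F) 𝓘(ℝ, F).tangent
      (fun z ↦ (⟨z, Y z⟩ : TangentBundle 𝓘(ℝ, F) N)) z := by
    refine (mdifferentiableAt_constField hz b).congr_of_eventuallyEq ?_
    filter_upwards [h2] with w hw
    rw [hw]
  rw [(cov.isCovariantDerivativeOn (s := univ)).congr_of_eventuallyEq h3
    (mdifferentiableAt_constField hz b) Filter.univ_mem h2, h1, christoffel_apply cov hz,
    ofCoord_toCoord hz]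
  rfl

theorem IsLeviCivita.contMDiff_cov_apply {g : PseudoRiemannianMetric F N}
    {cov : CovariantDerivative 𝓘(ℝ, F) F (TangentSpace 𝓘(ℝ, F) : N → Type _)}
    (hcov : IsLeviCivita g cov) {X Y : Π z : N, TangentSpace 𝓘(ℝ, F) z}
    (hX : ContMDiff 𝓘(ℝ, F) 𝓘(ℝ, F).tangent ∞ (fun z ↦ (⟨z, X z⟩ : TangentBundle 𝓘(ℝ, F) N)))
    (hY : ContMDiff 𝓘(ℝ, F) 𝓘(ℝ, F).tangent ∞ (fun z ↦ (⟨z, Y z⟩ : TangentBundle 𝓘(ℝ, F) N))) :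
    ContMDiff 𝓘(ℝ, F) 𝓘(ℝ, F).tangent ∞
      (fun z ↦ (⟨z, cov Y z (X z)⟩ : TangentBundle 𝓘(ℝ, F) N)) := by
  have h1 := hcov.smooth.contMDiff.contMDiff (σ := Y) (by simpa using hY.contMDiffOn)
  exact ContMDiff.clm_bundle_apply (IM := 𝓘(ℝ, F)) (b := fun z : N ↦ z)
    (contMDiffOn_univ.1 h1) hX

theorem IsLeviCivita.contDiffOn_christoffel {g : PseudoRiemannianMetric F N}
    {cov : CovariantDerivative 𝓘(ℝ, F) F (TangentSpace 𝓘(ℝ, F) : N → Type _)}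
    (hcov : IsLeviCivita g cov) (y₀ : N) :
    ContDiffOn ℝ ∞ (christoffel cov y₀) (extChartAt 𝓘(ℝ, F) y₀).target := by
  rw [contDiffOn_clm_apply]
  intro b
  rw [contDiffOn_clm_apply]
  intro a
  have key : ContDiffOn ℝ ∞ (fun z ↦ (fun w ↦ christoffel cov y₀ (extChartAt 𝓘(ℝ, F) y₀ w) b a)
      ((extChartAt 𝓘(ℝ, F) y₀).symm z)) (extChartAt 𝓘(ℝ, F) y₀).target := by
    refine contDiffOn_comp_extChartAt_symm (y₀ := y₀)
      (β := fun w ↦ christoffel cov y₀ (extChartAt 𝓘(ℝ, F) y₀ w) b a) fun y hy ↦ ?_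
    obtain ⟨χ, hχ, hX⟩ := exists_contMDiff_eventuallyEq_constField (F := F) hy
    have h0 : ∀ a : F, χ • constField y₀ a =ᶠ[𝓝 y] constField y₀ a := by
      intro a
      filter_upwards [hχ] with z hz
      simp only [Pi.smul_apply', hz, one_smul]
      rfl
    have h1 := (contMDiffAt_section_iff_toCoord (F := F) hy).1 (hcov.contMDiff_cov_apply (hX a) (hX b) y)
    refine h1.congr_of_eventuallyEq ?_
    filter_upwards [toCoord_cov_eventuallyEq cov hy (h0 a) (h0 b),
      chart_source_mem_nhds hy] with z hz hz'
    rw [hz, toCoord_ofCoord hz']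
  refine key.congr fun z hz ↦ ?_
  simp only [(extChartAt 𝓘(ℝ, F) y₀).right_inv hz]

/-- Compatibility of the connection with the metric, read off on two coordinate fields. -/
theorem IsLeviCivita.fderiv_metricCoord {g : PseudoRiemannianMetric F N}
    {cov : CovariantDerivative 𝓘(ℝ, F) F (TangentSpace 𝓘(ℝ, F) : N → Type _)}
    (hcov : IsLeviCivita g cov) {y₀ y : N} (hy : y ∈ (chartAt F y₀).source) (a b c : F) :
    fderiv ℝ (metricCoord g y₀) (extChartAt 𝓘(ℝ, F) y₀ y) a b c =
      metricCoord g y₀ (extChartAt 𝓘(ℝ, F) y₀ y)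
        (christoffel cov y₀ (extChartAt 𝓘(ℝ, F) y₀ y) b a) c +
      metricCoord g y₀ (extChartAt 𝓘(ℝ, F) y₀ y) b
        (christoffel cov y₀ (extChartAt 𝓘(ℝ, F) y₀ y) c a) := by
  have h := hcov.metric (constField y₀ b) (constField y₀ c) y (ofCoord y₀ y a)
    (mdifferentiableAt_constField hy b) (mdifferentiableAt_constField hy c)
  have hG := differentiableAt_of_contDiffOn_target hy (contDiffOn_metricCoord g y₀)
  have hGbc := hasFDerivAt_clm_apply_apply hG b c
  have h2 : mvfderiv 𝓘(ℝ, F) (fun z ↦ g.inner z (constField y₀ b z) (constField y₀ c z)) y =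
      mvfderiv 𝓘(ℝ, F) (fun z ↦ metricCoord g y₀ (extChartAt 𝓘(ℝ, F) y₀ z) b c) y := by
    have h3 : (fun z ↦ g.inner z (constField y₀ b z) (constField y₀ c z)) =ᶠ[𝓝 y]
        (fun z ↦ metricCoord g y₀ (extChartAt 𝓘(ℝ, F) y₀ z) b c) := by
      filter_upwards [chart_source_mem_nhds hy] with z hz
      rw [metricCoord_apply g hz]
      rfl
    ext v
    exact congrArg (fun L : F →L[ℝ] ℝ ↦ L v) (h3.mfderiv_eq (I := 𝓘(ℝ, F)) (I' := 𝓘(ℝ, ℝ)))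
  rw [h2, mvfderiv_comp_extChartAt hy hGbc.differentiableAt, toCoord_ofCoord hy, hGbc.fderiv] at h
  simp only [ContinuousLinearMap.flip_apply] at h
  rw [h, christoffel_apply cov hy, christoffel_apply cov hy, metricCoord_apply g hy,
    metricCoord_apply g hy, ofCoord_toCoord hy, ofCoord_toCoord hy]
  rfl

/-- The curvature hypothesis is applied to cut-off coordinate fields. Their bracket vanishes at the
point, so only the two iterated derivatives remain. -/
theorem IsLeviCivita.curvature_christoffel {g : PseudoRiemannianMetric F N}
    {cov : CovariantDerivative 𝓘(ℝ, F) F (TangentSpace 𝓘(ℝ, F) : N → Type _)}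
    (hcov : IsLeviCivita g cov) {κ : ℝ} (hκ : HasConstantCurvature g cov κ)
    {y₀ y : N} (hy : y ∈ (chartAt F y₀).source) (a b c : F) :
    let Γ := christoffel cov y₀
    let z := extChartAt 𝓘(ℝ, F) y₀ y
    (fderiv ℝ Γ z a c b + Γ z (Γ z c b) a) - (fderiv ℝ Γ z b c a + Γ z (Γ z c a) b) =
      κ • (metricCoord g y₀ z b c • a - metricCoord g y₀ z a c • b) := by
  intro Γ z
  obtain ⟨χ, hχ, hX⟩ := exists_contMDiff_eventuallyEq_constField (F := F) hy
  have h0 : ∀ a : F, χ • constField y₀ a =ᶠ[𝓝 y] constField y₀ a := by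
    intro a
    filter_upwards [hχ] with z hz
    simp only [Pi.smul_apply', hz, one_smul]
    rfl
  have hΓ : DifferentiableAt ℝ Γ z :=
    differentiableAt_of_contDiffOn_target (X := F →L[ℝ] F →L[ℝ] F) hy (hcov.contDiffOn_christoffel y₀)
  have key : ∀ a b, toCoord y₀ y (cov (fun w ↦ cov (χ • constField y₀ c) w
      ((χ • constField y₀ b) w)) y ((χ • constField y₀ a) y)) =
      fderiv ℝ Γ z a c b + Γ z (Γ z c b) a := by
    intro a b
    have h1 := toCoord_cov_eventuallyEq cov hy (h0 b) (h0 c)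
    have hΓcb := hasFDerivAt_clm_apply_apply hΓ c b
    have hβ := mdifferentiableAt_comp_extChartAt hy hΓcb.differentiableAt
    have h2 := (mdifferentiableAt_ofCoord_iff (F := F) hy).2 hβ
    have h3 := (hcov.contMDiff_cov_apply (hX b) (hX c) y).mdifferentiableAt (by simp)
    rw [(cov.isCovariantDerivativeOn (s := univ)).congr_of_eventuallyEq h3 h2
      Filter.univ_mem h1, (h0 a).self_of_nhds, toCoord_cov_ofCoord cov hy hβ,
      mvfderiv_comp_extChartAt hy hΓcb.differentiableAt, hΓcb.fderiv, add_comm]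
    simp only [constField, toCoord_ofCoord hy]
    rfl
  have h4 := hκ _ _ _ (hX a) (hX b) (hX c) y
  rw [curvature, (h0 a).mlieBracket_vectorField_eq (h0 b), mlieBracket_constField hy, map_zero,
    sub_zero] at h4
  have h5 := congrArg (toCoord y₀ y) h4
  rw [map_sub, key, key, (h0 a).self_of_nhds, (h0 b).self_of_nhds, (h0 c).self_of_nhds] at h5
  rw [h5, map_smul, map_sub, map_smul, map_smul]
  simp only [constField, toCoord_ofCoord hy, z, metricCoord_apply g hy]

end Coordinates

/-! ### Covariant derivatives along curves in a fixed chart. -/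

section AlongCurves

variable {F : Type*} [NormedAddCommGroup F] [NormedSpace ℝ F]
  {N : Type*} [TopologicalSpace N] [ChartedSpace F N] [IsManifold 𝓘(ℝ, F) ∞ N]
  [FiniteDimensional ℝ F] {c : ℝ → N} {V : Π t : ℝ, TangentSpace 𝓘(ℝ, F) (c t)} {t : ℝ}

theorem mdifferentiableAt_along_iff {y₀ : N} (hy : c t ∈ (chartAt F y₀).source) :
    MDifferentiableAt 𝓘(ℝ, ℝ) 𝓘(ℝ, F).tangent
      (fun s ↦ (⟨c s, V s⟩ : TangentBundle 𝓘(ℝ, F) N)) t ↔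
    MDifferentiableAt 𝓘(ℝ, ℝ) 𝓘(ℝ, F) c t ∧
      DifferentiableAt ℝ (fun s ↦ toCoord y₀ (c s) (V s)) t := by
  refine ((trivializationAt F (TangentSpace 𝓘(ℝ, F) : N → Type _)
    y₀).mdifferentiableAt_totalSpace_iff 𝓘(ℝ, F) (f := fun s ↦ (⟨c s, V s⟩ :
      TangentBundle 𝓘(ℝ, F) N)) (mem_trivializationAt_baseSet hy)).trans ?_
  refine and_congr_right fun hc ↦ ?_
  rw [← mdifferentiableAt_iff_differentiableAt]
  refine Filter.EventuallyEq.mdifferentiableAt_iff ?_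
  have h : ContinuousAt c t := MDifferentiableAt.continuousAt hc
  filter_upwards [h.preimage_mem_nhds (chart_source_mem_nhds hy)] with s hs
  rw [trivializationAt_snd hs]

theorem mdifferentiableAt_curve_iff {y₀ : N} (hy : c t ∈ (chartAt F y₀).source) :
    MDifferentiableAt 𝓘(ℝ, ℝ) 𝓘(ℝ, F) c t ↔
      ContinuousAt c t ∧ DifferentiableAt ℝ (fun s ↦ extChartAt 𝓘(ℝ, F) y₀ (c s)) t := by
  constructor
  · intro h
    refine ⟨h.continuousAt, ?_⟩
    rw [← mdifferentiableAt_iff_differentiableAt]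
    exact MDifferentiableAt.comp t (mdifferentiableAt_extChartAt hy) h
  · rintro ⟨h1, h2⟩
    have h3 := mdifferentiableWithinAt_extChartAt_symm (I := 𝓘(ℝ, F)) (x := y₀)
      (extChartAt_mem_target hy)
    simp only [modelWithCornersSelf_coe, range_id, mdifferentiableWithinAt_univ] at h3
    refine (MDifferentiableAt.comp t h3 h2.mdifferentiableAt).congr_of_eventuallyEq ?_
    filter_upwards [h1.preimage_mem_nhds (chart_source_mem_nhds hy)] with s hs
    exact (extChartAt_left_inv_of_mem hs).symm

theorem toCoord_mfderiv_curve {y₀ : N} (hy : c t ∈ (chartAt F y₀).source)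
    (hc : MDifferentiableAt 𝓘(ℝ, ℝ) 𝓘(ℝ, F) c t) :
    toCoord y₀ (c t) (mfderiv 𝓘(ℝ, ℝ) 𝓘(ℝ, F) c t (1 : ℝ)) =
      deriv (fun s ↦ extChartAt 𝓘(ℝ, F) y₀ (c s)) t := by
  have h7 : toCoord y₀ (c t) = mfderiv 𝓘(ℝ, F) 𝓘(ℝ, F) (extChartAt 𝓘(ℝ, F) y₀) (c t) :=
    TangentBundle.continuousLinearMapAt_trivializationAt hy
  have h8 := mfderiv_comp t (mdifferentiableAt_extChartAt (I := 𝓘(ℝ, F)) hy) hc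
  rw [h7, ← fderiv_apply_one_eq_deriv, ← mfderiv_eq_fderiv]
  exact (congrArg (fun L : ℝ →L[ℝ] F ↦ L 1) h8).symm

theorem deriv_comp_curve {X : Type*} [NormedAddCommGroup X] [NormedSpace ℝ X] {β : N → X}
    (hβ : MDifferentiableAt 𝓘(ℝ, F) 𝓘(ℝ, X) β (c t))
    (hc : MDifferentiableAt 𝓘(ℝ, ℝ) 𝓘(ℝ, F) c t) :
    HasDerivAt (fun s ↦ β (c s))
      (mvfderiv 𝓘(ℝ, F) β (c t) (mfderiv 𝓘(ℝ, ℝ) 𝓘(ℝ, F) c t (1 : ℝ))) t := by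
  have h := (hβ.comp t hc).differentiableAt.hasDerivAt
  refine h.congr_deriv ?_
  rw [← fderiv_apply_one_eq_deriv, ← mfderiv_eq_fderiv]
  exact congrArg (fun L : ℝ →L[ℝ] X ↦ L 1) (mfderiv_comp t hβ hc)

/-- The covariant derivative along a curve in terms of coordinates. -/
theorem toCoord_covDerivAlong
    (cov : CovariantDerivative 𝓘(ℝ, F) F (TangentSpace 𝓘(ℝ, F) : N → Type _))
    {y₀ : N} (hy : c t ∈ (chartAt F y₀).source)
    (hV : MDifferentiableAt 𝓘(ℝ, ℝ) 𝓘(ℝ, F).tangent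
      (fun s ↦ (⟨c s, V s⟩ : TangentBundle 𝓘(ℝ, F) N)) t) :
    toCoord y₀ (c t) (covDerivAlong cov c V t) =
      deriv (fun s ↦ toCoord y₀ (c s) (V s)) t +
        christoffel cov y₀ (extChartAt 𝓘(ℝ, F) y₀ (c t)) (toCoord y₀ (c t) (V t))
          (deriv (fun s ↦ extChartAt 𝓘(ℝ, F) y₀ (c s)) t) := by
  obtain ⟨hc, hu⟩ := (mdifferentiableAt_along_iff hy).1 hV
  have hy1 : c t ∈ (chartAt F (c t)).source := mem_chart_source F (c t)
  have hu1 := ((mdifferentiableAt_along_iff hy1).1 hV).2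
  set e₁ := trivializationAt F (TangentSpace 𝓘(ℝ, F) : N → Type _) (c t) with he₁
  set e₀ := trivializationAt F (TangentSpace 𝓘(ℝ, F) : N → Type _) y₀ with he₀
  -- `covDerivAlong` uses the chart at `c t`, which moves with $t$; `K` passes from it to the fixed
  -- chart at `y₀`.
  set K : N → F →L[ℝ] F := fun z ↦ e₁.coordChangeL ℝ e₀ z with hK
  have hKa : ∀ z ∈ (chartAt F y₀).source, z ∈ (chartAt F (c t)).source → ∀ a,
      K z a = toCoord y₀ z (ofCoord (c t) z a) := by
    intro z hz hz1 a
    rw [ofCoord_eq_symm hz1, ← trivializationAt_snd hz]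
    exact e₁.coordChangeL_apply e₀
      ⟨mem_trivializationAt_baseSet hz1, mem_trivializationAt_baseSet hz⟩ a
  have hKd : MDifferentiableAt 𝓘(ℝ, F) 𝓘(ℝ, F →L[ℝ] F) K (c t) :=
    mdifferentiableAt_coordChangeL (mem_trivializationAt_baseSet hy1)
      (mem_trivializationAt_baseSet hy)
  have hcc := hc.continuousAt
  have hnear : ∀ᶠ s in 𝓝 t, c s ∈ (chartAt F y₀).source ∧ c s ∈ (chartAt F (c t)).source :=
    Filter.inter_mem (hcc.preimage_mem_nhds (chart_source_mem_nhds hy))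
      (hcc.preimage_mem_nhds (chart_source_mem_nhds hy1))
  have hKc := deriv_comp_curve hKd hc
  set u₁ : ℝ → F := fun s ↦ toCoord (c t) (c s) (V s) with hu₁
  have h1 : HasDerivAt (fun s ↦ toCoord y₀ (c s) (V s))
      ((mvfderiv 𝓘(ℝ, F) K (c t) (mfderiv 𝓘(ℝ, ℝ) 𝓘(ℝ, F) c t (1 : ℝ))) (u₁ t) +
        K (c t) (deriv u₁ t)) t := by
    refine (hKc.clm_apply hu1.hasDerivAt).congr_of_eventuallyEq ?_
    filter_upwards [hnear] with s hs
    rw [hKa _ hs.1 hs.2, ofCoord_toCoord hs.2]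
  have hβ : MDifferentiableAt 𝓘(ℝ, F) 𝓘(ℝ, F) (fun z ↦ K z (u₁ t)) (c t) :=
    hKd.clm_apply mdifferentiableAt_const
  have h2 : mvfderiv 𝓘(ℝ, F) (fun z ↦ K z (u₁ t)) (c t) (mfderiv 𝓘(ℝ, ℝ) 𝓘(ℝ, F) c t (1 : ℝ)) =
      (mvfderiv 𝓘(ℝ, F) K (c t) (mfderiv 𝓘(ℝ, ℝ) 𝓘(ℝ, F) c t (1 : ℝ))) (u₁ t) := by
    refine (deriv_comp_curve hβ hc).unique ((hKc.clm_apply (hasDerivAt_const t (u₁ t))).congr_deriv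
      (by simp))
  -- A field frozen in the moving chart has coordinates $K(z)u_1(t)$ in the fixed one; its
  -- derivative is the summand that completes the product rule `h1`.
  have h3 : ∀ᶠ z in 𝓝 (c t), FiberBundle.extend F (V t) z = ofCoord y₀ z (K z (u₁ t)) := by
    filter_upwards [chart_source_mem_nhds hy, chart_source_mem_nhds hy1] with z hz hz1
    rw [hKa z hz hz1, ofCoord_toCoord hz, ofCoord_eq_symm hz1]
    simp only [FiberBundle.extend, hu₁, trivializationAt_snd hy1]
  have h4 : cov (FiberBundle.extend F (V t)) (c t) =
      cov (fun z ↦ ofCoord y₀ z (K z (u₁ t))) (c t) :=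
    (cov.isCovariantDerivativeOn (s := univ)).congr_of_eventuallyEq
      (FiberBundle.mdifferentiableAt_extend _ _ _)
      ((mdifferentiableAt_ofCoord_iff hy).2 hβ) Filter.univ_mem h3
  have h5 : deriv (fun s ↦ (e₁ (⟨c s, V s⟩ : TangentBundle 𝓘(ℝ, F) N)).2) t = deriv u₁ t := by
    refine Filter.EventuallyEq.deriv_eq ?_
    filter_upwards [hnear] with s hs
    exact trivializationAt_snd hs.2 _
  have h6 : covDerivAlong cov c V t = ofCoord (c t) (c t) (deriv u₁ t) +
      cov (FiberBundle.extend F (V t)) (c t) (mfderiv 𝓘(ℝ, ℝ) 𝓘(ℝ, F) c t (1 : ℝ)) := by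
    rw [ofCoord_eq_symm hy1, ← h5]
    rfl
  rw [h6, map_add, h4, toCoord_cov_ofCoord cov hy hβ, h2, h1.deriv, ← hKa _ hy hy1,
    toCoord_mfderiv_curve hy hc, hKa _ hy hy1 (u₁ t), hu₁]
  simp only [ofCoord_toCoord hy1]
  abel

end AlongCurves

/-! ### Local data of an immersion, the normal connection and the Ricci equation. -/

theorem fderiv_eq_of_apply_eq {E₁ E₂ E₃ E₄ X : Type*} [NormedAddCommGroup E₁]
    [NormedSpace ℝ E₁] [NormedAddCommGroup E₂] [NormedSpace ℝ E₂] [NormedAddCommGroup E₃]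
    [NormedSpace ℝ E₃] [NormedAddCommGroup E₄] [NormedSpace ℝ E₄] [NormedAddCommGroup X]
    [NormedSpace ℝ X] {Φ Ψ : E₁ → E₂ →L[ℝ] E₃ →L[ℝ] X} {T : E₁ → E₄ →L[ℝ] X}
    {S : E₁ → E₂ →L[ℝ] E₃ →L[ℝ] E₄} (h : ∀ z Y u, Φ z Y u = Ψ z Y u + T z (S z Y u)) {x : E₁}
    (hΦ : DifferentiableAt ℝ Φ x) (hΨ : DifferentiableAt ℝ Ψ x) (hT : DifferentiableAt ℝ T x)
    (hS : DifferentiableAt ℝ S x) (v : E₁) (Y : E₂) (u : E₃) :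
    fderiv ℝ Φ x v Y u =
      fderiv ℝ Ψ x v Y u + (fderiv ℝ T x v (S x Y u) + T x (fderiv ℝ S x v Y u)) := by
  have h1 := hasFDerivAt_clm_apply_apply hΦ Y u
  simp only [h] at h1
  have h2 := (hasFDerivAt_clm_apply_apply hΨ Y u).add
    (hT.hasFDerivAt.clm_apply (hasFDerivAt_clm_apply_apply hS Y u))
  have h3 := congrArg (fun L : E₁ →L[ℝ] X ↦ L v) (h1.unique h2)
  simp only [ContinuousLinearMap.flip_apply, add_apply, ContinuousLinearMap.comp_apply] at h3
  rw [h3, add_comm (T x _)]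

/-- Makes the local connection form global without changing it near `x₀`, so that the equations of
transport can be solved on all of `E`. -/
theorem exists_contDiff_eqOn_ball {E X : Type*} [NormedAddCommGroup E] [NormedSpace ℝ E]
    [FiniteDimensional ℝ E] [NormedAddCommGroup X] [NormedSpace ℝ X] {U : Set E} (hU : IsOpen U)
    {Φ : E → X} (hΦ : ContDiffOn ℝ ∞ Φ U) {x₀ : E} (hx₀ : x₀ ∈ U) :
    ∃ r > 0, ∃ Ψ : E → X, ContDiff ℝ 1 Ψ ∧ Metric.ball x₀ r ⊆ U ∧
      EqOn Ψ Φ (Metric.ball x₀ r) := by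
  obtain ⟨r, hr, hrU⟩ := Metric.nhds_basis_closedBall.mem_iff.1 (hU.mem_nhds hx₀)
  let χ : ContDiffBump x₀ := ⟨r / 2, r, half_pos hr, half_lt_self hr⟩
  refine ⟨r / 2, half_pos hr, fun x ↦ χ x • Φ x, ?_,
    (Metric.ball_subset_closedBall.trans (Metric.closedBall_subset_closedBall
      (half_le_self hr.le))).trans hrU, fun x hx ↦ ?_⟩
  · rw [contDiff_iff_contDiffAt]
    intro x
    by_cases hx : x ∈ U
    · exact (χ.contDiff.contDiffAt).smul ((hΦ.contDiffAt (hU.mem_nhds hx)).of_le (by simp))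
    · refine contDiffAt_const (c := 0) |>.congr_of_eventuallyEq ?_
      have hx' : x ∉ tsupport χ := by
        rw [χ.tsupport_eq]
        exact fun hx' ↦ hx (hrU hx')
      filter_upwards [notMem_tsupport_iff_eventuallyEq.1 hx'] with y hy
      rw [hy, Pi.zero_apply, zero_smul]
  · simp only [χ.one_of_mem_closedBall (Metric.ball_subset_closedBall hx), one_smul]

section ImmersedConnection

variable {E : Type*} [NormedAddCommGroup E] [NormedSpace ℝ E] [FiniteDimensional ℝ E]
  {F : Type*} [NormedAddCommGroup F] [NormedSpace ℝ F] [FiniteDimensional ℝ F]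

/-- Coordinates of a spacelike immersion on the open set `U`: the differential `T`, the metric `G`
of the ambient space and its connection `d + θ`, pulled back to `U`. The curvature of `d + θ`
has no normal component. -/
structure IsImmersedConnection (U : Set E) (T : E → E →L[ℝ] F) (G : E → F →L[ℝ] F →L[ℝ] ℝ)
    (θ : E → E →L[ℝ] F →L[ℝ] F) : Prop where
  isOpen : IsOpen U
  contDiffOn_differential : ContDiffOn ℝ ∞ T U
  contDiffOn_metric : ContDiffOn ℝ ∞ G U
  contDiffOn_conn : ContDiffOn ℝ ∞ θ U
  symm : ∀ x ∈ U, ∀ u w, G x u w = G x w u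
  pos : ∀ x ∈ U, ∀ X, X ≠ 0 → 0 < G x (T x X) (T x X)
  metric : ∀ x ∈ U, ∀ X u w, fderiv ℝ G x X u w = G x (θ x X u) w + G x u (θ x X w)
  torsion : ∀ x ∈ U, ∀ X Y,
    fderiv ℝ T x X Y + θ x X (T x Y) = fderiv ℝ T x Y X + θ x Y (T x X)
  curvature : ∀ x ∈ U, ∀ X Y u w, (∀ Z, G x (T x Z) u = 0) → (∀ Z, G x (T x Z) w = 0) →
    G x (connCurvature θ x X Y u) w = 0

/-- The second fundamental form, before projection to the normal space. -/
def secondForm (T : E → E →L[ℝ] F) (θ : E → E →L[ℝ] F →L[ℝ] F) (x : E) : E →L[ℝ] E →L[ℝ] F :=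
  fderiv ℝ T x + ((ContinuousLinearMap.compL ℝ E F F).flip (T x)) ∘L θ x

theorem secondForm_apply (T : E → E →L[ℝ] F) (θ : E → E →L[ℝ] F →L[ℝ] F) (x X Y : E) :
    secondForm T θ x X Y = fderiv ℝ T x X Y + θ x X (T x Y) := rfl

/-- The induced metric. -/
def firstForm (T : E → E →L[ℝ] F) (G : E → F →L[ℝ] F →L[ℝ] ℝ) (x : E) : E →L[ℝ] E →L[ℝ] ℝ :=
  (G x).bilinearComp (T x) (T x)

theorem firstForm_apply (T : E → E →L[ℝ] F) (G : E → F →L[ℝ] F →L[ℝ] ℝ) (x X Y : E) :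
    firstForm T G x X Y = G x (T x X) (T x Y) := rfl

/-- The form dual to the shape operator. -/
def shapeForm (T : E → E →L[ℝ] F) (G : E → F →L[ℝ] F →L[ℝ] ℝ) (θ : E → E →L[ℝ] F →L[ℝ] F)
    (x : E) : E →L[ℝ] F →L[ℝ] E →L[ℝ] ℝ :=
  ((ContinuousLinearMap.compL ℝ E F ℝ).bilinearComp (G x) (secondForm T θ x)).flip

theorem shapeForm_apply (T : E → E →L[ℝ] F) (G : E → F →L[ℝ] F →L[ℝ] ℝ)
    (θ : E → E →L[ℝ] F →L[ℝ] F) (x X : E) (u : F) (Y : E) :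
    shapeForm T G θ x X u Y = G x u (secondForm T θ x X Y) := rfl

/-- The shape operator. -/
def shapeOperator (T : E → E →L[ℝ] F) (G : E → F →L[ℝ] F →L[ℝ] ℝ) (θ : E → E →L[ℝ] F →L[ℝ] F)
    (x : E) : E →L[ℝ] F →L[ℝ] E :=
  (ContinuousLinearMap.compL ℝ F (E →L[ℝ] ℝ) E (firstForm T G x).inverse) ∘L shapeForm T G θ x

theorem shapeOperator_apply (T : E → E →L[ℝ] F) (G : E → F →L[ℝ] F →L[ℝ] ℝ)
    (θ : E → E →L[ℝ] F →L[ℝ] F) (x X : E) (u : F) :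
    shapeOperator T G θ x X u = (firstForm T G x).inverse (shapeForm T G θ x X u) := rfl

/-- The connection `d + θ`, modified such that its parallel transport preserves normal fields. -/
def normalConnection (T : E → E →L[ℝ] F) (G : E → F →L[ℝ] F →L[ℝ] ℝ) (θ : E → E →L[ℝ] F →L[ℝ] F)
    (x : E) : E →L[ℝ] F →L[ℝ] F :=
  θ x + (ContinuousLinearMap.compL ℝ F E F (T x)) ∘L shapeOperator T G θ x

theorem normalConnection_apply (T : E → E →L[ℝ] F) (G : E → F →L[ℝ] F →L[ℝ] ℝ)
    (θ : E → E →L[ℝ] F →L[ℝ] F) (x X : E) (u : F) :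
    normalConnection T G θ x X u = θ x X u + T x (shapeOperator T G θ x X u) := rfl

namespace IsImmersedConnection

variable {U : Set E} {T : E → E →L[ℝ] F} {G : E → F →L[ℝ] F →L[ℝ] ℝ}
  {θ : E → E →L[ℝ] F →L[ℝ] F}

/-- Positivity gives injectivity, and dimensions agree. This makes `ContinuousLinearMap.inverse` in
`shapeOperator` a genuine inverse. -/
theorem exists_firstForm_equiv (h : IsImmersedConnection U T G θ) {x : E} (hx : x ∈ U) :
    ∃ e : E ≃L[ℝ] (E →L[ℝ] ℝ), (e : E →L[ℝ] E →L[ℝ] ℝ) = firstForm T G x := by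
  have hinj : Function.Injective (firstForm T G x : E →ₗ[ℝ] E →L[ℝ] ℝ) := by
    rw [injective_iff_map_eq_zero]
    intro X hX
    by_contra hne
    have h1 := h.pos x hx X hne
    have h2 : firstForm T G x X X = 0 := by
      have : firstForm T G x X = 0 := hX
      rw [this, zero_apply]
    rw [firstForm_apply] at h2
    exact h1.ne' h2
  have hdim : Module.finrank ℝ E = Module.finrank ℝ (E →L[ℝ] ℝ) := by
    rw [← (LinearMap.toContinuousLinearMap : (E →ₗ[ℝ] ℝ) ≃ₗ[ℝ] E →L[ℝ] ℝ).finrank_eq]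
    exact (Subspace.dual_finrank_eq (K := ℝ) (V := E)).symm
  refine ⟨(LinearMap.linearEquivOfInjective _ hinj hdim).toContinuousLinearEquiv, ?_⟩
  ext X Y
  rfl

/-- The Weingarten relation. It holds for every `u`, normal or not, because `shapeOperator` is
defined by duality on all of `F`. -/
theorem firstForm_shapeOperator (h : IsImmersedConnection U T G θ) {x : E} (hx : x ∈ U) (X : E)
    (u : F) (Y : E) : G x (T x (shapeOperator T G θ x X u)) (T x Y) =
      G x (secondForm T θ x X Y) u := by
  obtain ⟨e, he⟩ := h.exists_firstForm_equiv hx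
  rw [← firstForm_apply, shapeOperator_apply, ← he, ContinuousLinearMap.inverse_equiv]
  have h1 : (e : E →L[ℝ] E →L[ℝ] ℝ) ((e.symm : (E →L[ℝ] ℝ) →L[ℝ] E) (shapeForm T G θ x X u)) =
      shapeForm T G θ x X u := e.apply_symm_apply _
  rw [h1, shapeForm_apply, h.symm x hx]

theorem contDiffOn_firstForm (h : IsImmersedConnection U T G θ) :
    ContDiffOn ℝ ∞ (firstForm T G) U := by
  rw [contDiffOn_clm_apply]
  intro X
  rw [contDiffOn_clm_apply]
  intro Y
  exact (h.contDiffOn_metric.clm_apply (h.contDiffOn_differential.clm_apply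
    contDiffOn_const)).clm_apply (h.contDiffOn_differential.clm_apply contDiffOn_const)

theorem contDiffOn_inverse_firstForm (h : IsImmersedConnection U T G θ) :
    ContDiffOn ℝ ∞ (fun x ↦ (firstForm T G x).inverse) U := by
  have : CompleteSpace E := FiniteDimensional.complete ℝ E
  intro x hx
  obtain ⟨e, he⟩ := h.exists_firstForm_equiv hx
  have h1 := contDiffAt_map_inverse (𝕜 := ℝ) (n := ∞) e
  rw [he] at h1
  exact ContDiffAt.comp_contDiffWithinAt x h1 (h.contDiffOn_firstForm x hx)

theorem contDiffOn_shapeForm_apply (h : IsImmersedConnection U T G θ) (X : E) (u : F) :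
    ContDiffOn ℝ ∞ (fun x ↦ shapeForm T G θ x X u) U := by
  rw [contDiffOn_clm_apply]
  intro Y
  have h1 : ContDiffOn ℝ ∞ (fun x ↦ fderiv ℝ T x X Y) U :=
    ((h.contDiffOn_differential.fderiv_of_isOpen h.isOpen (m := ∞) (by simp)).clm_apply
      contDiffOn_const).clm_apply contDiffOn_const
  have h2 : ContDiffOn ℝ ∞ (fun x ↦ θ x X (T x Y)) U :=
    (h.contDiffOn_conn.clm_apply contDiffOn_const).clm_apply
      (h.contDiffOn_differential.clm_apply contDiffOn_const)
  exact (h.contDiffOn_metric.clm_apply contDiffOn_const).clm_apply (h1.add h2)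

theorem contDiffOn_shapeOperator (h : IsImmersedConnection U T G θ) :
    ContDiffOn ℝ ∞ (shapeOperator T G θ) U := by
  rw [contDiffOn_clm_apply]
  intro X
  rw [contDiffOn_clm_apply]
  intro u
  exact h.contDiffOn_inverse_firstForm.clm_apply (h.contDiffOn_shapeForm_apply X u)

theorem contDiffOn_normalConnection (h : IsImmersedConnection U T G θ) :
    ContDiffOn ℝ ∞ (normalConnection T G θ) U := by
  rw [contDiffOn_clm_apply]
  intro X
  rw [contDiffOn_clm_apply]
  intro u
  exact ((h.contDiffOn_conn.clm_apply contDiffOn_const).clm_apply contDiffOn_const).add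
    (h.contDiffOn_differential.clm_apply ((h.contDiffOn_shapeOperator.clm_apply
      contDiffOn_const).clm_apply contDiffOn_const))

theorem differentiableAt_of_contDiffOn {X : Type*} [NormedAddCommGroup X] [NormedSpace ℝ X]
    (h : IsImmersedConnection U T G θ) {x : E} (hx : x ∈ U) {Φ : E → X}
    (hΦ : ContDiffOn ℝ ∞ Φ U) : DifferentiableAt ℝ Φ x :=
  (hΦ.contDiffAt (h.isOpen.mem_nhds hx)).differentiableAt (by simp)

theorem fderiv_normalConnection (h : IsImmersedConnection U T G θ) {x : E} (hx : x ∈ U) (X Y : E)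
    (u : F) : fderiv ℝ (normalConnection T G θ) x X Y u =
      fderiv ℝ θ x X Y u + (fderiv ℝ T x X (shapeOperator T G θ x Y u) +
        T x (fderiv ℝ (shapeOperator T G θ) x X Y u)) := by
  exact fderiv_eq_of_apply_eq (fun z Y u ↦ normalConnection_apply T G θ z Y u)
    (h.differentiableAt_of_contDiffOn (X := E →L[ℝ] F →L[ℝ] F) hx h.contDiffOn_normalConnection)
    (h.differentiableAt_of_contDiffOn (X := E →L[ℝ] F →L[ℝ] F) hx h.contDiffOn_conn)
    (h.differentiableAt_of_contDiffOn hx h.contDiffOn_differential)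
    (h.differentiableAt_of_contDiffOn (X := E →L[ℝ] F →L[ℝ] E) hx h.contDiffOn_shapeOperator) X Y u

/-- The Ricci equation. -/
theorem curvature_normalConnection (h : IsImmersedConnection U T G θ) {x : E} (hx : x ∈ U)
    (X Y : E) {u w : F} (hu : ∀ Z, G x (T x Z) u = 0) (hw : ∀ Z, G x (T x Z) w = 0) :
    G x (connCurvature (normalConnection T G θ) x X Y u) w =
      G x (secondForm T θ x X (shapeOperator T G θ x Y u)) w -
        G x (secondForm T θ x Y (shapeOperator T G θ x X u)) w := by
  -- The correction $T\circ S$ changes the curvature by second-form terms and a tangent vector; the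
  -- latter is orthogonal to the normal vector `w`.
  have h1 : ∃ Z, connCurvature (normalConnection T G θ) x X Y u = connCurvature θ x X Y u +
      (secondForm T θ x X (shapeOperator T G θ x Y u) -
        secondForm T θ x Y (shapeOperator T G θ x X u)) + T x Z := by
    refine ⟨fderiv ℝ (shapeOperator T G θ) x X Y u - fderiv ℝ (shapeOperator T G θ) x Y X u +
      shapeOperator T G θ x X (normalConnection T G θ x Y u) -
      shapeOperator T G θ x Y (normalConnection T G θ x X u), ?_⟩
    simp only [connCurvature, add_apply, sub_apply, ContinuousLinearMap.mul_def, ContinuousLinearMap.comp_apply,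
      h.fderiv_normalConnection hx, secondForm_apply, map_add, map_sub, normalConnection_apply]
    abel
  obtain ⟨Z, hZ⟩ := h1
  rw [hZ, map_add, map_add, add_apply, add_apply, h.curvature x hx X Y u w hu hw, hw Z, map_sub,
    sub_apply]
  ring

/-- The norm of `E` is unrelated to the induced metric, so a basis orthogonal for the form is chosen
and rescaled, which positivity allows. -/
theorem exists_orthonormal_basis (h : IsImmersedConnection U T G θ) {x : E} (hx : x ∈ U) :
    ∃ b : Module.Basis (Fin (Module.finrank ℝ E)) ℝ E,
      ∀ i j, G x (T x (b i)) (T x (b j)) = if i = j then 1 else 0 := by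
  let B : LinearMap.BilinForm ℝ E := LinearMap.mk₂ ℝ (fun X Y ↦ G x (T x X) (T x Y))
    (by intros; simp) (by intros; simp) (by intros; simp) (by intros; simp)
  have hB : LinearMap.IsSymm B := ⟨fun X Y ↦ h.symm x hx _ _⟩
  obtain ⟨v, hv⟩ := LinearMap.BilinForm.exists_orthogonal_basis (B := B) hB
  have hpos : ∀ i, 0 < G x (T x (v i)) (T x (v i)) := fun i ↦ h.pos x hx _ (v.ne_zero i)
  have hunit : ∀ i, IsUnit (√(G x (T x (v i)) (T x (v i))))⁻¹ := fun i ↦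
    (inv_ne_zero (Real.sqrt_pos.2 (hpos i)).ne').isUnit
  refine ⟨v.isUnitSMul hunit, fun i j ↦ ?_⟩
  rw [Module.Basis.isUnitSMul_apply, Module.Basis.isUnitSMul_apply]
  simp only [map_smul, smul_apply, smul_eq_mul]
  split_ifs with hij
  · subst hij
    have h1 := Real.mul_self_sqrt (hpos i).le
    have h2 := (Real.sqrt_pos.2 (hpos i)).ne'
    field_simp
    nlinarith
  · have : G x (T x (v i)) (T x (v j)) = 0 := hv hij
    rw [this]
    simp

/-- The Ricci equation written in an orthonormal basis. The order `b k`, `b i` on the left absorbs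
the sign of the commutator, and symmetry of the matrices is symmetry of the second fundamental form.
-/
theorem exists_matrix (h : IsImmersedConnection U T G θ) {x : E} (hx : x ∈ U) :
    ∃ (b : Module.Basis (Fin (Module.finrank ℝ E)) ℝ E)
      (A : F →ₗ[ℝ] Matrix (Fin (Module.finrank ℝ E)) (Fin (Module.finrank ℝ E)) ℝ),
      (∀ u, (A u).IsSymm) ∧ ∀ i k u w, (∀ Z, G x (T x Z) u = 0) → (∀ Z, G x (T x Z) w = 0) →
        G x (connCurvature (normalConnection T G θ) x (b k) (b i) u) w =
          (A u * A w - A w * A u) i k := by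
  obtain ⟨b, hb⟩ := h.exists_orthonormal_basis hx
  let A : F →ₗ[ℝ] Matrix (Fin (Module.finrank ℝ E)) (Fin (Module.finrank ℝ E)) ℝ :=
    { toFun := fun u ↦ Matrix.of fun i j ↦ G x (secondForm T θ x (b i) (b j)) u
      map_add' := by
        intro u w
        ext i j
        simp
      map_smul' := by
        intro c u
        ext i j
        simp }
  have hA : ∀ u i j, A u i j = G x (secondForm T θ x (b i) (b j)) u := fun u i j ↦ rfl
  have hsymm : ∀ u i j, A u i j = A u j i := by
    intro u i j
    rw [hA, hA, secondForm_apply, secondForm_apply, h.torsion x hx]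
  have hexp : ∀ X : E, X = ∑ j, G x (T x X) (T x (b j)) • b j := by
    intro X
    have h1 : ∀ j, G x (T x X) (T x (b j)) = b.repr X j := by
      intro j
      have h2 : G x (T x (∑ i, b.repr X i • b i)) (T x (b j)) = b.repr X j := by
        simp only [map_sum, map_smul, sum_apply, smul_apply, smul_eq_mul, hb]
        simp
      rwa [b.sum_repr] at h2
    simp only [h1]
    exact (b.sum_repr X).symm
  have hsh : ∀ i k u w, G x (secondForm T θ x (b k) (shapeOperator T G θ x (b i) u)) w =
      (A u * A w) i k := by
    intro i k u w
    rw [hexp (shapeOperator T G θ x (b i) u), Matrix.mul_apply]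
    simp only [h.firstForm_shapeOperator hx, map_sum, map_smul, sum_apply, smul_apply, smul_eq_mul]
    refine Finset.sum_congr rfl fun j _ ↦ ?_
    rw [hsymm w j k, hA, hA]
  refine ⟨b, A, fun u ↦ Matrix.IsSymm.ext fun i j ↦ hsymm u j i, fun i k u w hu hw ↦ ?_⟩
  rw [h.curvature_normalConnection hx _ _ hu hw, hsh, hsh, Matrix.sub_apply]
  congr 1
  rw [Matrix.mul_apply, Matrix.mul_apply]
  refine Finset.sum_congr rfl fun j _ ↦ ?_
  rw [hsymm u k j, hsymm w j i, mul_comm]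

/-- The normal connection, extended from a neighbourhood of `x₀`. -/
theorem exists_global_normalConnection (h : IsImmersedConnection U T G θ) {x₀ : E} (hx₀ : x₀ ∈ U) :
    ∃ r > 0, ∃ Ω : E → E →L[ℝ] F →L[ℝ] F, ContDiff ℝ 1 Ω ∧ Metric.ball x₀ r ⊆ U ∧
      EqOn Ω (normalConnection T G θ) (Metric.ball x₀ r) :=
  exists_contDiff_eqOn_ball (X := E →L[ℝ] F →L[ℝ] F) h.isOpen h.contDiffOn_normalConnection hx₀

end IsImmersedConnection

theorem connCurvature_congr {𝔸 : Type*} [NormedRing 𝔸] [NormedAlgebra ℝ 𝔸]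
    {Ω Ω' : E → E →L[ℝ] 𝔸} {x : E} (h : Ω =ᶠ[𝓝 x] Ω') (X Y : E) :
    connCurvature Ω x X Y = connCurvature Ω' x X Y := by
  rw [connCurvature, connCurvature, h.fderiv_eq, h.self_of_nhds]

end ImmersedConnection

set_option synthInstance.maxHeartbeats 400000

theorem two_le_infty : minSmoothness ℝ 2 ≤ (∞ : ℕ∞ω) := by
  rw [minSmoothness_of_isRCLikeNormedField]
  exact WithTop.coe_le_coe.2 (le_top : (2 : ℕ∞) ≤ ⊤)

section ImmersedConnection

variable {E : Type*} [NormedAddCommGroup E] [NormedSpace ℝ E] [FiniteDimensional ℝ E]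
  {F : Type*} [NormedAddCommGroup F] [NormedSpace ℝ F] [FiniteDimensional ℝ F]

namespace IsImmersedConnection

variable {U : Set E} {T : E → E →L[ℝ] F} {G : E → F →L[ℝ] F →L[ℝ] ℝ}
  {θ : E → E →L[ℝ] F →L[ℝ] F}

theorem hasDerivAt_metric (h : IsImmersedConnection U T G θ) {x : ℝ → E} {x' : E} {t : ℝ}
    (hx : HasDerivAt x x' t) (hxU : x t ∈ U) {p q : ℝ → F} {p' q' : F} (hp : HasDerivAt p p' t)
    (hq : HasDerivAt q q' t) :
    HasDerivAt (fun s ↦ G (x s) (p s) (q s))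
      (G (x t) (p' + θ (x t) x' (p t)) (q t) + G (x t) (p t) (q' + θ (x t) x' (q t))) t := by
  have hG := (h.differentiableAt_of_contDiffOn (X := F →L[ℝ] F →L[ℝ] ℝ) hxU
    h.contDiffOn_metric).hasFDerivAt.comp_hasDerivAt t hx
  refine ((hG.clm_apply hp).clm_apply hq).congr_deriv ?_
  simp only [add_apply, map_add, h.metric _ hxU, Function.comp_apply]
  ring

theorem hasDerivAt_differential (h : IsImmersedConnection U T G θ) {x : ℝ → E} {x' : E} {t : ℝ}
    (hx : HasDerivAt x x' t) (hxU : x t ∈ U) (Y : E) :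
    HasDerivAt (fun s ↦ T (x s) Y) (fderiv ℝ T (x t) x' Y) t := by
  have hT := (h.differentiableAt_of_contDiffOn hxU
    h.contDiffOn_differential).hasFDerivAt.comp_hasDerivAt t hx
  exact (hT.clm_apply (hasDerivAt_const t Y)).congr_deriv (by simp)

/-- This is why the correction $T\circ S$ is added to `θ`: the products of a field parallel for
`normalConnection` with the tangent vectors `T x Y` are constant, so normality propagates. -/
theorem hasDerivAt_metric_differential (h : IsImmersedConnection U T G θ) {x : ℝ → E} {x' : E}
    {t : ℝ} (hx : HasDerivAt x x' t) (hxU : x t ∈ U) (Y : E) {u : ℝ → F} {u' : F}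
    (hu : HasDerivAt u u' t) :
    HasDerivAt (fun s ↦ G (x s) (T (x s) Y) (u s))
      (G (x t) (T (x t) Y) (u' + normalConnection T G θ (x t) x' (u t))) t := by
  refine (h.hasDerivAt_metric hx hxU (h.hasDerivAt_differential hx hxU Y) hu).congr_deriv ?_
  rw [normalConnection_apply, ← secondForm_apply, ← h.firstForm_shapeOperator hxU,
    h.symm _ hxU (T _ (shapeOperator _ _ _ _ _ _))]
  simp only [map_add]
  ring

theorem eq_zero_of_forall_eq_zero (h : IsImmersedConnection U T G θ) {x : E} (hx : x ∈ U) {Z : E}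
    (hZ : ∀ Y, G x (T x Y) (T x Z) = 0) : Z = 0 := by
  by_contra hne
  exact (h.pos x hx Z hne).ne' (hZ Z)

/-- A normal field whose covariant derivative is tangent is parallel for the normal connection. -/
theorem eq_neg_normalConnection (h : IsImmersedConnection U T G θ) {x : ℝ → E} {x' : E}
    {t : ℝ} (hx : HasDerivAt x x' t) (hxU : x t ∈ U) {u : ℝ → F} {u' : F}
    (hu : HasDerivAt u u' t) (hn : ∀ᶠ s in 𝓝 t, ∀ Y, G (x s) (T (x s) Y) (u s) = 0) {Z : E}
    (hZ : u' + θ (x t) x' (u t) = T (x t) Z) :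
    u' = -normalConnection T G θ (x t) x' (u t) := by
  have h1 : Z + shapeOperator T G θ (x t) x' (u t) = 0 := by
    refine h.eq_zero_of_forall_eq_zero hxU fun Y ↦ ?_
    have h2 := h.hasDerivAt_metric_differential hx hxU Y hu
    have h3 : HasDerivAt (fun s ↦ G (x s) (T (x s) Y) (u s)) 0 t := by
      refine (hasDerivAt_const t (0 : ℝ)).congr_of_eventuallyEq ?_
      filter_upwards [hn] with s hs
      exact hs Y
    rw [map_add, ← hZ, add_assoc, ← normalConnection_apply]
    exact h2.unique h3
  rw [eq_neg_iff_add_eq_zero, normalConnection_apply, ← add_assoc, hZ, ← map_add, h1, map_zero]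

/-- `normalConnection` differs from a metric connection by tangential terms, and these are
orthogonal to normal fields; hence transport is isometric on normal vectors. -/
theorem hasDerivAt_metric_of_normal (h : IsImmersedConnection U T G θ) {x : ℝ → E} {x' : E}
    {t : ℝ} (hx : HasDerivAt x x' t) (hxU : x t ∈ U) {u w : ℝ → F}
    (hu : HasDerivAt u (-normalConnection T G θ (x t) x' (u t)) t)
    (hw : HasDerivAt w (-normalConnection T G θ (x t) x' (w t)) t)
    (hun : ∀ Y, G (x t) (T (x t) Y) (u t) = 0) (hwn : ∀ Y, G (x t) (T (x t) Y) (w t) = 0) :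
    HasDerivAt (fun s ↦ G (x s) (u s) (w s)) 0 t := by
  refine (h.hasDerivAt_metric hx hxU hu hw).congr_deriv ?_
  simp only [normalConnection_apply, neg_add_rev, add_assoc, neg_add_cancel, add_zero]
  rw [h.symm _ hxU (u t), map_neg, map_neg, neg_apply, neg_apply, hun, hwn, neg_zero, add_zero]

end IsImmersedConnection

end ImmersedConnection

/-! ### The submanifold in charts. -/

theorem hasFDerivAt_fun_comp {E₁ F₂ X : Type*} [NormedAddCommGroup E₁] [NormedSpace ℝ E₁]
    [NormedAddCommGroup F₂] [NormedSpace ℝ F₂] [NormedAddCommGroup X] [NormedSpace ℝ X]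
    {G : F₂ → X} {m : E₁ → F₂} {x : E₁} (hG : DifferentiableAt ℝ G (m x))
    (hm : DifferentiableAt ℝ m x) :
    HasFDerivAt (fun z ↦ G (m z)) (fderiv ℝ G (m x) ∘L fderiv ℝ m x) x :=
  hG.hasFDerivAt.comp x hm.hasFDerivAt

theorem fderiv_eq_of_comp_apply_eq {E₁ E₂ F₁ F₂ X : Type*} [NormedAddCommGroup E₁]
    [NormedSpace ℝ E₁] [NormedAddCommGroup E₂] [NormedSpace ℝ E₂] [NormedAddCommGroup F₁]
    [NormedSpace ℝ F₁] [NormedAddCommGroup F₂] [NormedSpace ℝ F₂] [NormedAddCommGroup X]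
    [NormedSpace ℝ X] {Θ : E₁ → E₂ →L[ℝ] F₁ →L[ℝ] X} {Γ : F₂ → F₁ →L[ℝ] F₂ →L[ℝ] X} {m : E₁ → F₂}
    {T : E₁ → E₂ →L[ℝ] F₂} (h : ∀ z Y u, Θ z Y u = Γ (m z) u (T z Y)) {x : E₁}
    (hΘ : DifferentiableAt ℝ Θ x) (hΓ : DifferentiableAt ℝ Γ (m x)) (hm : DifferentiableAt ℝ m x)
    (hT : DifferentiableAt ℝ T x) (v : E₁) (Y : E₂) (u : F₁) :
    fderiv ℝ Θ x v Y u =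
      fderiv ℝ Γ (m x) (fderiv ℝ m x v) u (T x Y) + Γ (m x) u (fderiv ℝ T x v Y) := by
  have h1 := hasFDerivAt_clm_apply_apply hΘ Y u
  simp only [h] at h1
  have h0 := hasFDerivAt_fun_comp (X := F₁ →L[ℝ] F₂ →L[ℝ] X) hΓ hm
  have h2 := ((h0.clm_apply (hasFDerivAt_const u x)).clm_apply
    (hT.hasFDerivAt.clm_apply (hasFDerivAt_const Y x)))
  have h3 := congrArg (fun L : E₁ →L[ℝ] X ↦ L v) (h1.unique h2)
  simp at h3
  rw [h3, add_comm]

section Submanifold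

variable {E : Type*} [NormedAddCommGroup E] [NormedSpace ℝ E] [FiniteDimensional ℝ E]
  {M : Type*} [TopologicalSpace M] [T2Space M] [ChartedSpace E M] [IsManifold 𝓘(ℝ, E) ∞ M]
  {F : Type*} [NormedAddCommGroup F] [NormedSpace ℝ F] [FiniteDimensional ℝ F]
  {N : Type*} [TopologicalSpace N] [T2Space N] [ChartedSpace F N] [IsManifold 𝓘(ℝ, F) ∞ N]

variable (E F) in
/-- The map `f` in the charts at `x₀` and `f x₀`. -/
def locMap (f : M → N) (x₀ : M) (z : E) : F :=
  extChartAt 𝓘(ℝ, F) (f x₀) (f ((extChartAt 𝓘(ℝ, E) x₀).symm z))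

variable (E F) in
/-- The domain of `locMap`. -/
def locDomain (f : M → N) (x₀ : M) : Set E :=
  (extChartAt 𝓘(ℝ, E) x₀).target ∩
    (fun z ↦ f ((extChartAt 𝓘(ℝ, E) x₀).symm z)) ⁻¹' (chartAt F (f x₀)).source

/-- The connection of the ambient space, pulled back by `f`. -/
def locConn (cov : CovariantDerivative 𝓘(ℝ, F) F (TangentSpace 𝓘(ℝ, F) : N → Type _))
    (f : M → N) (x₀ : M) (z : E) : E →L[ℝ] F →L[ℝ] F :=
  (christoffel cov (f x₀) (locMap E F f x₀ z)).flip ∘L fderiv ℝ (locMap E F f x₀) z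

variable {g : PseudoRiemannianMetric F N}
  {cov : CovariantDerivative 𝓘(ℝ, F) F (TangentSpace 𝓘(ℝ, F) : N → Type _)} {f : M → N} {x₀ : M}

theorem locConn_apply (z X : E) (u : F) : locConn cov f x₀ z X u =
    christoffel cov (f x₀) (locMap E F f x₀ z) u (fderiv ℝ (locMap E F f x₀) z X) := rfl

theorem symm_mem_source {z : E} (hz : z ∈ locDomain E F f x₀) :
    (extChartAt 𝓘(ℝ, E) x₀).symm z ∈ (chartAt E x₀).source := by
  simpa using (extChartAt 𝓘(ℝ, E) x₀).map_target hz.1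

theorem mapsTo_locMap : MapsTo (locMap E F f x₀) (locDomain E F f x₀)
    (extChartAt 𝓘(ℝ, F) (f x₀)).target := fun _ hz ↦ extChartAt_mem_target hz.2

theorem contMDiffOn_comp_symm (hf : ContMDiff 𝓘(ℝ, E) 𝓘(ℝ, F) ∞ f) :
    ContMDiffOn 𝓘(ℝ, E) 𝓘(ℝ, F) ∞ (fun z ↦ f ((extChartAt 𝓘(ℝ, E) x₀).symm z))
      (extChartAt 𝓘(ℝ, E) x₀).target :=
  hf.comp_contMDiffOn (contMDiffOn_extChartAt_symm x₀)

theorem isOpen_locDomain (hf : ContMDiff 𝓘(ℝ, E) 𝓘(ℝ, F) ∞ f) : IsOpen (locDomain E F f x₀) :=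
  (contMDiffOn_comp_symm hf).continuousOn.isOpen_inter_preimage (isOpen_extChartAt_target x₀)
    (chartAt F (f x₀)).open_source

theorem mem_locDomain (f : M → N) (x₀ : M) : extChartAt 𝓘(ℝ, E) x₀ x₀ ∈ locDomain E F f x₀ := by
  refine ⟨mem_extChartAt_target x₀, ?_⟩
  simp

theorem contDiffOn_locMap (hf : ContMDiff 𝓘(ℝ, E) 𝓘(ℝ, F) ∞ f) :
    ContDiffOn ℝ ∞ (locMap E F f x₀) (locDomain E F f x₀) := by
  rw [← contMDiffOn_iff_contDiffOn]
  exact (contMDiffOn_extChartAt (I := 𝓘(ℝ, F)) (x := f x₀)).comp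
    ((contMDiffOn_comp_symm hf).mono inter_subset_left) fun z hz ↦ hz.2

/-- The differential of `f` in coordinates. -/
theorem toCoord_mfderiv (hf : ContMDiff 𝓘(ℝ, E) 𝓘(ℝ, F) ∞ f) {x : M}
    (hx : x ∈ (chartAt E x₀).source) (hfx : f x ∈ (chartAt F (f x₀)).source)
    (v : TangentSpace 𝓘(ℝ, E) x) :
    toCoord (f x₀) (f x) (mfderiv 𝓘(ℝ, E) 𝓘(ℝ, F) f x v) =
      fderiv ℝ (locMap E F f x₀) (extChartAt 𝓘(ℝ, E) x₀ x) (toCoord x₀ x v) := by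
  have h1 : MDifferentiableAt 𝓘(ℝ, E) 𝓘(ℝ, F) f x := hf.mdifferentiableAt (by simp)
  have h2 := mdifferentiableAt_extChartAt (I := 𝓘(ℝ, F)) hfx
  have h3 := mvfderiv_eq_fderiv_toCoord hx (h2.comp x h1) v
  have h7 : toCoord (f x₀) (f x) =
      mfderiv 𝓘(ℝ, F) 𝓘(ℝ, F) (extChartAt 𝓘(ℝ, F) (f x₀)) (f x) :=
    TangentBundle.continuousLinearMapAt_trivializationAt hfx
  refine Eq.trans ?_ h3
  rw [h7]
  exact (congrArg (fun L : TangentSpace 𝓘(ℝ, E) x →L[ℝ] F ↦ L v) (mfderiv_comp x h2 h1)).symm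

/-- The Levi-Civita identities pull back by the chain rule, with symmetry of second derivatives
handling torsion and curvature. The latter becomes $\kappa(\langle TY,u\rangle TX-\langle
TX,u\rangle TY)$, which is zero for normal `u`. This is where constant curvature enters. -/
theorem isImmersedConnection (hcov : IsLeviCivita g cov) {κ : ℝ}
    (hκ : HasConstantCurvature g cov κ) (hf : IsSpacelikeImmersion (E := E) g f) (x₀ : M) :
    IsImmersedConnection (locDomain E F f x₀) (fderiv ℝ (locMap E F f x₀))
      (fun z ↦ metricCoord g (f x₀) (locMap E F f x₀ z)) (locConn cov f x₀) := by
  have hU := isOpen_locDomain (x₀ := x₀) hf.smooth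
  have hm := contDiffOn_locMap (x₀ := x₀) hf.smooth
  have hT : ContDiffOn ℝ ∞ (fderiv ℝ (locMap E F f x₀)) (locDomain E F f x₀) :=
    hm.fderiv_of_isOpen hU (by simp)
  have hG : ContDiffOn ℝ ∞ (fun z ↦ metricCoord g (f x₀) (locMap E F f x₀ z))
      (locDomain E F f x₀) := (contDiffOn_metricCoord g (f x₀)).comp hm mapsTo_locMap
  have hΓ : ContDiffOn ℝ ∞ (fun z ↦ christoffel cov (f x₀) (locMap E F f x₀ z))
      (locDomain E F f x₀) := (hcov.contDiffOn_christoffel (f x₀)).comp hm mapsTo_locMap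
  have hθ : ContDiffOn ℝ ∞ (locConn (E := E) cov f x₀) (locDomain E F f x₀) := by
    rw [contDiffOn_clm_apply]
    intro X
    rw [contDiffOn_clm_apply]
    intro u
    exact (hΓ.clm_apply contDiffOn_const).clm_apply (hT.clm_apply contDiffOn_const)
  have hmd : ∀ z ∈ locDomain E F f x₀, DifferentiableAt ℝ (locMap E F f x₀) z := fun z hz ↦
    (hm.contDiffAt (hU.mem_nhds hz)).differentiableAt (by simp)
  refine ⟨hU, hT, hG, hθ, fun z hz u w ↦ ?_, fun z hz X hX ↦ ?_, fun z hz X u w ↦ ?_,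
    fun z hz X Y ↦ ?_, fun z hz X Y u w hu hw ↦ ?_⟩
  · exact (metricCoord_apply g hz.2 u w).trans ((g.symm _ _ _).trans
      (metricCoord_apply g hz.2 w u).symm)
  · have hx := symm_mem_source hz
    have h1 := toCoord_mfderiv hf.smooth hx hz.2
      (ofCoord x₀ ((extChartAt 𝓘(ℝ, E) x₀).symm z) X)
    rw [toCoord_ofCoord hx, (extChartAt 𝓘(ℝ, E) x₀).right_inv hz.1] at h1
    have h2 := hf.spacelike ((extChartAt 𝓘(ℝ, E) x₀).symm z)
      (ofCoord x₀ ((extChartAt 𝓘(ℝ, E) x₀).symm z) X) (fun h0 ↦ hX (by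
        rw [← toCoord_ofCoord hx X, h0, map_zero]))
    rw [← metricCoord_toCoord g hz.2, h1] at h2
    exact h2
  · rw [(hasFDerivAt_fun_comp (G := metricCoord g (f x₀)) (m := locMap E F f x₀) (differentiableAt_of_contDiffOn_target (X := F →L[ℝ] F →L[ℝ] ℝ) hz.2
      (contDiffOn_metricCoord g (f x₀))) (hmd z hz)).fderiv]
    exact hcov.fderiv_metricCoord hz.2 _ u w
  · have h1 : IsSymmSndFDerivAt ℝ (locMap E F f x₀) z :=
      (hm.contDiffAt (hU.mem_nhds hz)).isSymmSndFDerivAt two_le_infty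
    rw [h1 X Y, locConn_apply, locConn_apply]
    congr 1
    exact hcov.christoffel_symm hz.2 _ _
  · have h1 : IsSymmSndFDerivAt ℝ (locMap E F f x₀) z :=
      (hm.contDiffAt (hU.mem_nhds hz)).isSymmSndFDerivAt two_le_infty
    have h2 : ∀ X Y, fderiv ℝ (locConn (E := E) cov f x₀) z X Y u = _ := fun X Y ↦
      fderiv_eq_of_comp_apply_eq (fun z Y u ↦ locConn_apply (cov := cov) (f := f) (x₀ := x₀) z Y u)
        ((hθ.contDiffAt (hU.mem_nhds hz)).differentiableAt (by simp))
        (differentiableAt_of_contDiffOn_target (X := F →L[ℝ] F →L[ℝ] F) hz.2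
          (hcov.contDiffOn_christoffel (f x₀))) (hmd z hz)
        ((hT.contDiffAt (hU.mem_nhds hz)).differentiableAt (by simp)) X Y u
    have h3 := hcov.curvature_christoffel hκ hz.2 (fderiv ℝ (locMap E F f x₀) z X)
      (fderiv ℝ (locMap E F f x₀) z Y) u
    have h4 : connCurvature (locConn cov f x₀) z X Y u = 0 := by
      simp only [connCurvature, add_apply, sub_apply, ContinuousLinearMap.mul_def,
        ContinuousLinearMap.comp_apply, h2, h1 X Y, locConn_apply]
      have h5 : ∀ Z, metricCoord g (f x₀) (locMap E F f x₀ z)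
        (fderiv ℝ (locMap E F f x₀) z Z) u = 0 := hu
      have h6 := h3
      change _ = κ • (metricCoord g (f x₀) (locMap E F f x₀ z) _ u • _ -
        metricCoord g (f x₀) (locMap E F f x₀ z) _ u • _) at h6
      rw [h5, h5, zero_smul, zero_smul, sub_zero, smul_zero] at h6
      rw [← h6, locMap]
      abel
    rw [h4, map_zero, zero_apply]

end Submanifold

/-! ### Chart balls on which the normal connection is a connection form. -/

section Box

variable {E : Type*} [NormedAddCommGroup E] [NormedSpace ℝ E] [FiniteDimensional ℝ E]
  {M : Type*} [TopologicalSpace M] [T2Space M] [ChartedSpace E M] [IsManifold 𝓘(ℝ, E) ∞ M]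
  {F : Type*} [NormedAddCommGroup F] [NormedSpace ℝ F] [FiniteDimensional ℝ F]
  {N : Type*} [TopologicalSpace N] [T2Space N] [ChartedSpace F N] [IsManifold 𝓘(ℝ, F) ∞ N]

/-- The metric of the ambient space in the charts at `x₀` and `f x₀`. -/
def locMetric (E : Type*) [NormedAddCommGroup E] [NormedSpace ℝ E]
    {M : Type*} [TopologicalSpace M] [ChartedSpace E M] (g : PseudoRiemannianMetric F N)
    (f : M → N) (x₀ : M) (z : E) : F →L[ℝ] F →L[ℝ] ℝ :=
  metricCoord g (f x₀) (locMap E F f x₀ z)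

/-- A ball in the chart at `x₀` on which the normal connection is given by `d + Ω`. -/
structure IsBox (g : PseudoRiemannianMetric F N)
    (cov : CovariantDerivative 𝓘(ℝ, F) F (TangentSpace 𝓘(ℝ, F) : N → Type _)) (f : M → N)
    (x₀ : M) (r : ℝ) (Ω : E → E →L[ℝ] F →L[ℝ] F) : Prop where
  immersed : IsImmersedConnection (locDomain E F f x₀) (fderiv ℝ (locMap E F f x₀))
    (locMetric E g f x₀) (locConn cov f x₀)
  smooth : ContMDiff 𝓘(ℝ, E) 𝓘(ℝ, F) ∞ f
  pos : 0 < r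
  contDiff : ContDiff ℝ 1 Ω
  subset : Metric.ball (extChartAt 𝓘(ℝ, E) x₀ x₀) r ⊆ locDomain E F f x₀
  eqOn : EqOn Ω (normalConnection (fderiv ℝ (locMap E F f x₀)) (locMetric E g f x₀)
    (locConn cov f x₀)) (Metric.ball (extChartAt 𝓘(ℝ, E) x₀ x₀) r)

theorem exists_isBox {g : PseudoRiemannianMetric F N}
    {cov : CovariantDerivative 𝓘(ℝ, F) F (TangentSpace 𝓘(ℝ, F) : N → Type _)}
    (hcov : IsLeviCivita g cov) {κ : ℝ} (hκ : HasConstantCurvature g cov κ) {f : M → N}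
    (hf : IsSpacelikeImmersion (E := E) g f) (x₀ : M) : ∃ r Ω, IsBox (E := E) g cov f x₀ r Ω := by
  have h := isImmersedConnection hcov hκ hf x₀
  obtain ⟨r, hr, Ω, h1, h2, h3⟩ := h.exists_global_normalConnection (mem_locDomain f x₀)
  exact ⟨r, Ω, h, hf.smooth, hr, h1, h2, h3⟩

variable (E) in
/-- The part of the manifold covered by the ball of radius `r` in the chart at `x₀`. -/
def boxRegion (x₀ : M) (r : ℝ) : Set M :=
  (chartAt E x₀).source ∩ extChartAt 𝓘(ℝ, E) x₀ ⁻¹' Metric.ball (extChartAt 𝓘(ℝ, E) x₀ x₀) r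

theorem isOpen_boxRegion (x₀ : M) (r : ℝ) : IsOpen (boxRegion E x₀ r) := by
  have := continuousOn_extChartAt (I := 𝓘(ℝ, E)) x₀
  rw [extChartAt_source] at this
  exact this.isOpen_inter_preimage (chartAt E x₀).open_source Metric.isOpen_ball

variable {g : PseudoRiemannianMetric F N}
  {cov : CovariantDerivative 𝓘(ℝ, F) F (TangentSpace 𝓘(ℝ, F) : N → Type _)} {f : M → N} {x₀ : M}
  {r : ℝ} {Ω : E → E →L[ℝ] F →L[ℝ] F}

theorem IsBox.mem_boxRegion (h : IsBox g cov f x₀ r Ω) : x₀ ∈ boxRegion E x₀ r :=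
  ⟨mem_chart_source E x₀, Metric.mem_ball_self h.pos⟩

theorem IsBox.map_mem_source (h : IsBox g cov f x₀ r Ω) {x : M} (hx : x ∈ boxRegion E x₀ r) :
    f x ∈ (chartAt F (f x₀)).source := by
  have h1 := (h.subset hx.2).2
  rwa [mem_preimage, extChartAt_left_inv_of_mem hx.1] at h1

theorem locMap_extChartAt {x : M} (hx : x ∈ (chartAt E x₀).source) :
    locMap E F f x₀ (extChartAt 𝓘(ℝ, E) x₀ x) = extChartAt 𝓘(ℝ, F) (f x₀) (f x) := by
  rw [locMap, extChartAt_left_inv_of_mem hx]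

variable (E g f x₀) in
/-- The normal space at the point with coordinates `z`. -/
def locNormal (z : E) : Submodule ℝ F where
  carrier := {u | ∀ Z, locMetric E g f x₀ z (fderiv ℝ (locMap E F f x₀) z Z) u = 0}
  add_mem' := by
    intro a b ha hb Z
    rw [map_add, ha Z, hb Z, add_zero]
  zero_mem' := fun Z ↦ map_zero _
  smul_mem' := by
    intro c a ha Z
    rw [map_smul, ha Z, smul_zero]

theorem mem_locNormal {z : E} {u : F} : u ∈ locNormal E g f x₀ z ↔
    ∀ Z, locMetric E g f x₀ z (fderiv ℝ (locMap E F f x₀) z Z) u = 0 := Iff.rfl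

theorem locMetric_toCoord {x : M} (hx : x ∈ (chartAt E x₀).source)
    (hfx : f x ∈ (chartAt F (f x₀)).source) (v w : TangentSpace 𝓘(ℝ, F) (f x)) :
    locMetric E g f x₀ (extChartAt 𝓘(ℝ, E) x₀ x) (toCoord (f x₀) (f x) v)
      (toCoord (f x₀) (f x) w) = g.inner (f x) v w := by
  rw [locMetric, locMap_extChartAt hx, metricCoord_toCoord g hfx]

theorem mem_tangentImage_iff (hf : ContMDiff 𝓘(ℝ, E) 𝓘(ℝ, F) ∞ f) {x : M}
    (hx : x ∈ (chartAt E x₀).source) (hfx : f x ∈ (chartAt F (f x₀)).source)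
    (v : TangentSpace 𝓘(ℝ, F) (f x)) : v ∈ tangentImage E f x ↔
      ∃ Z, toCoord (f x₀) (f x) v =
        fderiv ℝ (locMap E F f x₀) (extChartAt 𝓘(ℝ, E) x₀ x) Z := by
  constructor
  · rintro ⟨w, rfl⟩
    exact ⟨_, toCoord_mfderiv hf hx hfx w⟩
  · rintro ⟨Z, hZ⟩
    refine ⟨ofCoord x₀ x Z, ?_⟩
    have h1 := toCoord_mfderiv hf hx hfx (ofCoord x₀ x Z)
    rw [toCoord_ofCoord hx, ← hZ] at h1
    have h2 := congrArg (ofCoord (f x₀) (f x)) h1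
    rw [ofCoord_toCoord hfx, ofCoord_toCoord hfx] at h2
    exact h2

theorem mem_normalSpace_iff (hf : ContMDiff 𝓘(ℝ, E) 𝓘(ℝ, F) ∞ f) {x : M}
    (hx : x ∈ (chartAt E x₀).source) (hfx : f x ∈ (chartAt F (f x₀)).source)
    (ξ : TangentSpace 𝓘(ℝ, F) (f x)) : ξ ∈ normalSpace E g f x ↔
      toCoord (f x₀) (f x) ξ ∈ locNormal E g f x₀ (extChartAt 𝓘(ℝ, E) x₀ x) := by
  rw [mem_locNormal]
  constructor
  · intro h Z
    have h1 := h (mfderiv 𝓘(ℝ, E) 𝓘(ℝ, F) f x (ofCoord x₀ x Z)) ⟨_, rfl⟩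
    rw [← locMetric_toCoord hx hfx, toCoord_mfderiv hf hx hfx, toCoord_ofCoord hx] at h1
    exact h1
  · rintro h _ ⟨v, rfl⟩
    have h1 := h (toCoord x₀ x v)
    rw [← toCoord_mfderiv hf hx hfx] at h1
    rw [← locMetric_toCoord hx hfx]
    exact h1

variable {c : ℝ → M} {V : Π t : ℝ, TangentSpace 𝓘(ℝ, F) (f (c t))} {t : ℝ}

theorem hasDerivAt_extChartAt_comp (hct : c t ∈ (chartAt E x₀).source)
    (hc : MDifferentiableAt 𝓘(ℝ, ℝ) 𝓘(ℝ, E) c t) :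
    HasDerivAt (fun s ↦ extChartAt 𝓘(ℝ, E) x₀ (c s))
      (deriv (fun s ↦ extChartAt 𝓘(ℝ, E) x₀ (c s)) t) t :=
  ((mdifferentiableAt_curve_iff hct).1 hc).2.hasDerivAt

theorem IsBox.toCoord_covDerivAlong (h : IsBox g cov f x₀ r Ω) (hct : c t ∈ boxRegion E x₀ r)
    (hc : MDifferentiableAt 𝓘(ℝ, ℝ) 𝓘(ℝ, E) c t)
    (hV : MDifferentiableAt 𝓘(ℝ, ℝ) 𝓘(ℝ, F).tangent
      (fun s ↦ (⟨f (c s), V s⟩ : TangentBundle 𝓘(ℝ, F) N)) t) :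
    toCoord (f x₀) (f (c t)) (covDerivAlong cov (fun s ↦ f (c s)) V t) =
      deriv (fun s ↦ toCoord (f x₀) (f (c s)) (V s)) t +
        locConn cov f x₀ (extChartAt 𝓘(ℝ, E) x₀ (c t))
          (deriv (fun s ↦ extChartAt 𝓘(ℝ, E) x₀ (c s)) t) (toCoord (f x₀) (f (c t)) (V t)) := by
  rw [NormalHolonomy.toCoord_covDerivAlong (c := fun s ↦ f (c s)) cov (h.map_mem_source hct) hV,
    locConn_apply, locMap_extChartAt hct.1]
  congr 2
  have h1 := hasDerivAt_extChartAt_comp hct.1 hc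
  have h2 : DifferentiableAt ℝ (locMap E F f x₀) (extChartAt 𝓘(ℝ, E) x₀ (c t)) :=
    ((contDiffOn_locMap h.smooth).contDiffAt ((isOpen_locDomain h.smooth).mem_nhds
      (h.subset hct.2))).differentiableAt (by simp)
  refine ((h2.hasFDerivAt.comp_hasDerivAt t h1).congr_of_eventuallyEq ?_).deriv
  filter_upwards [hc.continuousAt.preimage_mem_nhds (chart_source_mem_nhds hct.1)] with s hs
  exact (locMap_extChartAt hs).symm

/-- Normal parallel fields solve the equation of parallel transport of `d + Ω`. -/
theorem IsBox.hasDerivAt_of_parallel (h : IsBox g cov f x₀ r Ω) (hct : c t ∈ boxRegion E x₀ r)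
    (hc : MDifferentiableAt 𝓘(ℝ, ℝ) 𝓘(ℝ, E) c t)
    (hV : MDifferentiableAt 𝓘(ℝ, ℝ) 𝓘(ℝ, F).tangent
      (fun s ↦ (⟨f (c s), V s⟩ : TangentBundle 𝓘(ℝ, F) N)) t)
    (hn : ∀ᶠ s in 𝓝 t, V s ∈ normalSpace E g f (c s))
    (htan : covDerivAlong cov (fun s ↦ f (c s)) V t ∈ tangentImage E f (c t)) :
    HasDerivAt (fun s ↦ toCoord (f x₀) (f (c s)) (V s))
      (-Ω (extChartAt 𝓘(ℝ, E) x₀ (c t)) (deriv (fun s ↦ extChartAt 𝓘(ℝ, E) x₀ (c s)) t)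
        (toCoord (f x₀) (f (c t)) (V t))) t := by
  have h1 := hasDerivAt_extChartAt_comp hct.1 hc
  obtain ⟨Z, hZ⟩ := (mem_tangentImage_iff h.smooth hct.1 (h.map_mem_source hct) _).1 htan
  rw [h.toCoord_covDerivAlong hct hc hV] at hZ
  have hu := ((mdifferentiableAt_along_iff (c := fun s ↦ f (c s)) (h.map_mem_source hct)).1
    hV).2.hasDerivAt
  have hn' : ∀ᶠ s in 𝓝 t, ∀ Y, locMetric E g f x₀ (extChartAt 𝓘(ℝ, E) x₀ (c s))
      (fderiv ℝ (locMap E F f x₀) (extChartAt 𝓘(ℝ, E) x₀ (c s)) Y)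
      (toCoord (f x₀) (f (c s)) (V s)) = 0 := by
    filter_upwards [hn, hc.continuousAt.preimage_mem_nhds
      ((isOpen_boxRegion x₀ r).mem_nhds hct)] with s hs hs'
    exact (mem_normalSpace_iff h.smooth hs'.1 (h.map_mem_source hs') _).1 hs
  have h2 := h.immersed.eq_neg_normalConnection h1 (h.subset hct.2) hu hn' hZ
  rw [h.eqOn hct.2, ← h2]
  exact hu

/-- For a solution of the `Ω`-equation the ambient covariant derivative is minus the shape-operator
term, which is tangent by construction. -/
theorem IsBox.parallel_of_hasDerivAt (h : IsBox g cov f x₀ r Ω) (hct : c t ∈ boxRegion E x₀ r)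
    (hc : MDifferentiableAt 𝓘(ℝ, ℝ) 𝓘(ℝ, E) c t)
    (hu : HasDerivAt (fun s ↦ toCoord (f x₀) (f (c s)) (V s))
      (-Ω (extChartAt 𝓘(ℝ, E) x₀ (c t)) (deriv (fun s ↦ extChartAt 𝓘(ℝ, E) x₀ (c s)) t)
        (toCoord (f x₀) (f (c t)) (V t))) t) :
    MDifferentiableAt 𝓘(ℝ, ℝ) 𝓘(ℝ, F).tangent
      (fun s ↦ (⟨f (c s), V s⟩ : TangentBundle 𝓘(ℝ, F) N)) t ∧
    covDerivAlong cov (fun s ↦ f (c s)) V t ∈ tangentImage E f (c t) := by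
  have hfc : MDifferentiableAt 𝓘(ℝ, ℝ) 𝓘(ℝ, F) (fun s ↦ f (c s)) t :=
    (h.smooth.mdifferentiableAt (by simp)).comp t hc
  have hV := (mdifferentiableAt_along_iff (c := fun s ↦ f (c s)) (V := V)
    (h.map_mem_source hct)).2 ⟨hfc, hu.differentiableAt⟩
  refine ⟨hV, (mem_tangentImage_iff h.smooth hct.1 (h.map_mem_source hct) _).2 ?_⟩
  rw [h.toCoord_covDerivAlong hct hc hV, hu.deriv, h.eqOn hct.2, normalConnection_apply]
  exact ⟨-shapeOperator _ _ _ _ _ _, by rw [map_neg]; abel⟩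

end Box

/-! ### Reversal and concatenation of paths and displacements. -/

section Paths

theorem extend_trans_apply {X : Type*} [TopologicalSpace X] {x y z : X} (γ : Path x y)
    (γ' : Path y z) (t : ℝ) : (γ.trans γ').extend t =
      if t ≤ 1 / 2 then γ.extend (2 * t) else γ'.extend (2 * t - 1) := by
  rcases le_total t 0 with h0 | h0
  · rw [Path.extend_of_le_zero _ h0, if_pos (by linarith), Path.extend_of_le_zero _ (by linarith)]
  · rcases le_total 1 t with h1 | h1
    · rw [Path.extend_of_one_le _ h1, if_neg (by linarith), Path.extend_of_one_le _ (by linarith)]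
    · rw [Path.extend_apply _ ⟨h0, h1⟩]
      rfl

theorem extend_symm_apply {X : Type*} [TopologicalSpace X] {x y : X} (γ : Path x y) (t : ℝ) :
    γ.symm.extend t = γ.extend (-1 * t + 1) := by
  rw [Path.extend_symm_apply]
  congr 1
  ring

end Paths

section Transport

variable {E : Type*} [NormedAddCommGroup E] [NormedSpace ℝ E] [FiniteDimensional ℝ E]
  {M : Type*} [TopologicalSpace M] [T2Space M] [ChartedSpace E M] [IsManifold 𝓘(ℝ, E) ∞ M]
  {F : Type*} [NormedAddCommGroup F] [NormedSpace ℝ F] [FiniteDimensional ℝ F]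
  {N : Type*} [TopologicalSpace N] [T2Space N] [ChartedSpace F N] [IsManifold 𝓘(ℝ, F) ∞ N]

theorem contMDiffOn_comp_affine {c₁ c₂ : ℝ → M} {s₁ s₂ : Set ℝ} {k l : ℝ}
    (h : ContMDiffOn 𝓘(ℝ, ℝ) 𝓘(ℝ, E) ∞ c₁ s₁) (hs : ∀ t ∈ s₂, k * t + l ∈ s₁)
    (hc : ∀ t ∈ s₂, c₂ t = c₁ (k * t + l)) : ContMDiffOn 𝓘(ℝ, ℝ) 𝓘(ℝ, E) ∞ c₂ s₂ := by
  have h1 : ContMDiff 𝓘(ℝ, ℝ) 𝓘(ℝ, ℝ) ∞ (fun t : ℝ ↦ k * t + l) := by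
    rw [contMDiff_iff_contDiff]
    fun_prop
  exact (h.comp h1.contMDiffOn hs).congr hc

theorem IsPiecewiseSmooth.symm {x y : M} {γ : Path x y} (h : IsPiecewiseSmooth E γ) :
    IsPiecewiseSmooth E γ.symm := by
  obtain ⟨n, a, ha, h0, h1, hs⟩ := h
  refine ⟨n, fun i ↦ 1 - a (n - i), fun i j hij ↦ ?_, by simp [h1], by simp [h0], fun i hi ↦ ?_⟩
  · have := ha (Nat.sub_le_sub_left hij n)
    dsimp only
    linarith
  · have h2 := hs (n - (i + 1)) (by omega)
    have h3 : n - (i + 1) + 1 = n - i := by omega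
    rw [h3] at h2
    refine contMDiffOn_comp_affine (k := -1) (l := 1) h2 (fun t ht ↦ ?_)
      fun t _ ↦ extend_symm_apply γ t
    obtain ⟨h4, h5⟩ := ht
    constructor <;> linarith

theorem IsPiecewiseSmooth.trans {x y z : M} {γ : Path x y} {γ' : Path y z}
    (h : IsPiecewiseSmooth E γ) (h' : IsPiecewiseSmooth E γ') :
    IsPiecewiseSmooth E (γ.trans γ') := by
  obtain ⟨n, a, ha, h0, h1, hs⟩ := h
  obtain ⟨n', a', ha', h0', h1', hs'⟩ := h'
  have hle : ∀ i ≤ n, a i ≤ 1 := fun i hi ↦ h1 ▸ ha hi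
  have hge : ∀ i, 0 ≤ a' i := fun i ↦ h0' ▸ ha' (Nat.zero_le i)
  -- Both formulas give `1 / 2` at `i = n`, since `a n = 1` and `a' 0 = 0`; the second half may
  -- therefore use the second formula already there.
  refine ⟨n + n', fun i ↦ if i ≤ n then a i / 2 else (1 + a' (i - n)) / 2, ?_, by simp [h0], ?_,
    fun i hi ↦ ?_⟩
  · intro i j hij
    dsimp only
    by_cases hj : j ≤ n
    · rw [if_pos hj, if_pos (hij.trans hj)]
      linarith [ha hij]
    · rw [if_neg hj]
      by_cases hi : i ≤ n
      · rw [if_pos hi]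
        linarith [hle i hi, hge (j - n)]
      · rw [if_neg hi]
        linarith [ha' (Nat.sub_le_sub_right hij n)]
  · beta_reduce
    by_cases hn' : n' = 0
    · subst hn'
      rw [h0'] at h1'
      norm_num at h1'
    · rw [if_neg (by omega), Nat.add_sub_cancel_left, h1']
      norm_num
  · beta_reduce
    by_cases hin : i < n
    · rw [if_pos hin.le, if_pos (by omega)]
      refine contMDiffOn_comp_affine (k := 2) (l := 0) (hs i hin) (fun t ht ↦ ?_) fun t ht ↦ ?_
      · obtain ⟨h4, h5⟩ := ht
        constructor <;> linarith
      · rw [extend_trans_apply, if_pos (by linarith [ht.2, hle (i + 1) hin]), add_zero]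
    · have h2 : (if i ≤ n then a i / 2 else (1 + a' (i - n)) / 2) = (1 + a' (i - n)) / 2 := by
        by_cases h3 : i ≤ n
        · obtain rfl : i = n := by omega
          rw [if_pos le_rfl, Nat.sub_self, h1, h0']
          norm_num
        · rw [if_neg h3]
      have h3 : i + 1 - n = i - n + 1 := by omega
      rw [h2, if_neg (by omega), h3]
      refine contMDiffOn_comp_affine (k := 2) (l := -1) (hs' (i - n) (by omega)) (fun t ht ↦ ?_)
        fun t ht ↦ ?_
      · obtain ⟨h4, h5⟩ := ht
        constructor <;> linarith
      · rw [extend_trans_apply]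
        split_ifs with h4
        · have h5 : t = 1 / 2 := le_antisymm h4 (by linarith [ht.1, hge (i - n)])
          rw [h5]
          norm_num
        · rw [sub_eq_add_neg]

variable {g : PseudoRiemannianMetric F N}
  {cov : CovariantDerivative 𝓘(ℝ, F) F (TangentSpace 𝓘(ℝ, F) : N → Type _)} {f : M → N}

variable (E g cov f) in
/-- The vector `ζ₁` arises from `ζ₀` by parallel displacement along `γ`. -/
def IsDisplacement {x y : M} (γ : Path x y) (ζ₀ ζ₁ : TangentBundle 𝓘(ℝ, F) N) : Prop :=
  ∃ V : Π t : ℝ, TangentSpace 𝓘(ℝ, F) (f (γ.extend t)), IsNormalParallel E g cov f γ V ∧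
    (⟨f (γ.extend 0), V 0⟩ : TangentBundle 𝓘(ℝ, F) N) = ζ₀ ∧
    (⟨f (γ.extend 1), V 1⟩ : TangentBundle 𝓘(ℝ, F) N) = ζ₁

/-- Vectors at base points that agree only propositionally are compared in the total space, which
avoids casts between fibres. -/
theorem toCoord_congr {y₀ y y' : N} {v : TangentSpace 𝓘(ℝ, F) y} {v' : TangentSpace 𝓘(ℝ, F) y'}
    (h : (⟨y, v⟩ : TangentBundle 𝓘(ℝ, F) N) = ⟨y', v'⟩) : toCoord y₀ y v = toCoord y₀ y' v' :=
  congrArg (fun ζ : TangentBundle 𝓘(ℝ, F) N ↦ toCoord y₀ ζ.proj ζ.2) h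

/-- By the chain rule the covariant derivative is multiplied by `k`, and tangency survives scaling.
Reversal has $k=-1$, the halves of a concatenation $k=2$. -/
theorem parallel_of_comp_affine (hf : ContMDiff 𝓘(ℝ, E) 𝓘(ℝ, F) ∞ f) {c₁ c₂ : ℝ → M}
    {V₁ : Π t : ℝ, TangentSpace 𝓘(ℝ, F) (f (c₁ t))}
    {V₂ : Π t : ℝ, TangentSpace 𝓘(ℝ, F) (f (c₂ t))} {t k l : ℝ}
    (hc : c₂ t = c₁ (k * t + l))
    (h : ∀ᶠ s in 𝓝 t, (⟨f (c₂ s), V₂ s⟩ : TangentBundle 𝓘(ℝ, F) N) =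
      ⟨f (c₁ (k * s + l)), V₁ (k * s + l)⟩)
    (h₁ : MDifferentiableAt 𝓘(ℝ, ℝ) 𝓘(ℝ, F).tangent
      (fun s ↦ (⟨f (c₁ s), V₁ s⟩ : TangentBundle 𝓘(ℝ, F) N)) (k * t + l) ∧
      covDerivAlong cov (fun s ↦ f (c₁ s)) V₁ (k * t + l) ∈ tangentImage E f (c₁ (k * t + l))) :
    MDifferentiableAt 𝓘(ℝ, ℝ) 𝓘(ℝ, F).tangent
      (fun s ↦ (⟨f (c₂ s), V₂ s⟩ : TangentBundle 𝓘(ℝ, F) N)) t ∧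
      covDerivAlong cov (fun s ↦ f (c₂ s)) V₂ t ∈ tangentImage E f (c₂ t) := by
  obtain ⟨hd, ht⟩ := h₁
  have hm : HasDerivAt (fun s : ℝ ↦ k * s + l) k t := by
    simpa using ((hasDerivAt_id t).const_mul k).add_const l
  have hd₂ : MDifferentiableAt 𝓘(ℝ, ℝ) 𝓘(ℝ, F).tangent
      (fun s ↦ (⟨f (c₂ s), V₂ s⟩ : TangentBundle 𝓘(ℝ, F) N)) t := by
    refine MDifferentiableAt.congr_of_eventuallyEq ?_ h
    exact MDifferentiableAt.comp t hd hm.differentiableAt.mdifferentiableAt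
  refine ⟨hd₂, ?_⟩
  set x := c₁ (k * t + l) with hx
  have hxs : x ∈ (chartAt E x).source := mem_chart_source E x
  have hfx : f x ∈ (chartAt F (f x)).source := mem_chart_source F (f x)
  obtain ⟨Z, hZ⟩ := (mem_tangentImage_iff hf hxs hfx _).1 ht
  have hZ' := hZ
  rw [toCoord_covDerivAlong (c := fun s ↦ f (c₁ s)) (t := k * t + l) cov hfx hd] at hZ'
  have hxs₂ : c₂ t ∈ (chartAt E x).source := hc ▸ hxs
  have hfx₂ : f (c₂ t) ∈ (chartAt F (f x)).source := hc ▸ hfx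
  refine (mem_tangentImage_iff hf hxs₂ hfx₂ _).2 ⟨k • Z, ?_⟩
  have h1 := (mdifferentiableAt_along_iff (c := fun s ↦ f (c₁ s)) (t := k * t + l) hfx).1 hd
  have h2 := ((mdifferentiableAt_curve_iff (c := fun s ↦ f (c₁ s)) (t := k * t + l) hfx).1
    h1.1).2.hasDerivAt
  have h3 : HasDerivAt (fun s ↦ toCoord (f x) (f (c₂ s)) (V₂ s))
      (k • deriv (fun s ↦ toCoord (f x) (f (c₁ s)) (V₁ s)) (k * t + l)) t :=
    (HasDerivAt.scomp (g₁ := fun s ↦ toCoord (f x) (f (c₁ s)) (V₁ s)) t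
      h1.2.hasDerivAt hm).congr_of_eventuallyEq (h.mono fun s hs ↦ toCoord_congr (y₀ := f x) hs)
  have h4 : HasDerivAt (fun s ↦ extChartAt 𝓘(ℝ, F) (f x) (f (c₂ s)))
      (k • deriv (fun s ↦ extChartAt 𝓘(ℝ, F) (f x) (f (c₁ s))) (k * t + l)) t :=
    (HasDerivAt.scomp (g₁ := fun s ↦ extChartAt 𝓘(ℝ, F) (f x) (f (c₁ s))) t
      h2 hm).congr_of_eventuallyEq (h.mono fun s hs ↦ congrArg
        (fun ζ : TangentBundle 𝓘(ℝ, F) N ↦ extChartAt 𝓘(ℝ, F) (f x) ζ.proj) hs)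
  rw [toCoord_covDerivAlong (c := fun s ↦ f (c₂ s)) cov hfx₂ hd₂, h3.deriv, h4.deriv, map_smul,
    map_smul, ← smul_add, toCoord_congr h.self_of_nhds, hc, ← hx, ← hZ']

theorem exists_eq_mk {y : N} {ζ : TangentBundle 𝓘(ℝ, F) N} (h : ζ.proj = y) :
    ∃ v : TangentSpace 𝓘(ℝ, F) y, (⟨y, v⟩ : TangentBundle 𝓘(ℝ, F) N) = ζ := by
  subst h
  exact ⟨ζ.2, rfl⟩

theorem mem_normalSpace_congr {x x' : M} {v : TangentSpace 𝓘(ℝ, F) (f x)}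
    {v' : TangentSpace 𝓘(ℝ, F) (f x')} (hx : x = x')
    (h : (⟨f x, v⟩ : TangentBundle 𝓘(ℝ, F) N) = ⟨f x', v'⟩) (hv : v' ∈ normalSpace E g f x') :
    v ∈ normalSpace E g f x := by
  subst hx
  obtain rfl : v = v' := by simpa using h
  exact hv

theorem IsDisplacement.symm (hf : ContMDiff 𝓘(ℝ, E) 𝓘(ℝ, F) ∞ f) {x y : M} {γ : Path x y}
    {ζ₀ ζ₁ : TangentBundle 𝓘(ℝ, F) N} (h : IsDisplacement E g cov f γ ζ₀ ζ₁) :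
    IsDisplacement E g cov f γ.symm ζ₁ ζ₀ := by
  obtain ⟨V, hV, h0, h1⟩ := h
  have hγ := extend_symm_apply γ
  choose V' hV' using fun t ↦ exists_eq_mk (y := f (γ.symm.extend t))
    (ζ := (⟨f (γ.extend (-1 * t + 1)), V (-1 * t + 1)⟩ : TangentBundle 𝓘(ℝ, F) N))
    (congrArg f (hγ t).symm)
  obtain ⟨S, hS, hp⟩ := hV.parallel
  have hmaps : MapsTo (fun t : ℝ ↦ -1 * t + 1) (Icc 0 1) (Icc 0 1) := by
    rintro t ⟨h2, h3⟩
    constructor <;> dsimp only <;> linarith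
  refine ⟨V', ⟨fun t ht ↦ ?_, ?_, (fun t ↦ -1 * t + 1) ⁻¹' S, ?_, fun t ht ↦ ?_⟩, ?_, ?_⟩
  · exact mem_normalSpace_congr (hγ t) (hV' t) (hV.normal _ (hmaps ht))
  · refine ContinuousOn.congr ?_ fun t _ ↦ hV' t
    exact hV.continuousOn.comp (by fun_prop) hmaps
  · refine hS.preimage (Function.Injective.injOn fun a b hab ↦ ?_)
    have : -1 * a + 1 = -1 * b + 1 := hab
    linarith
  · refine parallel_of_comp_affine hf (hγ t) (Filter.Eventually.of_forall hV') (hp _ ⟨?_, ht.2⟩)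
    obtain ⟨h2, h3⟩ := ht.1
    constructor <;> linarith
  · rw [hV' 0, show (-1 * 0 + 1 : ℝ) = 1 by norm_num, h1]
  · rw [hV' 1, show (-1 * 1 + 1 : ℝ) = 0 by norm_num, h0]

theorem IsDisplacement.trans (hf : ContMDiff 𝓘(ℝ, E) 𝓘(ℝ, F) ∞ f) {x y z : M} {γ : Path x y}
    {γ' : Path y z} {ζ₀ ζ₁ ζ₂ : TangentBundle 𝓘(ℝ, F) N}
    (h : IsDisplacement E g cov f γ ζ₀ ζ₁) (h' : IsDisplacement E g cov f γ' ζ₁ ζ₂) :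
    IsDisplacement E g cov f (γ.trans γ') ζ₀ ζ₂ := by
  obtain ⟨V₁, hV₁, h0, h1⟩ := h
  obtain ⟨V₂, hV₂, h0', h1'⟩ := h'
  have hγ := extend_trans_apply γ γ'
  let ζ : ℝ → TangentBundle 𝓘(ℝ, F) N := fun t ↦
    if t ≤ 1 / 2 then ⟨f (γ.extend (2 * t + 0)), V₁ (2 * t + 0)⟩
    else ⟨f (γ'.extend (2 * t + -1)), V₂ (2 * t + -1)⟩
  have hζ : ∀ t, (ζ t).proj = f ((γ.trans γ').extend t) := by
    intro t
    rw [hγ]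
    by_cases ht : t ≤ 1 / 2
    · simp only [ζ, ht, if_true, add_zero]
    · simp only [ζ, ht, if_false, sub_eq_add_neg]
  choose V hV using fun t ↦ exists_eq_mk (hζ t)
  have hγ₁ : ∀ t, t ≤ 1 / 2 → (γ.trans γ').extend t = γ.extend (2 * t + 0) := by
    intro t ht
    rw [hγ, if_pos ht, add_zero]
  have hγ₂ : ∀ t, 1 / 2 ≤ t → (γ.trans γ').extend t = γ'.extend (2 * t + -1) := by
    intro t ht
    rcases ht.eq_or_lt with rfl | ht
    · rw [hγ]
      norm_num
    · rw [hγ, if_neg ht.not_ge, sub_eq_add_neg]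
  have hV1 : ∀ t, t ≤ 1 / 2 → (⟨f ((γ.trans γ').extend t), V t⟩ : TangentBundle 𝓘(ℝ, F) N) =
      ⟨f (γ.extend (2 * t + 0)), V₁ (2 * t + 0)⟩ := by
    intro t ht
    rw [hV]
    simp only [ζ, ht, if_true]
  have hV2 : ∀ t, 1 / 2 ≤ t → (⟨f ((γ.trans γ').extend t), V t⟩ : TangentBundle 𝓘(ℝ, F) N) =
      ⟨f (γ'.extend (2 * t + -1)), V₂ (2 * t + -1)⟩ := by
    intro t ht
    rcases ht.eq_or_lt with rfl | ht
    · rw [hV1 _ le_rfl]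
      have e1 : (2 * (1 / 2) + 0 : ℝ) = 1 := by norm_num
      have e2 : (2 * (1 / 2) + -1 : ℝ) = 0 := by norm_num
      rw [e1, e2, h1, h0']
    · rw [hV]
      simp only [ζ, ht.not_ge, if_false]
  obtain ⟨S₁, hS₁, hp₁⟩ := hV₁.parallel
  obtain ⟨S₂, hS₂, hp₂⟩ := hV₂.parallel
  -- The junction time is exceptional: the field is continuous there but need not be differentiable.
  refine ⟨V, ⟨fun t ht ↦ ?_, ?_, insert (1 / 2) ((fun t ↦ 2 * t + 0) ⁻¹' S₁ ∪
    (fun t ↦ 2 * t + -1) ⁻¹' S₂), ?_, fun t ht ↦ ?_⟩, ?_, ?_⟩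
  · rcases le_total t (1 / 2) with h2 | h2
    · exact mem_normalSpace_congr (hγ₁ t h2) (hV1 t h2)
        (hV₁.normal _ ⟨by linarith [ht.1], by linarith⟩)
    · exact mem_normalSpace_congr (hγ₂ t h2) (hV2 t h2)
        (hV₂.normal _ ⟨by linarith, by linarith [ht.2]⟩)
  · have e : Icc (0 : ℝ) 1 = Icc 0 (1 / 2) ∪ Icc (1 / 2) 1 :=
      (Icc_union_Icc_eq_Icc (by norm_num) (by norm_num)).symm
    rw [e]
    refine ContinuousOn.union_of_isClosed ?_ ?_ isClosed_Icc isClosed_Icc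
    · refine ContinuousOn.congr ?_ fun t ht ↦ hV1 t ht.2
      refine hV₁.continuousOn.comp (f := fun t : ℝ ↦ 2 * t + 0) (by fun_prop) fun t ht ↦ ?_
      obtain ⟨h2, h3⟩ := ht
      constructor <;> dsimp only <;> linarith
    · refine ContinuousOn.congr ?_ fun t ht ↦ hV2 t ht.1
      refine hV₂.continuousOn.comp (f := fun t : ℝ ↦ 2 * t + -1) (by fun_prop) fun t ht ↦ ?_
      obtain ⟨h2, h3⟩ := ht
      constructor <;> dsimp only <;> linarith
  · refine ((hS₁.preimage (Function.Injective.injOn fun a b hab ↦ ?_)).union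
      (hS₂.preimage (Function.Injective.injOn fun a b hab ↦ ?_))).insert _
    · have : 2 * a + 0 = 2 * b + 0 := hab
      linarith
    · have : 2 * a + -1 = 2 * b + -1 := hab
      linarith
  · obtain ⟨⟨h2, h3⟩, h4⟩ := ht
    simp only [mem_insert_iff, mem_union, mem_preimage, not_or] at h4
    obtain ⟨h5, h6, h7⟩ := h4
    rcases lt_or_gt_of_ne h5 with h8 | h8
    · refine parallel_of_comp_affine hf (hγ₁ t h8.le) ?_
        (hp₁ _ ⟨⟨by linarith, by linarith⟩, h6⟩)
      filter_upwards [Iio_mem_nhds h8] with s hs using hV1 s (mem_Iio.1 hs).le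
    · refine parallel_of_comp_affine hf (hγ₂ t h8.le) ?_
        (hp₂ _ ⟨⟨by linarith, by linarith⟩, h7⟩)
      filter_upwards [Ioi_mem_nhds h8] with s hs using hV2 s (mem_Ioi.1 hs).le
  · rw [hV1 0 (by norm_num), show (2 * 0 + 0 : ℝ) = 0 by norm_num, h0]
  · rw [hV2 1 (by norm_num), show (2 * 1 + -1 : ℝ) = 1 by norm_num, h1']

end Transport

/-! ### Displacement along segments in a chart ball. -/

section SegmentTransport

variable {E : Type*} [NormedAddCommGroup E] [NormedSpace ℝ E]
  {F : Type*} [NormedAddCommGroup F] [NormedSpace ℝ F] [FiniteDimensional ℝ F]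

theorem add_smul_mem_ball {o a b : E} {r : ℝ} (ha : a ∈ Metric.ball o r) (hb : b ∈ Metric.ball o r)
    {t : ℝ} (ht : t ∈ Icc (0 : ℝ) 1) : a + t • (b - a) ∈ Metric.ball o r :=
  (convex_ball o r).add_smul_sub_mem ha hb ht

theorem hasDerivAt_line (a w : E) (t : ℝ) : HasDerivAt (fun s : ℝ ↦ a + s • w) w t := by
  simpa using ((hasDerivAt_id t).smul_const w).const_add a

theorem hasDerivAt_segTransport {Ω : E → E →L[ℝ] F →L[ℝ] F} (hΩ : Continuous Ω) (o w : E)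
    (s : ℝ) : HasDerivAt (fun s : ℝ ↦ segTransport Ω o (s • w))
      (-Ω (o + s • w) w * segTransport Ω o (s • w)) s := by
  obtain ⟨P, Q, h⟩ := exists_segPropagator hΩ o w
  have h1 : ∀ s, P 0 s = segTransport Ω o (s • w) := fun s ↦
    (h.eq_segTransport hΩ (t := 0) (s := s) (fun _ ↦ rfl)).1
  have h2 := h.hasDerivAt 0 s
  rw [h1] at h2
  exact h2.congr_of_eventuallyEq (Filter.Eventually.of_forall fun s ↦ (h1 s).symm)

/-- The time-reversed equation has the propagator $P(1-s)Q(1)$, and its value at $s=1$ is $Q(1)$. -/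
theorem segTransport_reverse {Ω : E → E →L[ℝ] F →L[ℝ] F} (hΩ : Continuous Ω) (a b : E) :
    segTransport Ω b (a - b) = segTransportInv Ω a (b - a) := by
  obtain ⟨P, Q, h⟩ := exists_segPropagator hΩ a (b - a)
  have hm : Continuous fun p : ℝ × ℝ ↦ ((0 : ℝ), 1 - p.2) := by fun_prop
  have hd : ∀ s : ℝ, HasDerivAt (fun s : ℝ ↦ 1 - s) (-1) s := fun s ↦ by
    simpa using (hasDerivAt_id s).const_sub 1
  have h' : IsPropagator (fun _ s ↦ -Ω (b + s • (a - b)) (a - b))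
      (fun _ s ↦ P 0 (1 - s) * Q 0 1) (fun _ s ↦ P 0 1 * Q 0 (1 - s)) := by
    have e : ∀ s : ℝ, -Ω (b + s • (a - b)) (a - b) = Ω (a + (1 - s) • (b - a)) (b - a) := by
      intro s
      rw [← neg_sub b a, map_neg, neg_neg]
      congr 2
      module
    refine ⟨(h.continuous.comp hm).mul continuous_const,
      continuous_const.mul (h.continuous_inv.comp hm), fun _ ↦ ?_, fun _ ↦ ?_, fun _ s ↦ ?_,
      fun _ s ↦ ?_, fun _ s ↦ ?_, fun _ s ↦ ?_⟩
    · rw [sub_zero, h.mul_inv]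
    · rw [sub_zero, h.mul_inv]
    · refine ((HasDerivAt.scomp s (h.hasDerivAt 0 (1 - s)) (hd s)).mul_const (Q 0 1)).congr_deriv ?_
      rw [e]
      simp only [neg_smul, one_smul, neg_mul, neg_neg, mul_assoc]
    · refine ((HasDerivAt.scomp s (h.hasDerivAt_inv 0 (1 - s)) (hd s)).const_mul
        (P 0 1)).congr_deriv ?_
      rw [e]
      simp only [neg_smul, one_smul, mul_neg, neg_neg, mul_assoc]
    · rw [mul_assoc, ← mul_assoc (Q 0 (1 - s)), h.inv_mul, one_mul, h.mul_inv]
    · rw [mul_assoc, ← mul_assoc (Q 0 1), h.inv_mul, one_mul, h.mul_inv]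
  have h1 := (h'.eq_segTransport hΩ (t := 0) (s := 1) (fun _ ↦ rfl)).1
  have h2 := (h.eq_segTransport hΩ (t := 0) (s := 1) (fun _ ↦ rfl)).2
  rw [one_smul] at h1 h2
  rw [← h1, ← h2, sub_self, h.zero, one_mul]

end SegmentTransport

section Box

variable {E : Type*} [NormedAddCommGroup E] [NormedSpace ℝ E] [FiniteDimensional ℝ E]
  {M : Type*} [TopologicalSpace M] [T2Space M] [ChartedSpace E M] [IsManifold 𝓘(ℝ, E) ∞ M]
  {F : Type*} [NormedAddCommGroup F] [NormedSpace ℝ F] [FiniteDimensional ℝ F]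
  {N : Type*} [TopologicalSpace N] [T2Space N] [ChartedSpace F N] [IsManifold 𝓘(ℝ, F) ∞ N]
  {g : PseudoRiemannianMetric F N}
  {cov : CovariantDerivative 𝓘(ℝ, F) F (TangentSpace 𝓘(ℝ, F) : N → Type _)} {f : M → N} {x₀ : M}
  {r : ℝ} {Ω : E → E →L[ℝ] F →L[ℝ] F}

namespace IsBox

theorem segTransport_mem_locNormal (h : IsBox g cov f x₀ r Ω) {a b : E}
    (ha : a ∈ Metric.ball (extChartAt 𝓘(ℝ, E) x₀ x₀) r)
    (hb : b ∈ Metric.ball (extChartAt 𝓘(ℝ, E) x₀ x₀) r) {u : F} (hu : u ∈ locNormal E g f x₀ a) :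
    segTransport Ω a (b - a) u ∈ locNormal E g f x₀ b := by
  have hΩ := h.contDiff.continuous
  intro Z
  have hd : ∀ t ∈ Icc (0 : ℝ) 1, HasDerivAt (fun t : ℝ ↦ locMetric E g f x₀ (a + t • (b - a))
      (fderiv ℝ (locMap E F f x₀) (a + t • (b - a)) Z)
      (segTransport Ω a (t • (b - a)) u)) 0 t := by
    intro t ht
    have hb' := add_smul_mem_ball ha hb ht
    have h1 := (hasDerivAt_segTransport hΩ a (b - a) t).clm_apply (hasDerivAt_const t u)
    have h2 := h.immersed.hasDerivAt_metric_differential (hasDerivAt_line a (b - a) t)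
      (h.subset hb') Z h1
    refine h2.congr_deriv ?_
    rw [← h.eqOn hb']
    simp
  have h1 := eq_of_hasDerivAt_zero_off_finite (S := ∅) zero_le_one
    (fun t ht ↦ (hd t ht).continuousAt.continuousWithinAt) finite_empty
    (fun t ht ↦ hd t (Ioo_subset_Icc_self ht.1))
  simp only [one_smul, zero_smul, add_sub_cancel, add_zero, segTransport_zero hΩ] at h1
  rw [h1]
  exact hu Z

theorem locMetric_segTransport (h : IsBox g cov f x₀ r Ω) {a b : E}
    (ha : a ∈ Metric.ball (extChartAt 𝓘(ℝ, E) x₀ x₀) r)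
    (hb : b ∈ Metric.ball (extChartAt 𝓘(ℝ, E) x₀ x₀) r) {u w : F}
    (hu : u ∈ locNormal E g f x₀ a) (hw : w ∈ locNormal E g f x₀ a) :
    locMetric E g f x₀ b (segTransport Ω a (b - a) u) (segTransport Ω a (b - a) w) =
      locMetric E g f x₀ a u w := by
  have hΩ := h.contDiff.continuous
  have hd : ∀ t ∈ Icc (0 : ℝ) 1, HasDerivAt (fun t : ℝ ↦ locMetric E g f x₀ (a + t • (b - a))
      (segTransport Ω a (t • (b - a)) u) (segTransport Ω a (t • (b - a)) w)) 0 t := by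
    intro t ht
    have hb' := add_smul_mem_ball ha hb ht
    have h1 : ∀ v : F, HasDerivAt (fun t : ℝ ↦ segTransport Ω a (t • (b - a)) v)
        (-normalConnection (fderiv ℝ (locMap E F f x₀)) (locMetric E g f x₀) (locConn cov f x₀)
          (a + t • (b - a)) (b - a) (segTransport Ω a (t • (b - a)) v)) t := by
      intro v
      rw [← h.eqOn hb']
      refine ((hasDerivAt_segTransport hΩ a (b - a) t).clm_apply
        (hasDerivAt_const t v)).congr_deriv ?_
      simp
    have hn : ∀ v ∈ locNormal E g f x₀ a,
        segTransport Ω a (t • (b - a)) v ∈ locNormal E g f x₀ (a + t • (b - a)) := by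
      intro v hv
      have := h.segTransport_mem_locNormal ha hb' hv
      rwa [add_sub_cancel_left] at this
    exact h.immersed.hasDerivAt_metric_of_normal (hasDerivAt_line a (b - a) t) (h.subset hb')
      (h1 u) (h1 w) (hn u hu) (hn w hw)
  have h1 := eq_of_hasDerivAt_zero_off_finite (S := ∅) zero_le_one
    (fun t ht ↦ (hd t ht).continuousAt.continuousWithinAt) finite_empty
    (fun t ht ↦ hd t (Ioo_subset_Icc_self ht.1))
  simpa [segTransport_zero hΩ] using h1

theorem symm_mem_boxRegion (h : IsBox g cov f x₀ r Ω) {b : E}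
    (hb : b ∈ Metric.ball (extChartAt 𝓘(ℝ, E) x₀ x₀) r) :
    (extChartAt 𝓘(ℝ, E) x₀).symm b ∈ boxRegion E x₀ r := by
  refine ⟨symm_mem_source (h.subset hb), ?_⟩
  rw [mem_preimage, (extChartAt 𝓘(ℝ, E) x₀).right_inv (h.subset hb).1]
  exact hb

theorem continuousOn_symm (h : IsBox g cov f x₀ r Ω) :
    ContinuousOn (extChartAt 𝓘(ℝ, E) x₀).symm (Metric.ball (extChartAt 𝓘(ℝ, E) x₀ x₀) r) :=
  (continuousOn_extChartAt_symm x₀).mono fun _ hb ↦ (h.subset hb).1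

/-- The segment between two points in the chart at `x₀`. -/
def path (h : IsBox g cov f x₀ r Ω) {x y : M} (hx : x ∈ boxRegion E x₀ r)
    (hy : y ∈ boxRegion E x₀ r) : Path x y where
  toFun t := (extChartAt 𝓘(ℝ, E) x₀).symm (extChartAt 𝓘(ℝ, E) x₀ x +
    (t : ℝ) • (extChartAt 𝓘(ℝ, E) x₀ y - extChartAt 𝓘(ℝ, E) x₀ x))
  continuous_toFun := h.continuousOn_symm.comp_continuous (by fun_prop) fun t ↦
    add_smul_mem_ball hx.2 hy.2 t.2
  source' := by simp [(chartAt E x₀).left_inv hx.1]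
  target' := by simp [(chartAt E x₀).left_inv hy.1]

theorem path_extend (h : IsBox g cov f x₀ r Ω) {x y : M} (hx : x ∈ boxRegion E x₀ r)
    (hy : y ∈ boxRegion E x₀ r) {t : ℝ} (ht : t ∈ Icc (0 : ℝ) 1) :
    (h.path hx hy).extend t = (extChartAt 𝓘(ℝ, E) x₀).symm (extChartAt 𝓘(ℝ, E) x₀ x +
      t • (extChartAt 𝓘(ℝ, E) x₀ y - extChartAt 𝓘(ℝ, E) x₀ x)) :=
  Path.extend_apply _ ht

theorem path_extend_mem (h : IsBox g cov f x₀ r Ω) {x y : M} (hx : x ∈ boxRegion E x₀ r)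
    (hy : y ∈ boxRegion E x₀ r) {t : ℝ} (ht : t ∈ Icc (0 : ℝ) 1) :
    (h.path hx hy).extend t ∈ boxRegion E x₀ r := by
  rw [h.path_extend hx hy ht]
  exact h.symm_mem_boxRegion (add_smul_mem_ball hx.2 hy.2 ht)

theorem extChartAt_path_extend (h : IsBox g cov f x₀ r Ω) {x y : M} (hx : x ∈ boxRegion E x₀ r)
    (hy : y ∈ boxRegion E x₀ r) {t : ℝ} (ht : t ∈ Icc (0 : ℝ) 1) :
    extChartAt 𝓘(ℝ, E) x₀ ((h.path hx hy).extend t) = extChartAt 𝓘(ℝ, E) x₀ x +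
      t • (extChartAt 𝓘(ℝ, E) x₀ y - extChartAt 𝓘(ℝ, E) x₀ x) := by
  rw [h.path_extend hx hy ht, (extChartAt 𝓘(ℝ, E) x₀).right_inv
    (h.subset (add_smul_mem_ball hx.2 hy.2 ht)).1]

theorem contMDiffOn_path (h : IsBox g cov f x₀ r Ω) {x y : M} (hx : x ∈ boxRegion E x₀ r)
    (hy : y ∈ boxRegion E x₀ r) :
    ContMDiffOn 𝓘(ℝ, ℝ) 𝓘(ℝ, E) ∞ (h.path hx hy).extend (Icc 0 1) := by
  have h1 : ContMDiff 𝓘(ℝ, ℝ) 𝓘(ℝ, E) ∞ (fun t : ℝ ↦ extChartAt 𝓘(ℝ, E) x₀ x +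
      t • (extChartAt 𝓘(ℝ, E) x₀ y - extChartAt 𝓘(ℝ, E) x₀ x)) := by
    rw [contMDiff_iff_contDiff]
    fun_prop
  refine ((contMDiffOn_extChartAt_symm x₀).comp h1.contMDiffOn fun t ht ↦ ?_).congr
    fun t ht ↦ h.path_extend hx hy ht
  exact (h.subset (add_smul_mem_ball hx.2 hy.2 ht)).1

theorem isPiecewiseSmooth_path (h : IsBox g cov f x₀ r Ω) {x y : M} (hx : x ∈ boxRegion E x₀ r)
    (hy : y ∈ boxRegion E x₀ r) : IsPiecewiseSmooth E (h.path hx hy) := by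
  refine ⟨1, fun i ↦ i, Nat.mono_cast, by simp, by simp, fun i hi ↦ ?_⟩
  obtain rfl : i = 0 := by omega
  simpa using h.contMDiffOn_path hx hy

theorem continuousOn_ofCoord (y₀ : N) {X : Type*} [TopologicalSpace X] {c : X → N} {u : X → F}
    {s : Set X} (hc : ContinuousOn c s) (hu : ContinuousOn u s)
    (hs : ∀ t ∈ s, c t ∈ (chartAt F y₀).source) :
    ContinuousOn (fun t ↦ (⟨c t, ofCoord y₀ (c t) (u t)⟩ : TangentBundle 𝓘(ℝ, F) N)) s := by
  let e := trivializationAt F (TangentSpace 𝓘(ℝ, F) : N → Type _) y₀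
  have h1 : ∀ t ∈ s, (c t, u t) ∈ e.target := fun t ht ↦
    e.mem_target.2 (mem_trivializationAt_baseSet (hs t ht))
  refine (e.toOpenPartialHomeomorph.symm.continuousOn.comp (hc.prodMk hu) h1).congr fun t ht ↦ ?_
  rw [ofCoord_eq_symm (hs t ht)]
  exact e.mk_symm (mem_trivializationAt_baseSet (hs t ht)) _

/-- Parallel displacement along a segment. -/
theorem isDisplacement_path (h : IsBox g cov f x₀ r Ω) {x y : M} (hx : x ∈ boxRegion E x₀ r)
    (hy : y ∈ boxRegion E x₀ r) {u : F} (hu : u ∈ locNormal E g f x₀ (extChartAt 𝓘(ℝ, E) x₀ x)) :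
    IsDisplacement E g cov f (h.path hx hy) ⟨f x, ofCoord (f x₀) (f x) u⟩
      ⟨f y, ofCoord (f x₀) (f y) (segTransport Ω (extChartAt 𝓘(ℝ, E) x₀ x)
        (extChartAt 𝓘(ℝ, E) x₀ y - extChartAt 𝓘(ℝ, E) x₀ x) u)⟩ := by
  have hΩ := h.contDiff.continuous
  have e0 := (h.path hx hy).extend_zero
  have e1 := (h.path hx hy).extend_one
  have hbox := fun {t} (ht : t ∈ Icc (0 : ℝ) 1) ↦ h.path_extend_mem hx hy ht
  have hchart := fun {t} (ht : t ∈ Icc (0 : ℝ) 1) ↦ h.extChartAt_path_extend hx hy ht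
  set c := (h.path hx hy).extend with hc
  set a := extChartAt 𝓘(ℝ, E) x₀ x
  set w := extChartAt 𝓘(ℝ, E) x₀ y - a with hw
  have hder : ∀ t, HasDerivAt (fun t : ℝ ↦ segTransport Ω a (t • w) u)
      (-Ω (a + t • w) w (segTransport Ω a (t • w) u)) t := fun t ↦
    ((hasDerivAt_segTransport hΩ a w t).clm_apply (hasDerivAt_const t u)).congr_deriv (by simp)
  refine ⟨fun t ↦ ofCoord (f x₀) (f (c t)) (segTransport Ω a (t • w) u), ⟨fun t ht ↦ ?_, ?_,
    ∅, finite_empty, fun t ht ↦ ?_⟩, ?_, ?_⟩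
  · rw [mem_normalSpace_iff h.smooth (hbox ht).1 (h.map_mem_source (hbox ht)),
      toCoord_ofCoord (h.map_mem_source (hbox ht)), hchart ht]
    have h1 := h.segTransport_mem_locNormal hx.2 (add_smul_mem_ball hx.2 hy.2 ht) hu
    rwa [add_sub_cancel_left] at h1
  · refine continuousOn_ofCoord (f x₀) ?_ ?_ fun t ht ↦ h.map_mem_source (hbox ht)
    · exact (h.smooth.continuous.comp (h.path hx hy).continuous_extend).continuousOn
    · exact fun t _ ↦ (hder t).continuousAt.continuousWithinAt
  · have htI := Ioo_subset_Icc_self ht.1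
    have hev : ∀ᶠ s in 𝓝 t, s ∈ Icc (0 : ℝ) 1 := Icc_mem_nhds ht.1.1 ht.1.2
    have hcd : MDifferentiableAt 𝓘(ℝ, ℝ) 𝓘(ℝ, E) c t :=
      ((h.contMDiffOn_path hx hy).contMDiffAt hev).mdifferentiableAt (by simp)
    refine h.parallel_of_hasDerivAt (hbox htI) hcd ?_
    rw [toCoord_ofCoord (h.map_mem_source (hbox htI)), hchart htI]
    have h1 : deriv (fun s ↦ extChartAt 𝓘(ℝ, E) x₀ (c s)) t = w := by
      rw [← (hasDerivAt_line a w t).deriv]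
      exact Filter.EventuallyEq.deriv_eq (hev.mono fun s hs ↦ hchart hs)
    rw [h1]
    refine (hder t).congr_of_eventuallyEq (hev.mono fun s hs ↦ ?_)
    exact toCoord_ofCoord (h.map_mem_source (hbox hs)) _
  · beta_reduce
    rw [e0, zero_smul, segTransport_zero hΩ]
    rfl
  · beta_reduce
    rw [e1, one_smul]

/-- The ball is convex, so the loop contracts linearly to its base point in the chart, with end
points fixed. -/
theorem homotopic_refl (h : IsBox g cov f x₀ r Ω) {x : M} (γ : Path x x)
    (hγ : ∀ t, γ t ∈ boxRegion E x₀ r) : γ.Homotopic (Path.refl x) := by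
  have hx : x ∈ boxRegion E x₀ r := γ.source ▸ hγ 0
  have hc : Continuous fun t ↦ extChartAt 𝓘(ℝ, E) x₀ (γ t) :=
    (continuousOn_extChartAt x₀).comp_continuous γ.continuous fun t ↦ by
      rw [extChartAt_source]
      exact (hγ t).1
  refine ⟨⟨⟨⟨fun p ↦ (extChartAt 𝓘(ℝ, E) x₀).symm (extChartAt 𝓘(ℝ, E) x₀ (γ p.2) +
    (p.1 : ℝ) • (extChartAt 𝓘(ℝ, E) x₀ x - extChartAt 𝓘(ℝ, E) x₀ (γ p.2))), ?_⟩, fun t ↦ ?_,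
    fun t ↦ ?_⟩, fun t s hs ↦ ?_⟩⟩
  · have hc' := hc.comp (continuous_snd : Continuous fun p : unitInterval × unitInterval ↦ p.2)
    refine h.continuousOn_symm.comp_continuous ?_ fun p ↦
      add_smul_mem_ball (hγ p.2).2 hx.2 p.1.2
    exact hc'.add ((continuous_subtype_val.comp continuous_fst).smul (continuous_const.sub hc'))
  · simp [(chartAt E x₀).left_inv (hγ t).1]
  · simp [(chartAt E x₀).left_inv hx.1]
  · rcases hs with rfl | rfl <;> simp [(chartAt E x₀).left_inv hx.1]

end IsBox

end Box

/-! ### Transport around small parallelograms. -/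

section Square

variable {E : Type*} [NormedAddCommGroup E] [NormedSpace ℝ E]
  {F : Type*} [NormedAddCommGroup F] [NormedSpace ℝ F] [FiniteDimensional ℝ F]

/-- Parallel transport around the parallelogram with sides `s • X` and `t • Y`. -/
def squareTransport (Ω : E → E →L[ℝ] F →L[ℝ] F) (a X Y : E) (s t : ℝ) : F →L[ℝ] F :=
  segTransportInv Ω a (t • Y) * segTransportInv Ω (a + t • Y) (s • X) *
    segTransport Ω (a + s • X) (t • Y) * segTransport Ω a (s • X)

theorem exists_propagator_line {Ω : E → E →L[ℝ] F →L[ℝ] F} (hΩ : ContDiff ℝ 1 Ω) (a X Y : E) :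
    ∃ P Q : ℝ → ℝ → F →L[ℝ] F, IsPropagator (fun t s ↦ -Ω (a + t • Y + s • X) X) P Q ∧
      (∀ t s, P t s = segTransport Ω (a + t • Y) (s • X)) ∧
      (∀ t s, Q t s = segTransportInv Ω (a + t • Y) (s • X)) := by
  have hc : Continuous (Function.uncurry fun t s : ℝ ↦ -Ω (a + t • Y + s • X) X) := by
    have e1 : Continuous fun p : ℝ × ℝ ↦ a + p.1 • Y + p.2 • X := by fun_prop
    exact ((hΩ.continuous.comp e1).clm_apply continuous_const).neg
  obtain ⟨P, Q, h⟩ := exists_isPropagator hc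
  exact ⟨P, Q, h, fun t s ↦ (h.eq_segTransport hΩ.continuous (fun _ ↦ rfl)).1,
    fun t s ↦ (h.eq_segTransport hΩ.continuous (fun _ ↦ rfl)).2⟩

/-- Holonomy around a parallelogram is the identity up to $-st$ times curvature. Only the iterated
derivative, first in $t$ and then in $s$ along $t=0$, is taken, so a connection form of class $C^1$
suffices. -/
theorem exists_hasDerivAt_squareTransport {Ω : E → E →L[ℝ] F →L[ℝ] F} (hΩ : ContDiff ℝ 1 Ω)
    (a X Y : E) : ∃ S' : ℝ → ℝ → F →L[ℝ] F, (∀ s, Continuous (S' s)) ∧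
      (∀ s t, HasDerivAt (squareTransport Ω a X Y s) (S' s t) t) ∧
      HasDerivAt (fun s ↦ S' s 0) (-connCurvature Ω a X Y) 0 := by
  have : CompleteSpace F := FiniteDimensional.complete ℝ F
  obtain ⟨P, Q, h, hP, hQ⟩ := exists_propagator_line hΩ a X Y
  obtain ⟨R, R', h₁, hR, hR'⟩ := exists_propagator_line hΩ a Y X
  have hdΩ : Continuous (fderiv ℝ Ω) := hΩ.continuous_fderiv one_ne_zero
  have e1 : Continuous fun p : ℝ × ℝ ↦ a + p.1 • Y + p.2 • X := by fun_prop
  set A' : ℝ → ℝ → F →L[ℝ] F := fun t s ↦ -(fderiv ℝ Ω (a + t • Y + s • X) Y X) with hA'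
  have hA'c : Continuous (Function.uncurry A') :=
    (((hdΩ.comp e1).clm_apply continuous_const).clm_apply continuous_const).neg
  have hAc : Continuous (Function.uncurry fun t s : ℝ ↦ -Ω (a + t • Y + s • X) X) :=
    ((hΩ.continuous.comp e1).clm_apply continuous_const).neg
  have hder : ∀ t s, HasDerivAt (fun t : ℝ ↦ -Ω (a + t • Y + s • X) X) (A' t s) t := by
    intro t s
    have h2 : HasDerivAt (fun t : ℝ ↦ a + t • Y + s • X) Y t :=
      (hasDerivAt_line a Y t).add_const _
    refine (hasDerivAt_conn_line hΩ h2 (hasDerivAt_const t X)).neg.congr_deriv ?_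
    simp [hA']
  set K : ℝ → ℝ → F →L[ℝ] F := fun t s ↦ ∫ σ in (0 : ℝ)..s, Q t σ * A' t σ * P t σ with hK
  have hPt : ∀ t s, HasDerivAt (fun t ↦ P t s) (P t s * K t s) t := fun t s ↦
    h.hasDerivAt_param hAc hA'c hder t s
  have hQt : ∀ t s, HasDerivAt (fun t ↦ Q t s) (-(K t s * Q t s)) t := by
    intro t s
    refine (h.hasDerivAt_inv_param (hPt t s)).congr_deriv ?_
    rw [← mul_assoc, h.inv_mul, one_mul]
  have hint : Continuous (Function.uncurry fun t σ ↦ Q t σ * A' t σ * P t σ) :=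
    (h.continuous_inv.mul hA'c).mul h.continuous
  have hKc : ∀ s, Continuous fun t ↦ K t s := fun s ↦
    intervalIntegral.continuous_parametric_intervalIntegral_of_continuous' hint 0 s
  have hS : ∀ s, squareTransport Ω a X Y s = fun t ↦ R' 0 t * Q t s * R s t * P 0 s := by
    intro s
    funext t
    rw [hR', hQ, hR, hP, squareTransport, zero_smul, zero_smul, add_zero]
  set B : ℝ → ℝ → F →L[ℝ] F := fun s t ↦ -Ω (a + s • X + t • Y) Y with hB
  have hBc : ∀ s, Continuous (B s) := by
    intro s
    have e2 : Continuous fun t : ℝ ↦ a + s • X + t • Y := by fun_prop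
    exact ((hΩ.continuous.comp e2).clm_apply continuous_const).neg
  have hcr : ∀ {Z : ℝ → ℝ → F →L[ℝ] F}, Continuous (Function.uncurry Z) → ∀ s, Continuous (Z s) :=
    fun hZ s ↦ hZ.comp (by fun_prop : Continuous fun t : ℝ ↦ (s, t))
  have hcl : ∀ {Z : ℝ → ℝ → F →L[ℝ] F}, Continuous (Function.uncurry Z) →
      ∀ s, Continuous fun t ↦ Z t s :=
    fun hZ s ↦ hZ.comp (by fun_prop : Continuous fun t : ℝ ↦ (t, s))
  refine ⟨fun s t ↦ ((-(R' 0 t * B 0 t) * Q t s + R' 0 t * -(K t s * Q t s)) * R s t +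
    R' 0 t * Q t s * (B s t * R s t)) * P 0 s, fun s ↦ ?_, fun s t ↦ ?_, ?_⟩
  · have c1 := hcr h₁.continuous_inv 0
    have c2 := hcl h.continuous_inv s
    have c3 := hcr h₁.continuous s
    exact ((((((c1.mul (hBc 0)).neg).mul c2).add (c1.mul ((hKc s).mul c2).neg)).mul c3).add
      ((c1.mul c2).mul ((hBc s).mul c3))).mul continuous_const
  · rw [hS]
    exact ((((h₁.hasDerivAt_inv 0 t).mul (hQt t s)).mul (h₁.hasDerivAt s t)).mul_const (P 0 s))
  -- At $t=0$ the transports in the direction `Y` are trivial and $QP=1$ cancels, leaving three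
  -- terms that can be differentiated in $s$.
  · have e : ∀ s, ((-(R' 0 0 * B 0 0) * Q 0 s + R' 0 0 * -(K 0 s * Q 0 s)) * R s 0 +
        R' 0 0 * Q 0 s * (B s 0 * R s 0)) * P 0 s = -B 0 0 - K 0 s + Q 0 s * B s 0 * P 0 s := by
      intro s
      rw [h₁.zero, h₁.zero_inv]
      simp only [one_mul, mul_one, add_mul, neg_mul, mul_assoc, h.inv_mul, sub_eq_add_neg]
    simp only [e]
    have hK0 : HasDerivAt (fun s ↦ K 0 s) (Q 0 0 * A' 0 0 * P 0 0) 0 := by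
      have c := hcr hint 0
      exact intervalIntegral.integral_hasDerivAt_right (c.intervalIntegrable _ _)
        (c.stronglyMeasurableAtFilter _ _) c.continuousAt
    have hB0 : HasDerivAt (fun s ↦ B s 0) (-(fderiv ℝ Ω (a + (0 : ℝ) • X + (0 : ℝ) • Y) X Y)) 0 := by
      have h2 : HasDerivAt (fun s : ℝ ↦ a + s • X + (0 : ℝ) • Y) X 0 :=
        (hasDerivAt_line a X 0).add_const _
      refine (hasDerivAt_conn_line hΩ h2 (hasDerivAt_const 0 Y)).neg.congr_deriv ?_
      simp
    refine ((hK0.const_sub (-B 0 0)).add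
      (((h.hasDerivAt_inv 0 0).mul hB0).mul (h.hasDerivAt 0 0))).congr_deriv ?_
    simp only [Pi.mul_apply, h.zero, h.zero_inv, hA', hB, zero_smul, add_zero, connCurvature]
    noncomm_ring

end Square

/-- Subspaces of a finite-dimensional space are closed, hence contain the limits of the difference
quotients. -/
theorem mem_of_hasDerivAt {G V : Type*} [NormedAddCommGroup G] [NormedSpace ℝ G]
    [FiniteDimensional ℝ G] [AddCommGroup V] [Module ℝ V] (T : G →ₗ[ℝ] V) (W : Submodule ℝ V)
    {u : ℝ → G} {u' : G} {t : ℝ} (hu : HasDerivAt u u' t) (h : ∀ᶠ s in 𝓝 t, T (u s) ∈ W) :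
    T u' ∈ W := by
  have h1 : IsClosed ((W.comap T : Submodule ℝ G) : Set G) :=
    Submodule.closed_of_finiteDimensional _
  have h2 := hasDerivAt_iff_tendsto_slope.1 hu
  refine h1.mem_of_tendsto h2 ?_
  filter_upwards [nhdsWithin_le_nhds h] with s hs
  rw [slope_def_module]
  exact Submodule.smul_mem _ _ (Submodule.sub_mem (W.comap T) hs h.self_of_nhds)

theorem continuous_linearMap_comp {F : Type*} [NormedAddCommGroup F] [NormedSpace ℝ F]
    [FiniteDimensional ℝ F] {W : Submodule ℝ F} (T : F →ₗ[ℝ] W) {u : ℝ → F} (hu : Continuous u) :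
    Continuous fun s ↦ T (u s) :=
  (LinearMap.continuous_of_finiteDimensional T).comp hu

theorem hasDerivAt_linearMap_comp {F : Type*} [NormedAddCommGroup F] [NormedSpace ℝ F]
    [FiniteDimensional ℝ F] {W : Submodule ℝ F} (T : F →ₗ[ℝ] W) {u : ℝ → F} {u' : F} {t : ℝ}
    (hu : HasDerivAt u u' t) : HasDerivAt (fun s ↦ T (u s)) (T u') t :=
  (LinearMap.toContinuousLinearMap T).hasFDerivAt.comp_hasDerivAt t hu

/-! ### Displaced curvature belongs to the holonomy algebra. -/

section Holonomy

variable {E : Type*} [NormedAddCommGroup E] [NormedSpace ℝ E] [FiniteDimensional ℝ E]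
  {M : Type*} [TopologicalSpace M] [T2Space M] [ChartedSpace E M] [IsManifold 𝓘(ℝ, E) ∞ M]
  {F : Type*} [NormedAddCommGroup F] [NormedSpace ℝ F] [FiniteDimensional ℝ F]
  {N : Type*} [TopologicalSpace N] [T2Space N] [ChartedSpace F N] [IsManifold 𝓘(ℝ, F) ∞ N]

/-- `τ` is the parallel displacement of normal vectors along some path from `p` to `x`. -/
structure IsTransport (E : Type*) [NormedAddCommGroup E] [NormedSpace ℝ E]
    {M : Type*} [TopologicalSpace M] [ChartedSpace E M] (g : PseudoRiemannianMetric F N)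
    (cov : CovariantDerivative 𝓘(ℝ, F) F (TangentSpace 𝓘(ℝ, F) : N → Type _)) (f : M → N) (p x : M)
    (τ : normalSpace E g f p →ₗ[ℝ] TangentSpace 𝓘(ℝ, F) (f x)) : Prop where
  exists_path : ∃ γ : Path p x, IsPiecewiseSmooth E γ ∧ ∀ ξ : normalSpace E g f p,
    IsDisplacement E g cov f γ ⟨f p, (ξ : TangentSpace 𝓘(ℝ, F) (f p))⟩ ⟨f x, τ ξ⟩
  injective : Function.Injective τ
  range_eq : LinearMap.range τ = normalSpace E g f x
  inner_eq : ∀ ξ η, g.inner (f x) (τ ξ) (τ η) = g.inner (f p) ξ η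

variable {g : PseudoRiemannianMetric F N}
  {cov : CovariantDerivative 𝓘(ℝ, F) F (TangentSpace 𝓘(ℝ, F) : N → Type _)} {f : M → N}
  {p x₀ x : M} {r : ℝ} {Ω : E → E →L[ℝ] F →L[ℝ] F}
  {τ : normalSpace E g f p →ₗ[ℝ] TangentSpace 𝓘(ℝ, F) (f x)}

namespace IsBox

variable (f x₀ Ω) in
/-- The parallel displacement from `x` to `y` along the segment in the chart at `x₀`. -/
def move (x y : M) : TangentSpace 𝓘(ℝ, F) (f x) →ₗ[ℝ] TangentSpace 𝓘(ℝ, F) (f y) :=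
  (ofCoord (f x₀) (f y)).toLinearMap ∘ₗ (segTransport Ω (extChartAt 𝓘(ℝ, E) x₀ x)
    (extChartAt 𝓘(ℝ, E) x₀ y - extChartAt 𝓘(ℝ, E) x₀ x)).toLinearMap ∘ₗ
    (toCoord (f x₀) (f x)).toLinearMap

theorem move_apply (x y : M) (v : TangentSpace 𝓘(ℝ, F) (f x)) : move f x₀ Ω x y v =
    ofCoord (f x₀) (f y) (segTransport Ω (extChartAt 𝓘(ℝ, E) x₀ x)
      (extChartAt 𝓘(ℝ, E) x₀ y - extChartAt 𝓘(ℝ, E) x₀ x) (toCoord (f x₀) (f x) v)) := rfl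

theorem toCoord_move (h : IsBox g cov f x₀ r Ω) {y : M} (hy : y ∈ boxRegion E x₀ r)
    (v : TangentSpace 𝓘(ℝ, F) (f x)) : toCoord (f x₀) (f y) (move f x₀ Ω x y v) =
      segTransport Ω (extChartAt 𝓘(ℝ, E) x₀ x)
      (extChartAt 𝓘(ℝ, E) x₀ y - extChartAt 𝓘(ℝ, E) x₀ x) (toCoord (f x₀) (f x) v) := by
  rw [move_apply, toCoord_ofCoord (h.map_mem_source hy)]

theorem move_move (h : IsBox g cov f x₀ r Ω) {y : M} (hx : x ∈ boxRegion E x₀ r)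
    (hy : y ∈ boxRegion E x₀ r) (v : TangentSpace 𝓘(ℝ, F) (f x)) :
    move f x₀ Ω y x (move f x₀ Ω x y v) = v := by
  have hΩ := h.contDiff.continuous
  rw [move_apply, h.toCoord_move hy, segTransport_reverse hΩ, ← mul_apply_eq_comp,
    segTransportInv_mul hΩ, one_apply_eq_self, ofCoord_toCoord (h.map_mem_source hx)]

theorem move_mem (h : IsBox g cov f x₀ r Ω) {y : M} (hx : x ∈ boxRegion E x₀ r)
    (hy : y ∈ boxRegion E x₀ r) {v : TangentSpace 𝓘(ℝ, F) (f x)} (hv : v ∈ normalSpace E g f x) :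
    move f x₀ Ω x y v ∈ normalSpace E g f y := by
  rw [mem_normalSpace_iff h.smooth hx.1 (h.map_mem_source hx)] at hv
  rw [mem_normalSpace_iff h.smooth hy.1 (h.map_mem_source hy), h.toCoord_move hy]
  exact h.segTransport_mem_locNormal hx.2 hy.2 hv

theorem inner_move (h : IsBox g cov f x₀ r Ω) {y : M} (hx : x ∈ boxRegion E x₀ r)
    (hy : y ∈ boxRegion E x₀ r) {v w : TangentSpace 𝓘(ℝ, F) (f x)} (hv : v ∈ normalSpace E g f x)
    (hw : w ∈ normalSpace E g f x) :
    g.inner (f y) (move f x₀ Ω x y v) (move f x₀ Ω x y w) = g.inner (f x) v w := by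
  rw [mem_normalSpace_iff h.smooth hx.1 (h.map_mem_source hx)] at hv hw
  rw [← locMetric_toCoord hy.1 (h.map_mem_source hy), h.toCoord_move hy, h.toCoord_move hy,
    h.locMetric_segTransport hx.2 hy.2 hv hw, locMetric_toCoord hx.1 (h.map_mem_source hx)]

theorem isDisplacement_move (h : IsBox g cov f x₀ r Ω) {y : M} (hx : x ∈ boxRegion E x₀ r)
    (hy : y ∈ boxRegion E x₀ r) {v : TangentSpace 𝓘(ℝ, F) (f x)} (hv : v ∈ normalSpace E g f x) :
    IsDisplacement E g cov f (h.path hx hy) ⟨f x, v⟩ ⟨f y, move f x₀ Ω x y v⟩ := by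
  rw [mem_normalSpace_iff h.smooth hx.1 (h.map_mem_source hx)] at hv
  have h1 := h.isDisplacement_path hx hy hv
  rwa [ofCoord_toCoord (h.map_mem_source hx)] at h1

theorem move_self (h : IsBox g cov f x₀ r Ω) (hx : x ∈ boxRegion E x₀ r)
    (v : TangentSpace 𝓘(ℝ, F) (f x)) : move f x₀ Ω x x v = v := by
  rw [move_apply, sub_self, segTransport_zero h.contDiff.continuous,
    one_apply_eq_self, ofCoord_toCoord (h.map_mem_source hx)]

theorem path_mem (h : IsBox g cov f x₀ r Ω) {y : M} (hx : x ∈ boxRegion E x₀ r)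
    (hy : y ∈ boxRegion E x₀ r) (t : unitInterval) : h.path hx hy t ∈ boxRegion E x₀ r :=
  h.symm_mem_boxRegion (add_smul_mem_ball hx.2 hy.2 t.2)

end IsBox

theorem trans_mem {X : Type*} [TopologicalSpace X] {a b c : X} {γ : Path a b} {γ' : Path b c}
    {s : Set X} (h : ∀ t, γ t ∈ s) (h' : ∀ t, γ' t ∈ s) (t : unitInterval) :
    (γ.trans γ') t ∈ s := by
  have h1 : (γ.trans γ') t ∈ range (γ.trans γ') := mem_range_self t
  rw [Path.trans_range] at h1
  rcases h1 with ⟨t', h1⟩ | ⟨t', h1⟩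
  · exact h1 ▸ h t'
  · exact h1 ▸ h' t'

namespace IsTransport

theorem mem (hτ : IsTransport E g cov f p x τ) (ξ : normalSpace E g f p) :
    τ ξ ∈ normalSpace E g f x := hτ.range_eq ▸ LinearMap.mem_range_self τ ξ

theorem refl (h : IsBox g cov f x₀ r Ω) (hp : p ∈ boxRegion E x₀ r) :
    IsTransport E g cov f p p (normalSpace E g f p).subtype where
  exists_path := by
    refine ⟨h.path hp hp, h.isPiecewiseSmooth_path hp hp, fun ξ ↦ ?_⟩
    have h1 := h.isDisplacement_move hp hp ξ.2
    rwa [h.move_self hp] at h1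
  injective := Submodule.subtype_injective _
  range_eq := Submodule.range_subtype _
  inner_eq _ _ := rfl

theorem move (hτ : IsTransport E g cov f p x τ) (h : IsBox g cov f x₀ r Ω)
    (hx : x ∈ boxRegion E x₀ r) {y : M} (hy : y ∈ boxRegion E x₀ r) :
    IsTransport E g cov f p y (IsBox.move f x₀ Ω x y ∘ₗ τ) where
  exists_path := by
    obtain ⟨γ, hγ, hd⟩ := hτ.exists_path
    exact ⟨γ.trans (h.path hx hy), hγ.trans (h.isPiecewiseSmooth_path hx hy), fun ξ ↦
      (hd ξ).trans h.smooth (h.isDisplacement_move hx hy (hτ.mem ξ))⟩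
  injective := by
    rw [LinearMap.coe_comp]
    exact Function.Injective.comp (Function.LeftInverse.injective (g := IsBox.move f x₀ Ω y x)
      fun v ↦ h.move_move hx hy v) hτ.injective
  range_eq := by
    ext v
    constructor
    · rintro ⟨ξ, rfl⟩
      exact h.move_mem hx hy (hτ.mem ξ)
    · intro hv
      have h1 := h.move_mem hy hx hv
      rw [← hτ.range_eq] at h1
      obtain ⟨ξ, hξ⟩ := h1
      exact ⟨ξ, by rw [LinearMap.comp_apply, hξ, h.move_move hy hx]⟩
  inner_eq ξ η := (h.inner_move hx hy (hτ.mem ξ) (hτ.mem η)).trans (hτ.inner_eq ξ η)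

/-- Parallel displacement along a lasso. -/
theorem mem_restrictedNormalHolonomy (hτ : IsTransport E g cov f p x τ)
    (h : IsBox g cov f x₀ r Ω) (hx : x ∈ boxRegion E x₀ r) {x₁ x₂ x₃ : M}
    (h₁ : x₁ ∈ boxRegion E x₀ r) (h₂ : x₂ ∈ boxRegion E x₀ r) (h₃ : x₃ ∈ boxRegion E x₀ r)
    {φ : Module.End ℝ (normalSpace E g f p)} (hφ : ∀ ξ, τ (φ ξ) =
      IsBox.move f x₀ Ω x₃ x (IsBox.move f x₀ Ω x₂ x₃ (IsBox.move f x₀ Ω x₁ x₂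
        (IsBox.move f x₀ Ω x x₁ (τ ξ))))) : φ ∈ restrictedNormalHolonomy E g cov f p := by
  obtain ⟨γ, hγ, hd⟩ := hτ.exists_path
  have hf := h.smooth
  let δ : Path x x := ((h.path hx h₁).trans (h.path h₁ h₂)).trans
    ((h.path h₂ h₃).trans (h.path h₃ hx))
  have hδ : IsPiecewiseSmooth E δ :=
    ((h.isPiecewiseSmooth_path _ _).trans (h.isPiecewiseSmooth_path _ _)).trans
      ((h.isPiecewiseSmooth_path _ _).trans (h.isPiecewiseSmooth_path _ _))
  have hδ' : δ.Homotopic (Path.refl x) := h.homotopic_refl δ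
    (trans_mem (trans_mem (h.path_mem _ _) (h.path_mem _ _))
      (trans_mem (h.path_mem _ _) (h.path_mem _ _)))
  refine ⟨(γ.trans δ).trans γ.symm, (hγ.trans hδ).trans hγ.symm, ?_, fun ξ ↦ ?_⟩
  -- The quadrilateral `δ` contracts inside the box, after which the lasso retraces `γ`.
  · have h1 : (γ.trans δ).Homotopic γ :=
      ((Path.Homotopic.refl γ).hcomp hδ').trans ⟨Path.Homotopy.transRefl γ⟩
    exact (h1.hcomp (Path.Homotopic.refl γ.symm)).trans
      (Path.Homotopic.symm ⟨Path.Homotopy.reflTransSymm γ⟩)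
  · have m₁ := h.move_mem hx h₁ (hτ.mem ξ)
    have m₂ := h.move_mem h₁ h₂ m₁
    have m₃ := h.move_mem h₂ h₃ m₂
    have d : IsDisplacement E g cov f δ ⟨f x, τ ξ⟩ ⟨f x, τ (φ ξ)⟩ := by
      rw [hφ]
      exact ((h.isDisplacement_move hx h₁ (hτ.mem ξ)).trans hf
        (h.isDisplacement_move h₁ h₂ m₁)).trans hf
        ((h.isDisplacement_move h₂ h₃ m₂).trans hf (h.isDisplacement_move h₃ hx m₃))
    exact ((hd ξ).trans hf d).trans hf ((hd (φ ξ)).symm hf)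

/-- The third and fourth sides are run backwards, so `segTransport_reverse` turns them into the
inverse transports of `squareTransport`. -/
theorem exists_square (h : IsBox g cov f x₀ r Ω)
    (hx : x ∈ boxRegion E x₀ r) {X Y : E} {s t : ℝ}
    (h₁ : extChartAt 𝓘(ℝ, E) x₀ x + s • X ∈ Metric.ball (extChartAt 𝓘(ℝ, E) x₀ x₀) r)
    (h₂ : extChartAt 𝓘(ℝ, E) x₀ x + s • X + t • Y ∈ Metric.ball (extChartAt 𝓘(ℝ, E) x₀ x₀) r)
    (h₃ : extChartAt 𝓘(ℝ, E) x₀ x + t • Y ∈ Metric.ball (extChartAt 𝓘(ℝ, E) x₀ x₀) r) :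
    ∃ x₁ ∈ boxRegion E x₀ r, ∃ x₂ ∈ boxRegion E x₀ r, ∃ x₃ ∈ boxRegion E x₀ r, ∀ ξ,
      toCoord (f x₀) (f x) (IsBox.move f x₀ Ω x₃ x (IsBox.move f x₀ Ω x₂ x₃
        (IsBox.move f x₀ Ω x₁ x₂ (IsBox.move f x₀ Ω x x₁ (τ ξ))))) =
      squareTransport Ω (extChartAt 𝓘(ℝ, E) x₀ x) X Y s t (toCoord (f x₀) (f x) (τ ξ)) := by
  have hΩ := h.contDiff.continuous
  have hinv : ∀ {z}, z ∈ Metric.ball (extChartAt 𝓘(ℝ, E) x₀ x₀) r →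
      extChartAt 𝓘(ℝ, E) x₀ ((extChartAt 𝓘(ℝ, E) x₀).symm z) = z := fun hz ↦
    (extChartAt 𝓘(ℝ, E) x₀).right_inv (h.subset hz).1
  have m₁ := h.symm_mem_boxRegion h₁
  have m₂ := h.symm_mem_boxRegion h₂
  have m₃ := h.symm_mem_boxRegion h₃
  refine ⟨_, m₁, _, m₂, _, m₃, fun ξ ↦ ?_⟩
  rw [h.toCoord_move hx, h.toCoord_move m₃, h.toCoord_move m₂, h.toCoord_move m₁, hinv h₁, hinv h₂,
    hinv h₃, segTransport_reverse hΩ, segTransport_reverse hΩ, add_sub_cancel_left,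
    add_sub_cancel_left, add_sub_cancel_left, add_right_comm, add_sub_cancel_left]
  rfl

/-- A curve of endomorphisms which belong to the restricted holonomy group near time `0` has
its velocity among the velocities of the holonomy group. -/
theorem velocity_mem {L : normalSpace E g f p →ₗ[ℝ] F} {T : F →ₗ[ℝ] normalSpace E g f p}
    (hT : ∀ ξ, T (L ξ) = ξ) {ε : ℝ} (hε : 0 ≤ ε) {S S' : ℝ → F →L[ℝ] F}
    (hS : ∀ t, HasDerivAt S (S' t) t) (hS' : Continuous S') (h0 : S 0 = 1)
    (hmem : ∀ t, |t| ≤ ε → ∀ φ : Module.End ℝ (normalSpace E g f p), (∀ ξ, φ ξ = T (S t (L ξ))) →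
      φ ∈ restrictedNormalHolonomy E g cov f p) :
    (T ∘ₗ (ε • S' 0).toLinearMap ∘ₗ L : Module.End ℝ (normalSpace E g f p)) ∈
      holonomyVelocities E g cov f p := by
  -- A curve in the group is required for all times, whereas membership is known only for parameters
  -- up to `ε`. The substitution $\varepsilon\sin t$ stays in that range and has velocity `ε` at
  -- time $0$.
  refine ⟨fun t ↦ T ∘ₗ (S (ε * Real.sin t)).toLinearMap ∘ₗ L,
    fun t ↦ T ∘ₗ ((ε * Real.cos t) • S' (ε * Real.sin t)).toLinearMap ∘ₗ L, fun t ↦ ?_, ?_,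
    by simp, fun ξ ↦ ⟨?_, fun t ↦ ?_⟩⟩
  · have ht : |ε * Real.sin t| ≤ ε := by
      rw [abs_mul, abs_of_nonneg hε]
      exact mul_le_of_le_one_right hε (Real.abs_sin_le_one t)
    exact hmem _ ht _ fun ξ ↦ rfl
  · refine LinearMap.ext fun ξ ↦ ?_
    show T (S (ε * Real.sin 0) (L ξ)) = ξ
    rw [Real.sin_zero, mul_zero, h0, one_apply_eq_self, hT]
  · have h1 : Continuous fun t : ℝ ↦ ((ε * Real.cos t) • S' (ε * Real.sin t)) (L ξ) :=
      ((continuous_const.mul Real.continuous_cos).smul (hS'.comp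
        (continuous_const.mul Real.continuous_sin))).clm_apply continuous_const
    exact continuous_linearMap_comp (F := F) (W := normalSpace E g f p) T h1
  · have h1 : HasDerivAt (fun t : ℝ ↦ ε * Real.sin t) (ε * Real.cos t) t :=
      (Real.hasDerivAt_sin t).const_mul ε
    have h2 : HasDerivAt (fun t : ℝ ↦ S (ε * Real.sin t) (L ξ))
        (((ε * Real.cos t) • S' (ε * Real.sin t)) (L ξ)) t := by
      refine ((HasDerivAt.scomp (g₁ := S) t (hS (ε * Real.sin t)) h1).clm_apply
        (hasDerivAt_const t (L ξ))).congr_deriv ?_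
      simp
    exact hasDerivAt_linearMap_comp (F := F) (W := normalSpace E g f p) T h2

/-- The curvature of the normal connection, displaced to `p`, belongs to the holonomy algebra. -/
theorem exists_mem_normalHolonomyAlgebra (hτ : IsTransport E g cov f p x τ)
    (h : IsBox g cov f x₀ r Ω) (hx : x ∈ boxRegion E x₀ r) (X Y : E) :
    ∃ B ∈ normalHolonomyAlgebra E g cov f p, ∀ ξ, toCoord (f x₀) (f x) (τ (B ξ)) =
      connCurvature Ω (extChartAt 𝓘(ℝ, E) x₀ x) X Y (toCoord (f x₀) (f x) (τ ξ)) := by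
  have hfx := h.map_mem_source hx
  set a := extChartAt 𝓘(ℝ, E) x₀ x with ha
  let L : normalSpace E g f p →ₗ[ℝ] F := (toCoord (f x₀) (f x)).toLinearMap ∘ₗ τ
  have hL : Function.Injective L := by
    rw [LinearMap.coe_comp]
    exact Function.Injective.comp (Function.LeftInverse.injective (g := ofCoord (f x₀) (f x))
      fun v ↦ ofCoord_toCoord hfx v) hτ.injective
  obtain ⟨T, hT⟩ := LinearMap.exists_leftInverse_of_injective L (LinearMap.ker_eq_bot.2 hL)
  have hT' : ∀ ξ, T (L ξ) = ξ := fun ξ ↦ LinearMap.congr_fun hT ξ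
  obtain ⟨S', hS'c, hS', hS''⟩ := exists_hasDerivAt_squareTransport h.contDiff a X Y
  obtain ⟨ε, hε, hball⟩ : ∃ ε > 0, ∀ s t : ℝ, |s| ≤ ε → |t| ≤ ε →
      a + s • X + t • Y ∈ Metric.ball (extChartAt 𝓘(ℝ, E) x₀ x₀) r := by
    have h1 : Continuous fun q : ℝ × ℝ ↦ a + q.1 • X + q.2 • Y := by fun_prop
    have h2 : (fun q : ℝ × ℝ ↦ a + q.1 • X + q.2 • Y) ⁻¹'
        Metric.ball (extChartAt 𝓘(ℝ, E) x₀ x₀) r ∈ 𝓝 (0 : ℝ × ℝ) := by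
      refine h1.continuousAt.preimage_mem_nhds (Metric.isOpen_ball.mem_nhds ?_)
      simp only [Prod.fst_zero, Prod.snd_zero, zero_smul, add_zero]
      exact hx.2
    obtain ⟨ε, hε, h3⟩ := Metric.nhds_basis_closedBall.mem_iff.1 h2
    refine ⟨ε, hε, fun s t hs ht ↦ ?_⟩
    refine @h3 (s, t) ?_
    rw [mem_closedBall_zero_iff, Prod.norm_def]
    exact max_le hs ht
  have hsq : ∀ s t : ℝ, |s| ≤ ε → |t| ≤ ε →
      ∃ x₁ ∈ boxRegion E x₀ r, ∃ x₂ ∈ boxRegion E x₀ r, ∃ x₃ ∈ boxRegion E x₀ r, ∀ ξ,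
        L (T (squareTransport Ω a X Y s t (L ξ))) = squareTransport Ω a X Y s t (L ξ) ∧
        τ (T (squareTransport Ω a X Y s t (L ξ))) =
          IsBox.move f x₀ Ω x₃ x (IsBox.move f x₀ Ω x₂ x₃
            (IsBox.move f x₀ Ω x₁ x₂ (IsBox.move f x₀ Ω x x₁ (τ ξ)))) := by
    intro s t hs ht
    have e0 : |(0 : ℝ)| ≤ ε := by simpa using hε.le
    have b₁ := hball s 0 hs e0
    have b₃ := hball 0 t e0 ht
    rw [zero_smul, add_zero] at b₁ b₃
    obtain ⟨x₁, m₁, x₂, m₂, x₃, m₃, he⟩ := exists_square (τ := τ) h hx b₁ (hball s t hs ht) b₃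
    refine ⟨x₁, m₁, x₂, m₂, x₃, m₃, fun ξ ↦ ?_⟩
    have h1 := h.move_mem m₃ hx (h.move_mem m₂ m₃ (h.move_mem m₁ m₂ (h.move_mem hx m₁ (hτ.mem ξ))))
    rw [← hτ.range_eq] at h1
    obtain ⟨η, hη⟩ := h1
    have h2 : squareTransport Ω a X Y s t (L ξ) = L η := by
      refine (he ξ).symm.trans ?_
      rw [← hη]
      rfl
    rw [h2, hT']
    exact ⟨rfl, hη⟩
  let Φ : (F →L[ℝ] F) →ₗ[ℝ] Module.End ℝ (normalSpace E g f p) :=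
    { toFun := fun S ↦ T ∘ₗ S.toLinearMap ∘ₗ L
      map_add' := fun S S₁ ↦ by
        ext ξ
        simp
      map_smul' := fun c S ↦ by
        ext ξ
        simp }
  have hΦ : ∀ S ξ, Φ S ξ = T (S (L ξ)) := fun S ξ ↦ rfl
  have hnear : ∀ᶠ s in 𝓝 (0 : ℝ), |s| ≤ ε := by
    filter_upwards [Metric.closedBall_mem_nhds (0 : ℝ) hε] with s hs
    rwa [mem_closedBall_zero_iff] at hs
  -- For fixed $s$ the parallelograms form a curve in the group starting at the identity. Its
  -- velocities lie in the algebra, a linear space, so they may be differentiated again in $s$.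
  have hmem : ∀ s : ℝ, |s| ≤ ε → Φ (S' s 0) ∈ (normalHolonomyAlgebra E g cov f p).toSubmodule := by
    intro s hs
    have hvel : Φ (ε • S' s 0) ∈ holonomyVelocities E g cov f p := by
      refine velocity_mem hT' hε.le (hS' s) (hS'c s) ?_ fun t ht φ hφ ↦ ?_
      · have hΩ := h.contDiff.continuous
        have h2 := segTransport_mul_inv hΩ a 0
        rw [segTransport_zero hΩ, one_mul] at h2
        simp only [squareTransport, zero_smul, add_zero, segTransport_zero hΩ, h2, one_mul,
          mul_one, segTransportInv_mul hΩ]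
      · obtain ⟨x₁, m₁, x₂, m₂, x₃, m₃, he⟩ := hsq s _ hs ht
        refine hτ.mem_restrictedNormalHolonomy h hx m₁ m₂ m₃ fun ξ ↦ ?_
        rw [hφ]
        exact (he ξ).2
    have h1 := LieSubalgebra.subset_lieSpan (R := ℝ) hvel
    have h2 : Φ (S' s 0) = ε⁻¹ • Φ (ε • S' s 0) := by
      rw [map_smul, smul_smul, inv_mul_cancel₀ hε.ne', one_smul]
    rw [h2]
    exact Submodule.smul_mem _ _ h1
  have hB := mem_of_hasDerivAt Φ _ hS'' (hnear.mono hmem)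
  rw [map_neg, neg_mem_iff] at hB
  refine ⟨_, hB, fun ξ ↦ ?_⟩
  let ev : (F →L[ℝ] F) →ₗ[ℝ] F := (ContinuousLinearMap.apply ℝ F (L ξ)).toLinearMap
  -- The left inverse `T` recovers the curvature only on the range of `L`, so the curvature must be
  -- seen to stay in this range; the same double differentiation shows it.
  have hr : ev (-connCurvature Ω a X Y) ∈ LinearMap.range L := by
    refine mem_of_hasDerivAt ev _ hS'' (hnear.mono fun s hs ↦ ?_)
    refine mem_of_hasDerivAt ev _ (hS' s 0) (hnear.mono fun t ht ↦ ?_)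
    obtain ⟨x₁, m₁, x₂, m₂, x₃, m₃, he⟩ := hsq s t hs ht
    exact ⟨_, (he ξ).1⟩
  rw [map_neg, neg_mem_iff] at hr
  obtain ⟨η, hη⟩ := hr
  have hη' : L η = connCurvature Ω a X Y (L ξ) := hη
  show L (Φ _ ξ) = connCurvature Ω a X Y (L ξ)
  rw [hΦ, ← hη', hT']

end IsTransport

end Holonomy

/-! ### Flat systems have no monodromy along null-homotopic loops. -/

section Monodromy

/-- A flat system of states over a space `X` with an open cover `B`: inside of each `B i` the states
are carried from point to point by `step i`, and the ways to do this agree locally. -/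
structure IsFlatSystem {X S ι : Type*} [TopologicalSpace X] (B : ι → Set X) (Good : X → S → Prop)
    (step : ι → X → X → S → S) : Prop where
  isOpen : ∀ i, IsOpen (B i)
  cover : ∀ x, ∃ i, x ∈ B i
  good : ∀ i x y K, x ∈ B i → y ∈ B i → Good x K → Good y (step i x y K)
  comp : ∀ i x y z K, x ∈ B i → y ∈ B i → z ∈ B i → Good x K →
    step i y z (step i x y K) = step i x z K
  self : ∀ i x K, x ∈ B i → Good x K → step i x x K = K
  eventually_eq : ∀ i j x K, x ∈ B i → x ∈ B j → Good x K →
    ∀ᶠ y in 𝓝 x, step i x y K = step j x y K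

variable {X S ι : Type*} [TopologicalSpace X] {B : ι → Set X} {Good : X → S → Prop}
  {step : ι → X → X → S → S}

/-- The set where the two continuations agree is open and closed in `T`, because agreement at a
point and at nearby points are equivalent. -/
theorem IsFlatSystem.step_eq (h : IsFlatSystem B Good step) {Y : Type*} [TopologicalSpace Y]
    {T : Set Y} (hT : IsPreconnected T) {c : Y → X} (hc : Continuous c) {i j : ι}
    (hi : ∀ y ∈ T, c y ∈ B i) (hj : ∀ y ∈ T, c y ∈ B j) {a b : Y} (ha : a ∈ T) (hb : b ∈ T) {K : S}
    (hK : Good (c a) K) : step i (c a) (c b) K = step j (c a) (c b) K := by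
  have hgi := fun y hy ↦ h.good i (c a) (c y) K (hi a ha) (hi y hy) hK
  have hgj := fun y hy ↦ h.good j (c a) (c y) K (hj a ha) (hj y hy) hK
  have key : ∀ y ∈ T, ∀ᶠ z in 𝓝 y, z ∈ T →
      (step i (c a) (c z) K = step j (c a) (c z) K ↔
        step i (c a) (c y) K = step j (c a) (c y) K) := by
    intro y hy
    filter_upwards [hc.continuousAt.eventually
      (h.eventually_eq i j (c y) _ (hi y hy) (hj y hy) (hgi y hy))] with z hz hzT
    rw [h.comp i _ _ _ _ (hi a ha) (hi y hy) (hi z hzT) hK] at hz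
    constructor
    · intro h1
      have h2 := h.comp j (c y) (c z) (c y) _ (hj y hy) (hj z hzT) (hj y hy) (hgi y hy)
      rw [← hz, h1, h.comp j _ _ _ _ (hj a ha) (hj z hzT) (hj y hy) hK,
        h.self j _ _ (hj y hy) (hgi y hy)] at h2
      exact h2.symm
    · intro h1
      rw [hz, h1, h.comp j _ _ _ _ (hj a ha) (hj y hy) (hj z hzT) hK]
  let D : Set Y := {y | step i (c a) (c y) K = step j (c a) (c y) K}
  have hpre := isPreconnected_iff_subset_of_disjoint.1 hT
    (interior {y | y ∈ T → y ∈ D}) (interior {y | y ∈ T → y ∉ D}) isOpen_interior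
    isOpen_interior (fun y hy ↦ ?_) ?_
  · rcases hpre with h1 | h1
    · exact interior_subset (h1 hb) hb
    · refine (interior_subset (h1 ha) ha ?_).elim
      show step i (c a) (c a) K = step j (c a) (c a) K
      rw [h.self i _ _ (hi a ha) hK, h.self j _ _ (hj a ha) hK]
  · by_cases hyD : y ∈ D
    · exact Or.inl (mem_interior_iff_mem_nhds.2
        ((key y hy).mono fun z hz hzT ↦ (hz hzT).2 hyD))
    · exact Or.inr (mem_interior_iff_mem_nhds.2
        ((key y hy).mono fun z hz hzT hzD ↦ hyD ((hz hzT).1 hzD)))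
  · refine eq_empty_of_forall_notMem fun y hy ↦ ?_
    exact interior_subset hy.2.2 hy.1 (interior_subset hy.2.1 hy.1)

/-- States which are tracked along a null-homotopic loop return to their initial value. -/
theorem IsFlatSystem.of_homotopic (h : IsFlatSystem B Good step) {p : X} {γ : Path p p}
    (hγ : γ.Homotopic (Path.refl p)) {Tr : unitInterval → S → Prop}
    (hTr : ∀ (i : ι) (a b : unitInterval) (K : S), a ≤ b → (∀ t ∈ Icc a b, γ t ∈ B i) →
      Good (γ a) K → Tr a K → Tr b (step i (γ a) (γ b) K)) {K₀ : S} (hK₀ : Good p K₀)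
    (h0 : Tr 0 K₀) : Tr 1 K₀ := by
  obtain ⟨H⟩ := hγ
  have hH : Continuous fun q : unitInterval × unitInterval ↦ H q := H.continuous
  -- A Lebesgue-number grid: each closed cell of the homotopy square is mapped into a single member
  -- of the cover.
  obtain ⟨t, ht0, hmono, ⟨n₀, hn₀⟩, hcov⟩ :=
    exists_monotone_Icc_subset_open_cover_unitInterval_prod_self
      (c := fun i ↦ (fun q : unitInterval × unitInterval ↦ H q) ⁻¹' B i)
      (fun i ↦ (h.isOpen i).preimage hH) fun q _ ↦ by
        obtain ⟨i, hi⟩ := h.cover (H q)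
        exact mem_iUnion.2 ⟨i, hi⟩
  choose k hk using hcov
  have hmem : ∀ n m, ∀ s ∈ Icc (t n) (t (n + 1)), ∀ u ∈ Icc (t m) (t (m + 1)),
      H (s, u) ∈ B (k n m) := fun n m s hs u hu ↦ hk n m (mk_mem_prod hs hu)
  have hl : ∀ n, t n ∈ Icc (t n) (t (n + 1)) := fun n ↦ left_mem_Icc.2 (hmono n.le_succ)
  have hr : ∀ n, t (n + 1) ∈ Icc (t n) (t (n + 1)) := fun n ↦ right_mem_Icc.2 (hmono n.le_succ)
  let x : ℕ → ℕ → X := fun n m ↦ H (t n, t m)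
  let K : ℕ → ℕ → S := fun n m ↦ Nat.rec K₀ (fun m L ↦ step (k n m) (x n m) (x n (m + 1)) L) m
  have hK0 : ∀ n, K n 0 = K₀ := fun n ↦ rfl
  have hKs : ∀ n m, K n (m + 1) = step (k n m) (x n m) (x n (m + 1)) (K n m) := fun n m ↦ rfl
  have hx0 : ∀ n, x n 0 = p := fun n ↦ by
    show H (t n, t 0) = p
    rw [ht0]
    exact H.source _
  have hx1 : ∀ n, x n n₀ = p := fun n ↦ by
    show H (t n, t n₀) = p
    rw [hn₀ n₀ le_rfl]
    exact H.target _
  have hgood : ∀ n m, Good (x n m) (K n m) := by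
    intro n m
    induction m with
    | zero => rw [hx0, hK0]; exact hK₀
    | succ m ih =>
      exact h.good _ _ _ _ (hmem n m _ (hl n) _ (hl m)) (hmem n m _ (hl n) _ (hr m)) ih
  -- Continuation along a row followed by a vertical step does not depend on the route around a
  -- cell. `e1` and `e2` change the label of the cell along a shared horizontal and vertical edge.
  have hrow : ∀ n m, K (n + 1) m = step (k n m) (x n m) (x (n + 1) m) (K n m) := by
    intro n m
    induction m with
    | zero =>
      have h1 := hmem n 0 _ (hl n) _ (hl 0)
      have h2 : H (t n, t 0) = p := hx0 n
      rw [h2] at h1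
      rw [hx0, hx0, hK0, hK0, h.self _ _ _ h1 hK₀]
    | succ m ih =>
      have b₁ := hmem n m _ (hl n) _ (hl m)
      have b₂ := hmem n m _ (hl n) _ (hr m)
      have b₃ := hmem n m _ (hr n) _ (hl m)
      have b₄ := hmem n m _ (hr n) _ (hr m)
      have e1 : K (n + 1) (m + 1) =
          step (k n m) (x (n + 1) m) (x (n + 1) (m + 1)) (K (n + 1) m) :=
        h.step_eq (T := Icc (t m) (t (m + 1))) isPreconnected_Icc (c := fun u ↦ H (t (n + 1), u))
          (hH.comp (by fun_prop)) (fun u hu ↦ hmem (n + 1) m _ (hl (n + 1)) u hu)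
          (fun u hu ↦ hmem n m _ (hr n) u hu) (hl m) (hr m) (hgood (n + 1) m)
      have e2 : step (k n m) (x n (m + 1)) (x (n + 1) (m + 1)) (K n (m + 1)) =
          step (k n (m + 1)) (x n (m + 1)) (x (n + 1) (m + 1)) (K n (m + 1)) :=
        h.step_eq (T := Icc (t n) (t (n + 1))) isPreconnected_Icc (c := fun s ↦ H (s, t (m + 1)))
          (hH.comp (by fun_prop)) (fun s hs ↦ hmem n m s hs _ (hr m))
          (fun s hs ↦ hmem n (m + 1) s hs _ (hl (m + 1))) (hl n) (hr n) (hgood n (m + 1))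
      rw [e1, ih, ← e2, hKs, h.comp _ _ _ _ _ b₁ b₃ b₄ (hgood n m),
        h.comp _ _ _ _ _ b₁ b₂ b₄ (hgood n m)]
  have hend : ∀ n, K n n₀ = K 0 n₀ := by
    intro n
    induction n with
    | zero => rfl
    | succ n ih =>
      have h1 := hmem n n₀ _ (hl n) _ (hl n₀)
      have h3 := hgood n n₀
      have h2 : H (t n, t n₀) = p := hx1 n
      rw [h2] at h1
      rw [hx1] at h3
      rw [hrow, hx1, hx1, h.self _ _ _ h1 h3, ih]
  have hconst : ∀ m, x n₀ m = p := fun m ↦ by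
    show H (t n₀, t m) = p
    rw [hn₀ n₀ le_rfl]
    exact H.apply_one _
  -- The row `n₀` lies over the constant loop, where each step is the identity.
  have hlast : ∀ m, K n₀ m = K₀ := by
    intro m
    induction m with
    | zero => rfl
    | succ m ih =>
      have h1 := hmem n₀ m _ (hl n₀) _ (hl m)
      have h2 : H (t n₀, t m) = p := hconst m
      rw [h2] at h1
      rw [hKs, hconst, hconst, ih, h.self _ _ _ h1 hK₀]
  have hγ0 : ∀ u, H (t 0, u) = γ u := fun u ↦ by
    rw [ht0]
    exact H.apply_zero u
  have htr : ∀ m, Tr (t m) (K 0 m) := by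
    intro m
    induction m with
    | zero => rw [ht0, hK0]; exact h0
    | succ m ih =>
      have h1 := hTr (k 0 m) (t m) (t (m + 1)) (K 0 m) (hmono m.le_succ) (fun u hu ↦ by
        rw [← hγ0]
        exact hmem 0 m _ (hl 0) u hu) (by
        rw [← hγ0]
        exact hgood 0 m) ih
      rw [← hγ0, ← hγ0] at h1
      exact h1
  have h1 := htr n₀
  rw [hn₀ n₀ le_rfl, ← hend n₀, hlast] at h1
  exact h1

end Monodromy

/-! ### Displaced classes modulo `Ξ` inside a box. -/

section FlatStates

variable {E : Type*} [NormedAddCommGroup E] [NormedSpace ℝ E] [FiniteDimensional ℝ E]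
  {M : Type*} [TopologicalSpace M] [T2Space M] [ChartedSpace E M] [IsManifold 𝓘(ℝ, E) ∞ M]
  {F : Type*} [NormedAddCommGroup F] [NormedSpace ℝ F] [FiniteDimensional ℝ F]
  {N : Type*} [TopologicalSpace N] [T2Space N] [ChartedSpace F N] [IsManifold 𝓘(ℝ, F) ∞ N]

variable {g : PseudoRiemannianMetric F N}
  {cov : CovariantDerivative 𝓘(ℝ, F) F (TangentSpace 𝓘(ℝ, F) : N → Type _)} {f : M → N}
  {p x₀ x y : M} {r : ℝ} {Ω : E → E →L[ℝ] F →L[ℝ] F}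
  {τ : normalSpace E g f p →ₗ[ℝ] TangentSpace 𝓘(ℝ, F) (f x)}

/-- The curvature of the normal connection, displaced to `p`, maps `z` and `Ξ` into `Ξ`. -/
def IsFlatOn (cov : CovariantDerivative 𝓘(ℝ, F) F (TangentSpace 𝓘(ℝ, F) : N → Type _))
    (z : normalSpace E g f p) (Ξ : Submodule ℝ (normalSpace E g f p)) : Prop :=
  ∀ ⦃x₀ : M⦄ ⦃r : ℝ⦄ ⦃Ω : E → E →L[ℝ] F →L[ℝ] F⦄, IsBox g cov f x₀ r Ω →
    ∀ ⦃x : M⦄, x ∈ boxRegion E x₀ r →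
    ∀ ⦃τ : normalSpace E g f p →ₗ[ℝ] TangentSpace 𝓘(ℝ, F) (f x)⦄, IsTransport E g cov f p x τ →
    ∀ (X Y : E) (ξ : normalSpace E g f p), (ξ = z ∨ ξ ∈ Ξ) →
      connCurvature Ω (extChartAt 𝓘(ℝ, E) x₀ x) X Y (toCoord (f x₀) (f x) (τ ξ)) ∈
        Ξ.map ((toCoord (f x₀) (f x)).toLinearMap ∘ₗ τ)

/-- The vectors at `x` which arise from the class of `z` modulo `Ξ` by the displacement `τ`. -/
def transportClass (z : normalSpace E g f p) (Ξ : Submodule ℝ (normalSpace E g f p))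
    (τ : normalSpace E g f p →ₗ[ℝ] TangentSpace 𝓘(ℝ, F) (f x)) : Set (TangentBundle 𝓘(ℝ, F) N) :=
  (fun ξ ↦ ⟨f x, τ ξ⟩) '' {ξ | ξ - z ∈ Ξ}

theorem mk_mem_transportClass {z : normalSpace E g f p}
    {Ξ : Submodule ℝ (normalSpace E g f p)} {v : TangentSpace 𝓘(ℝ, F) (f x)} :
    (⟨f x, v⟩ : TangentBundle 𝓘(ℝ, F) N) ∈ transportClass z Ξ τ ↔ ∃ ξ, ξ - z ∈ Ξ ∧ τ ξ = v := by
  constructor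
  · rintro ⟨ξ, hξ, h⟩
    exact ⟨ξ, hξ, by simpa using h⟩
  · rintro ⟨ξ, hξ, rfl⟩
    exact ⟨ξ, hξ, rfl⟩

/-- The sets of vectors which arise from the class of `z` modulo `Ξ` by a displacement. -/
def IsTransportClass (cov : CovariantDerivative 𝓘(ℝ, F) F (TangentSpace 𝓘(ℝ, F) : N → Type _))
    (z : normalSpace E g f p) (Ξ : Submodule ℝ (normalSpace E g f p)) (x : M)
    (K : Set (TangentBundle 𝓘(ℝ, F) N)) : Prop :=
  ∃ τ : normalSpace E g f p →ₗ[ℝ] TangentSpace 𝓘(ℝ, F) (f x), IsTransport E g cov f p x τ ∧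
    K = transportClass z Ξ τ

variable (f x₀ Ω) in
/-- The displacement of sets of vectors from `x` to `y` through the centre of the box. -/
def coneStep (x y : M) (K : Set (TangentBundle 𝓘(ℝ, F) N)) : Set (TangentBundle 𝓘(ℝ, F) N) :=
  {ζ | ∃ v : TangentSpace 𝓘(ℝ, F) (f x), ⟨f x, v⟩ ∈ K ∧
    ζ = ⟨f y, IsBox.move f x₀ Ω x₀ y (IsBox.move f x₀ Ω x x₀ v)⟩}

theorem coneStep_transportClass (z : normalSpace E g f p)
    (Ξ : Submodule ℝ (normalSpace E g f p)) :
    coneStep f x₀ Ω x y (transportClass z Ξ τ) =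
      transportClass z Ξ (IsBox.move f x₀ Ω x₀ y ∘ₗ IsBox.move f x₀ Ω x x₀ ∘ₗ τ) := by
  ext ζ
  constructor
  · rintro ⟨v, hv, rfl⟩
    obtain ⟨ξ, hξ, rfl⟩ := mk_mem_transportClass.1 hv
    exact mk_mem_transportClass.2 ⟨ξ, hξ, rfl⟩
  · rintro ⟨ξ, hξ, rfl⟩
    exact ⟨τ ξ, mk_mem_transportClass.2 ⟨ξ, hξ, rfl⟩, rfl⟩

variable {z : normalSpace E g f p} {Ξ : Submodule ℝ (normalSpace E g f p)}
  {K : Set (TangentBundle 𝓘(ℝ, F) N)}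

namespace IsBox

theorem isTransportClass_coneStep (h : IsBox g cov f x₀ r Ω) (hx : x ∈ boxRegion E x₀ r)
    (hy : y ∈ boxRegion E x₀ r) (hK : IsTransportClass cov z Ξ x K) :
    IsTransportClass cov z Ξ y (coneStep f x₀ Ω x y K) := by
  obtain ⟨τ, hτ, rfl⟩ := hK
  exact ⟨_, (hτ.move h hx h.mem_boxRegion).move h h.mem_boxRegion hy,
    coneStep_transportClass z Ξ⟩

/-- Passing through the centre makes consecutive steps compose exactly, because the way back to the
centre undoes the way out. For direct segments the curvature would intervene. -/
theorem coneStep_coneStep (h : IsBox g cov f x₀ r Ω) (hy : y ∈ boxRegion E x₀ r) (w : M)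
    (hK : IsTransportClass cov z Ξ x K) :
    coneStep f x₀ Ω y w (coneStep f x₀ Ω x y K) = coneStep f x₀ Ω x w K := by
  obtain ⟨τ, hτ, rfl⟩ := hK
  rw [coneStep_transportClass, coneStep_transportClass, coneStep_transportClass]
  congr 1
  refine LinearMap.ext fun ξ ↦ ?_
  simp only [LinearMap.comp_apply]
  rw [h.move_move h.mem_boxRegion hy]

theorem coneStep_self (h : IsBox g cov f x₀ r Ω) (hx : x ∈ boxRegion E x₀ r)
    (hK : IsTransportClass cov z Ξ x K) : coneStep f x₀ Ω x x K = K := by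
  obtain ⟨τ, hτ, rfl⟩ := hK
  rw [coneStep_transportClass]
  congr 1
  refine LinearMap.ext fun ξ ↦ ?_
  simp only [LinearMap.comp_apply]
  rw [h.move_move hx h.mem_boxRegion]

/-- Normal parallel fields along a smooth curve in a box stay in the displaced classes. -/
theorem mem_coneStep_of_contMDiffOn (h : IsBox g cov f x₀ r Ω) (hflat : IsFlatOn cov z Ξ)
    {y₁ y₂ : M} {γ : Path y₁ y₂} {V : Π t : ℝ, TangentSpace 𝓘(ℝ, F) (f (γ.extend t))}
    (hV : IsNormalParallel E g cov f γ V) {a b : ℝ} (ha : 0 ≤ a) (hab : a < b) (hb : b ≤ 1)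
    (hγ : ContMDiffOn 𝓘(ℝ, ℝ) 𝓘(ℝ, E) ∞ γ.extend (Icc a b))
    (hreg : ∀ t ∈ Icc a b, γ.extend t ∈ boxRegion E x₀ r)
    (hK : IsTransportClass cov z Ξ (γ.extend a) K)
    (hVa : (⟨f (γ.extend a), V a⟩ : TangentBundle 𝓘(ℝ, F) N) ∈ K) :
    (⟨f (γ.extend b), V b⟩ : TangentBundle 𝓘(ℝ, F) N) ∈
      coneStep f x₀ Ω (γ.extend a) (γ.extend b) K := by
  have hΩ := h.contDiff.continuous
  obtain ⟨τ, hτ, rfl⟩ := hK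
  obtain ⟨ξ, hξ, hξV⟩ := mk_mem_transportClass.1 hVa
  have hx₀ := h.mem_boxRegion
  have hsub : Icc a b ⊆ Icc 0 1 := Icc_subset_Icc ha hb
  have haI := left_mem_Icc.2 hab.le
  have hbI := right_mem_Icc.2 hab.le
  set o := extChartAt 𝓘(ℝ, E) x₀ x₀ with ho
  let τ₀ := IsBox.move f x₀ Ω (γ.extend a) x₀ ∘ₗ τ
  have hτ₀ : IsTransport E g cov f p x₀ τ₀ := hτ.move h (hreg a haI) hx₀
  let L : normalSpace E g f p →ₗ[ℝ] F := (toCoord (f x₀) (f x₀)).toLinearMap ∘ₗ τ₀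
  have hL : ∀ η, L η = segTransportInv Ω o (extChartAt 𝓘(ℝ, E) x₀ (γ.extend a) - o)
      (toCoord (f x₀) (f (γ.extend a)) (τ η)) := by
    intro η
    rw [← segTransport_reverse hΩ]
    exact h.toCoord_move hx₀ _
  have hmove : ∀ w η, toCoord (f x₀) (f w) (IsBox.move f x₀ Ω x₀ w (τ₀ η)) =
      toCoord (f x₀) (f w) (ofCoord (f x₀) (f w)
        (segTransport Ω o (extChartAt 𝓘(ℝ, E) x₀ w - o) (L η))) := fun w η ↦ rfl
  have hγ1 : ContDiffOn ℝ 1 (fun t ↦ extChartAt 𝓘(ℝ, E) x₀ (γ.extend t)) (Icc a b) := by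
    have h1 : ContMDiffOn 𝓘(ℝ, ℝ) 𝓘(ℝ, E) ∞ (fun t ↦ extChartAt 𝓘(ℝ, E) x₀ (γ.extend t)) (Icc a b) :=
      (contMDiffOn_extChartAt (I := 𝓘(ℝ, E)) (x := x₀)).comp hγ fun t ht ↦ (hreg t ht).1
    exact (contMDiffOn_iff_contDiffOn.1 h1).of_le (by simp)
  have hu : ContinuousOn (fun t ↦ toCoord (f x₀) (f (γ.extend t)) (V t)) (Icc a b) := by
    let e := trivializationAt F (TangentSpace 𝓘(ℝ, F) : N → Type _) (f x₀)
    have h1 : ContinuousOn (fun t ↦ e (⟨f (γ.extend t), V t⟩ : TangentBundle 𝓘(ℝ, F) N)) (Icc a b) :=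
      e.continuousOn.comp (hV.continuousOn.mono hsub) fun t ht ↦
        e.mem_source.2 (mem_trivializationAt_baseSet (h.map_mem_source (hreg t ht)))
    exact (continuous_snd.comp_continuousOn h1).congr fun t ht ↦
      (trivializationAt_snd (h.map_mem_source (hreg t ht)) _).symm
  obtain ⟨S, hS, hpar⟩ := hV.parallel
  -- Everything is referred to the centre: `L` carries the class of `z` there in coordinates, and
  -- the flatness hypothesis is used at each point of the cone over the curve.
  have hfin := segTransportInv_sub_mem h.contDiff o hab hγ1 hu hS (fun t ht ↦ ?_) (L z) (Ξ.map L)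
    (fun t ht s hs X Y v hv ↦ ?_) ?_
  · obtain ⟨η, hη, hLη⟩ := hfin
    rw [coneStep_transportClass]
    refine mk_mem_transportClass.2 ⟨z + η, by rwa [add_sub_cancel_left], ?_⟩
    have h1 : segTransportInv Ω o (extChartAt 𝓘(ℝ, E) x₀ (γ.extend b) - o)
        (toCoord (f x₀) (f (γ.extend b)) (V b)) = L (z + η) := by
      rw [map_add, hLη]
      abel
    have h2 : segTransport Ω o (extChartAt 𝓘(ℝ, E) x₀ (γ.extend b) - o) (L (z + η)) =
        toCoord (f x₀) (f (γ.extend b)) (V b) := by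
      rw [← h1, ← mul_apply_eq_comp, segTransport_mul_inv hΩ, one_apply_eq_self]
    show ofCoord (f x₀) (f (γ.extend b)) (segTransport Ω o (extChartAt 𝓘(ℝ, E) x₀ (γ.extend b) - o)
      (L (z + η))) = V b
    rw [h2, ofCoord_toCoord (h.map_mem_source (hreg b hbI))]
  · have htI := Ioo_subset_Icc_self ht.1
    have htI' : t ∈ Ioo (0 : ℝ) 1 := ⟨ha.trans_lt ht.1.1, ht.1.2.trans_le hb⟩
    obtain ⟨h1, h2⟩ := hpar t ⟨htI', ht.2⟩
    refine h.hasDerivAt_of_parallel (hreg t htI) ?_ h1 ?_ h2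
    · exact (hγ.contMDiffAt (Icc_mem_nhds ht.1.1 ht.1.2)).mdifferentiableAt (by simp)
    · filter_upwards [Icc_mem_nhds htI'.1 htI'.2] with s hs using hV.normal s hs
  · have hb' := add_smul_mem_ball (Metric.mem_ball_self h.pos) (hreg t ht).2 hs
    rw [← ho] at hb'
    have hw := h.symm_mem_boxRegion hb'
    have hinv := (extChartAt 𝓘(ℝ, E) x₀).right_inv (h.subset hb').1
    set w := (extChartAt 𝓘(ℝ, E) x₀).symm (o + s • (extChartAt 𝓘(ℝ, E) x₀ (γ.extend t) - o)) with hwdef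
    have hcoord : ∀ η, toCoord (f x₀) (f w) (IsBox.move f x₀ Ω x₀ w (τ₀ η)) =
        segTransport Ω o (s • (extChartAt 𝓘(ℝ, E) x₀ (γ.extend t) - o)) (L η) := by
      intro η
      rw [hmove, toCoord_ofCoord (h.map_mem_source hw), hinv, add_sub_cancel_left]
    obtain ⟨η, hη, rfl⟩ : ∃ η, (η = z ∨ η ∈ Ξ) ∧ L η = v := by
      rcases hv with rfl | ⟨η, hη, rfl⟩
      · exact ⟨z, Or.inl rfl, rfl⟩
      · exact ⟨η, Or.inr hη, rfl⟩
    obtain ⟨η', hη', he⟩ := hflat h hw (hτ₀.move h hx₀ hw) X Y η hη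
    simp only [LinearMap.comp_apply, hinv] at he
    refine ⟨η', hη', ?_⟩
    have h3 : segTransport Ω o (s • (extChartAt 𝓘(ℝ, E) x₀ (γ.extend t) - o)) (L η') =
        connCurvature Ω (o + s • (extChartAt 𝓘(ℝ, E) x₀ (γ.extend t) - o)) X Y
          (segTransport Ω o (s • (extChartAt 𝓘(ℝ, E) x₀ (γ.extend t) - o)) (L η)) := by
      rw [← hcoord, ← hcoord]
      exact he
    rw [← h3, ← mul_apply_eq_comp, segTransportInv_mul hΩ, one_apply_eq_self]
  · refine ⟨ξ - z, hξ, ?_⟩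
    rw [map_sub, hL ξ, hξV]

end IsBox

end FlatStates

/-! ### The holonomy group fixes the class. -/

section Monodromy

variable {E : Type*} [NormedAddCommGroup E] [NormedSpace ℝ E] [FiniteDimensional ℝ E]
  {M : Type*} [TopologicalSpace M] [T2Space M] [ChartedSpace E M] [IsManifold 𝓘(ℝ, E) ∞ M]
  {F : Type*} [NormedAddCommGroup F] [NormedSpace ℝ F] [FiniteDimensional ℝ F]
  {N : Type*} [TopologicalSpace N] [T2Space N] [ChartedSpace F N] [IsManifold 𝓘(ℝ, F) ∞ N]

variable {g : PseudoRiemannianMetric F N}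
  {cov : CovariantDerivative 𝓘(ℝ, F) F (TangentSpace 𝓘(ℝ, F) : N → Type _)} {f : M → N}
  {p x₀ x y : M} {r : ℝ} {Ω : E → E →L[ℝ] F →L[ℝ] F}
  {z : normalSpace E g f p} {Ξ : Submodule ℝ (normalSpace E g f p)}
  {K : Set (TangentBundle 𝓘(ℝ, F) N)}

namespace IsBox

/-- Normal parallel fields along a piecewise smooth curve in a box stay in the displaced classes. -/
theorem mem_coneStep (h : IsBox g cov f x₀ r Ω) (hflat : IsFlatOn cov z Ξ)
    {y₁ y₂ : M} {γ : Path y₁ y₂} (hγ : IsPiecewiseSmooth E γ)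
    {V : Π t : ℝ, TangentSpace 𝓘(ℝ, F) (f (γ.extend t))}
    (hV : IsNormalParallel E g cov f γ V) {a b : ℝ} (ha : 0 ≤ a) (hab : a ≤ b) (hb : b ≤ 1)
    (hreg : ∀ t ∈ Icc a b, γ.extend t ∈ boxRegion E x₀ r)
    (hK : IsTransportClass cov z Ξ (γ.extend a) K)
    (hVa : (⟨f (γ.extend a), V a⟩ : TangentBundle 𝓘(ℝ, F) N) ∈ K) :
    (⟨f (γ.extend b), V b⟩ : TangentBundle 𝓘(ℝ, F) N) ∈
      coneStep f x₀ Ω (γ.extend a) (γ.extend b) K := by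
  obtain ⟨n, s, hs, hs0, hs1, hsm⟩ := hγ
  -- The partition is clamped to `[a, b]`. A nondegenerate clamped interval lies in the original
  -- one, which is the content of `h1` and `h2` below.
  let c : ℕ → ℝ := fun i ↦ max a (min b (s i))
  have hc0 : c 0 = a := by
    simp only [c, hs0]
    exact max_eq_left ((min_le_right _ _).trans ha)
  have hcn : c n = b := by
    simp only [c, hs1, min_eq_left hb, max_eq_right hab]
  have hcI : ∀ i, c i ∈ Icc a b := fun i ↦ ⟨le_max_left _ _, max_le hab (min_le_left _ _)⟩
  have hmono : Monotone c := fun i j hij ↦ max_le_max_left _ (min_le_min_left _ (hs hij))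
  have key : ∀ i ≤ n, (⟨f (γ.extend (c i)), V (c i)⟩ : TangentBundle 𝓘(ℝ, F) N) ∈
      coneStep f x₀ Ω (γ.extend a) (γ.extend (c i)) K := by
    intro i hi
    induction i with
    | zero =>
      rw [hc0, h.coneStep_self (hreg a (left_mem_Icc.2 hab)) hK]
      exact hVa
    | succ i ih =>
      have ih := ih (by omega)
      rcases (hmono i.le_succ).eq_or_lt with he | hlt
      · rw [Nat.succ_eq_add_one] at he
        rw [← he]
        exact ih
      · have h1 : c (i + 1) ≤ s (i + 1) := by
          have : a < max a (min b (s (i + 1))) := (hcI i).1.trans_lt hlt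
          have h2 : c (i + 1) = min b (s (i + 1)) :=
            max_eq_right (le_of_lt ((lt_max_iff.1 this).resolve_left (lt_irrefl a)))
          exact h2.trans_le (min_le_right _ _)
        have h2 : s i ≤ c i := by
          rcases le_total b (s i) with h3 | h3
          · have h4 : b ≤ c i := by
              simp only [c, min_eq_left h3]
              exact le_max_right _ _
            exact absurd (hlt.trans_le (hcI (i + 1)).2) h4.not_gt
          · simp only [c, min_eq_right h3]
            exact le_max_right _ _
        have hK' := h.isTransportClass_coneStep (hreg a (left_mem_Icc.2 hab))
          (hreg _ (hcI i)) hK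
        have h3 := h.mem_coneStep_of_contMDiffOn hflat hV (ha.trans (hcI i).1) hlt
          ((hcI (i + 1)).2.trans hb) ((hsm i (by omega)).mono (Icc_subset_Icc h2 h1))
          (fun t ht ↦ hreg t ⟨(hcI i).1.trans ht.1, ht.2.trans (hcI (i + 1)).2⟩) hK' ih
        rwa [h.coneStep_coneStep (hreg _ (hcI i)) _ hK] at h3
  have h1 := key n le_rfl
  rwa [hcn] at h1

theorem mem_coneStep_of_isDisplacement (h : IsBox g cov f x₀ r Ω) (hflat : IsFlatOn cov z Ξ)
    {γ : Path x y} (hγ : IsPiecewiseSmooth E γ) (hreg : ∀ t, γ t ∈ boxRegion E x₀ r)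
    {ζ₀ ζ₁ : TangentBundle 𝓘(ℝ, F) N} (hd : IsDisplacement E g cov f γ ζ₀ ζ₁)
    (hK : IsTransportClass cov z Ξ x K) (h0 : ζ₀ ∈ K) : ζ₁ ∈ coneStep f x₀ Ω x y K := by
  obtain ⟨V, hV, e0, e1⟩ := hd
  have h1 := h.mem_coneStep (K := K) hflat hγ hV le_rfl zero_le_one le_rfl (fun t ht ↦ by
    rw [Path.extend_apply _ ht]
    exact hreg _) (by rwa [γ.extend_zero]) (by rwa [e0])
  rwa [e1, γ.extend_zero, γ.extend_one] at h1

/-- In the chart, `U` contains a ball around `x`, and balls are convex. -/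
theorem eventually_path_mem (h : IsBox g cov f x₀ r Ω) (hx : x ∈ boxRegion E x₀ r) {U : Set M}
    (hU : IsOpen U) (hxU : x ∈ U) :
    ∀ᶠ y in 𝓝 x, ∃ hy : y ∈ boxRegion E x₀ r, ∀ t, h.path hx hy t ∈ U := by
  have h1 := h.continuousOn_symm.isOpen_inter_preimage Metric.isOpen_ball hU
  have h2 : extChartAt 𝓘(ℝ, E) x₀ x ∈ Metric.ball (extChartAt 𝓘(ℝ, E) x₀ x₀) r ∩
      (extChartAt 𝓘(ℝ, E) x₀).symm ⁻¹' U := by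
    refine ⟨hx.2, ?_⟩
    rw [mem_preimage, extChartAt_left_inv_of_mem hx.1]
    exact hxU
  obtain ⟨ρ, hρ, h3⟩ := Metric.isOpen_iff.1 h1 _ h2
  have h4 : ContinuousAt (extChartAt 𝓘(ℝ, E) x₀) x :=
    continuousAt_extChartAt' (by rw [extChartAt_source]; exact hx.1)
  filter_upwards [h4.preimage_mem_nhds (Metric.ball_mem_nhds _ hρ),
    (isOpen_boxRegion x₀ r).mem_nhds hx] with y hy hy'
  exact ⟨hy', fun t ↦ (h3 (add_smul_mem_ball (Metric.mem_ball_self hρ) hy t.2)).2⟩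

/-- A vector at `y` is moved back to `x` along a short segment, landing in `K`, and then forward
along the same segment. The forward segment lies in both boxes, so the second box places the
returned vector in its own class. -/
theorem eventually_coneStep_subset (h : IsBox g cov f x₀ r Ω) {x₁ : M} {r₁ : ℝ}
    {Ω₁ : E → E →L[ℝ] F →L[ℝ] F} (h₁ : IsBox g cov f x₁ r₁ Ω₁) (hflat : IsFlatOn cov z Ξ)
    (hx : x ∈ boxRegion E x₀ r) (hx₁ : x ∈ boxRegion E x₁ r₁)
    (hK : IsTransportClass cov z Ξ x K) :
    ∀ᶠ y in 𝓝 x, coneStep f x₀ Ω x y K ⊆ coneStep f x₁ Ω₁ x y K := by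
  filter_upwards [h.eventually_path_mem hx (isOpen_boxRegion x₁ r₁) hx₁] with y ⟨hy, hpath⟩ ζ hζ
  have hKy := h.isTransportClass_coneStep hx hy hK
  obtain ⟨v, hv, rfl⟩ : ∃ v : TangentSpace 𝓘(ℝ, F) (f y), v ∈ normalSpace E g f y ∧
      (⟨f y, v⟩ : TangentBundle 𝓘(ℝ, F) N) = ζ := by
    obtain ⟨τ, hτ, e⟩ := hKy
    rw [e] at hζ
    obtain ⟨ξ, -, rfl⟩ := hζ
    exact ⟨_, hτ.mem ξ, rfl⟩
  have h2 := h.mem_coneStep_of_isDisplacement hflat (h.isPiecewiseSmooth_path hy hx)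
    (h.path_mem hy hx) (h.isDisplacement_move hy hx hv) hKy hζ
  rw [h.coneStep_coneStep hy _ hK, h.coneStep_self hx hK] at h2
  have h3 := h₁.mem_coneStep_of_isDisplacement hflat (h.isPiecewiseSmooth_path hx hy) hpath
    (h.isDisplacement_move hx hy (h.move_mem hy hx hv)) hK h2
  rwa [h.move_move hy hx] at h3

end IsBox

theorem isFlatSystem_coneStep {R : M → ℝ} {A : M → E → E →L[ℝ] F →L[ℝ] F}
    (h : ∀ x₀, IsBox g cov f x₀ (R x₀) (A x₀)) (hflat : IsFlatOn cov z Ξ) :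
    IsFlatSystem (fun x₀ ↦ boxRegion E x₀ (R x₀)) (IsTransportClass cov z Ξ)
      (fun x₀ ↦ coneStep f x₀ (A x₀)) where
  isOpen x₀ := isOpen_boxRegion x₀ (R x₀)
  cover x := ⟨x, (h x).mem_boxRegion⟩
  good x₀ x y K hx hy hK := (h x₀).isTransportClass_coneStep hx hy hK
  comp x₀ x y w K hx hy hw hK := (h x₀).coneStep_coneStep hy w hK
  self x₀ x K hx hK := (h x₀).coneStep_self hx hK
  eventually_eq x₀ x₁ x K hx hx₁ hK := by
    filter_upwards [(h x₀).eventually_coneStep_subset (h x₁) hflat hx hx₁ hK,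
      (h x₁).eventually_coneStep_subset (h x₀) hflat hx₁ hx hK] with y h1 h2
    exact h1.antisymm h2

/-- If the displaced curvature maps `z` and `Ξ` into `Ξ`, then the holonomy fixes `z` modulo `Ξ`. -/
theorem restrictedNormalHolonomy_sub_mem (hbox : ∀ x₀, ∃ r Ω, IsBox (E := E) g cov f x₀ r Ω)
    (hflat : IsFlatOn cov z Ξ) {φ : Module.End ℝ (normalSpace E g f p)}
    (hφ : φ ∈ restrictedNormalHolonomy E g cov f p) : φ z - z ∈ Ξ := by
  choose R A h using hbox
  obtain ⟨γ, hγ, hnull, htr⟩ := hφ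
  obtain ⟨V, hV, e0, e1⟩ := htr z
  have hext : ∀ t : unitInterval, γ.extend t = γ t := fun t ↦ Path.extend_apply _ t.2
  have hfin := (isFlatSystem_coneStep h hflat).of_homotopic hnull
    (Tr := fun t K ↦ (⟨f (γ.extend t), V t⟩ : TangentBundle 𝓘(ℝ, F) N) ∈ K)
    (fun x₀ a b K hab hreg hK hVa ↦ ?_)
    (K₀ := transportClass z Ξ (normalSpace E g f p).subtype)
    ⟨_, IsTransport.refl (h p) (h p).mem_boxRegion, rfl⟩ ?_
  · rw [Icc.coe_one, e1] at hfin
    obtain ⟨ξ, hξ, he⟩ := mk_mem_transportClass.1 hfin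
    rwa [Subtype.ext he] at hξ
  · rw [← hext] at hK
    have h1 := (h x₀).mem_coneStep hflat hγ hV a.2.1 hab b.2.2 (fun t ht ↦ by
      have ht' : t ∈ Icc (0 : ℝ) 1 := ⟨a.2.1.trans ht.1, ht.2.trans b.2.2⟩
      rw [Path.extend_apply _ ht']
      exact hreg ⟨t, ht'⟩ ht) hK hVa
    rw [← hext, ← hext]
    exact h1
  · rw [Icc.coe_zero, e0]
    exact mk_mem_transportClass.2 ⟨z, by rw [sub_self]; exact Ξ.zero_mem, rfl⟩

end Monodromy

/-! ### From flat classes to the screen holonomy. -/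

theorem connCurvature_swap {E : Type*} [NormedAddCommGroup E] [NormedSpace ℝ E] {𝔸 : Type*}
    [NormedRing 𝔸] [NormedAlgebra ℝ 𝔸] (Ω : E → E →L[ℝ] 𝔸) (x X Y : E) :
    connCurvature Ω x Y X = -connCurvature Ω x X Y := by
  unfold connCurvature
  abel

theorem connCurvature_sum_smul {E : Type*} [NormedAddCommGroup E] [NormedSpace ℝ E] {𝔸 : Type*}
    [NormedRing 𝔸] [NormedAlgebra ℝ 𝔸] {ι : Type*} [Fintype ι] (Ω : E → E →L[ℝ] 𝔸) (x Y : E)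
    (a : ι → ℝ) (b : ι → E) :
    connCurvature Ω x (∑ i, a i • b i) Y = ∑ i, a i • connCurvature Ω x (b i) Y := by
  simp only [connCurvature, map_sum, map_smul, sum_apply, smul_apply, Finset.sum_mul,
    Finset.mul_sum, smul_mul_assoc, mul_smul_comm, smul_add, smul_sub, Finset.sum_add_distrib,
    Finset.sum_sub_distrib]

theorem connCurvature_mem_of_basis {E : Type*} [NormedAddCommGroup E] [NormedSpace ℝ E]
    {F : Type*} [NormedAddCommGroup F] [NormedSpace ℝ F] {ι : Type*} [Fintype ι]
    (b : Module.Basis ι ℝ E) {Ω : E → E →L[ℝ] F →L[ℝ] F} {x : E} {u : F} {W : Submodule ℝ F}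
    (h : ∀ i k, connCurvature Ω x (b k) (b i) u ∈ W) (X Y : E) : connCurvature Ω x X Y u ∈ W := by
  have h1 : ∀ k, connCurvature Ω x (b k) Y u ∈ W := by
    intro k
    rw [connCurvature_swap, ← b.sum_repr Y, connCurvature_sum_smul, neg_apply, sum_apply]
    refine W.neg_mem (W.sum_mem fun i _ ↦ ?_)
    rw [connCurvature_swap, smul_apply, neg_apply]
    exact W.smul_mem _ (W.neg_mem (h i k))
  rw [← b.sum_repr X, connCurvature_sum_smul, sum_apply]
  exact W.sum_mem fun k _ ↦ W.smul_mem _ (h1 k)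

theorem mem_of_hasDerivAt_submodule {F : Type*} [NormedAddCommGroup F] [NormedSpace ℝ F]
    [FiniteDimensional ℝ F] {W : Submodule ℝ F} (Ξ : Submodule ℝ W) {u : ℝ → W} {u' z : W} {t : ℝ}
    (hu : HasDerivAt u u' t) (h : ∀ s, u s - z ∈ Ξ) : u' ∈ Ξ :=
  mem_of_hasDerivAt LinearMap.id Ξ (hu.sub_const z) (Filter.Eventually.of_forall h)

section Screen

variable {E : Type*} [NormedAddCommGroup E] [NormedSpace ℝ E] [FiniteDimensional ℝ E]
  {M : Type*} [TopologicalSpace M] [T2Space M] [ChartedSpace E M] [IsManifold 𝓘(ℝ, E) ∞ M]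
  {F : Type*} [NormedAddCommGroup F] [NormedSpace ℝ F] [FiniteDimensional ℝ F]
  {N : Type*} [TopologicalSpace N] [T2Space N] [ChartedSpace F N] [IsManifold 𝓘(ℝ, F) ∞ N]

variable {g : PseudoRiemannianMetric F N}
  {cov : CovariantDerivative 𝓘(ℝ, F) F (TangentSpace 𝓘(ℝ, F) : N → Type _)} {f : M → N}
  {p x₀ x y : M} {r : ℝ} {Ω : E → E →L[ℝ] F →L[ℝ] F}

/-- The inclusion of Euclidean space as the span of `e`. -/
def screenInclusion {q : ℕ} (e : Fin q → normalSpace E g f p) :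
    EuclideanSpace ℝ (Fin q) →ₗ[ℝ] normalSpace E g f p where
  toFun x := ∑ j, x j • e j
  map_add' x y := by simp [add_smul, Finset.sum_add_distrib]
  map_smul' c x := by simp [mul_smul, Finset.smul_sum]

theorem screenProjection_apply {q : ℕ} (e : Fin q → normalSpace E g f p)
    (B : Module.End ℝ (normalSpace E g f p)) (x : EuclideanSpace ℝ (Fin q)) (i : Fin q) :
    screenProjection e B x i = g.inner (f p) (B (screenInclusion e x)) (e i) := rfl

theorem inner_screenInclusion {q : ℕ} (e : Fin q → normalSpace E g f p)
    (η : normalSpace E g f p) (x : EuclideanSpace ℝ (Fin q)) :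
    g.inner (f p) η (screenInclusion e x) = ∑ i, x i * g.inner (f p) η (e i) := by
  simp [screenInclusion]

theorem inner_screenProjection {q : ℕ} (e : Fin q → normalSpace E g f p)
    (B : Module.End ℝ (normalSpace E g f p)) (x y : EuclideanSpace ℝ (Fin q)) :
    inner ℝ (screenProjection e B x) y =
      g.inner (f p) (B (screenInclusion e x)) (screenInclusion e y) := by
  rw [inner_screenInclusion]
  simp [PiLp.inner_apply, screenProjection_apply]

theorem inner_eq_zero_of_mem_span {k : ℕ} {v : Fin k → normalSpace E g f p} {ξ : normalSpace E g f p}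
    (hξ : ξ ∈ Submodule.span ℝ (range v)) {η : normalSpace E g f p}
    (hη : ∀ i, g.inner (f p) (v i) η = 0) : g.inner (f p) ξ η = 0 := by
  induction hξ using Submodule.span_induction with
  | mem _ h =>
    obtain ⟨i, rfl⟩ := h
    exact hη i
  | zero => simp
  | add _ _ _ _ h1 h2 => simp [h1, h2]
  | smul _ _ _ h1 => simp [h1]

namespace IsScreenBasis

variable {k q : ℕ} {v : Fin k → normalSpace E g f p} {e : Fin q → normalSpace E g f p}
  {w : Fin k → normalSpace E g f p}

/-- In the adapted basis, products with `v` read off the `w`-coefficients, and products with `e` the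
`e`-coefficients. -/
theorem mem_span_of_inner_eq_zero (hb : IsScreenBasis E g cov f p v e w)
    {η : normalSpace E g f p} (hv : ∀ i, g.inner (f p) η (v i) = 0)
    (he : ∀ i, g.inner (f p) η (e i) = 0) : η ∈ Submodule.span ℝ (range v) := by
  have h1 : η ∈ Submodule.span ℝ (range v ∪ range e ∪ range w) := hb.span_eq_top ▸ trivial
  rw [Submodule.span_union, Submodule.span_union] at h1
  obtain ⟨_, h2, c, hc, rfl⟩ := Submodule.mem_sup.1 h1
  obtain ⟨a, ha, b, hb', rfl⟩ := Submodule.mem_sup.1 h2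
  obtain ⟨β, rfl⟩ := (Submodule.mem_span_range_iff_exists_fun ℝ).1 hb'
  obtain ⟨δ, rfl⟩ := (Submodule.mem_span_range_iff_exists_fun ℝ).1 hc
  have hav : ∀ i, g.inner (f p) a (v i) = 0 := fun i ↦
    inner_eq_zero_of_mem_span ha fun i' ↦ hb.vv i' i
  have hae : ∀ i, g.inner (f p) a (e i) = 0 := fun i ↦
    inner_eq_zero_of_mem_span ha fun i' ↦ hb.ve i' i
  have hev : ∀ i i', g.inner (f p) (e i) (v i') = 0 := fun i i' ↦ (g.symm _ _ _).trans (hb.ve i' i)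
  have hwv : ∀ i i', g.inner (f p) (w i) (v i') = if i = i' then 1 else 0 := fun i i' ↦ by
    rw [g.symm, hb.vw]
    simp only [eq_comm]
  have hδ : ∀ i, δ i = 0 := fun i ↦ by
    simpa [hav, hev, hwv] using hv i
  have hβ : ∀ i, β i = 0 := fun i ↦ by
    simpa [hae, hb.ee, hδ] using he i
  simpa [hβ, hδ] using ha

theorem inner_screenInclusion_eq_zero (hb : IsScreenBasis E g cov f p v e w)
    {ξ : normalSpace E g f p} (hξ : ξ ∈ Submodule.span ℝ (range v))
    (c : EuclideanSpace ℝ (Fin q)) : g.inner (f p) ξ (screenInclusion e c) = 0 := by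
  rw [inner_screenInclusion]
  exact Finset.sum_eq_zero fun i _ ↦ by
    rw [inner_eq_zero_of_mem_span hξ fun i' ↦ hb.ve i' i, mul_zero]

theorem screenProjection_eq_zero (hb : IsScreenBasis E g cov f p v e w)
    {B : Module.End ℝ (normalSpace E g f p)} {c : EuclideanSpace ℝ (Fin q)}
    (h : B (screenInclusion e c) ∈ Submodule.span ℝ (range v)) : screenProjection e B c = 0 := by
  ext i
  rw [screenProjection_apply, inner_eq_zero_of_mem_span h fun i' ↦ hb.ve i' i]
  rfl

/-- If the restricted holonomy group fixes `z` modulo `Ξ`, its Lie algebra maps `z` into `Ξ`. -/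
theorem apply_mem_of_holonomy (hb : IsScreenBasis E g cov f p v e w) {z : normalSpace E g f p}
    (hz : ∀ φ ∈ restrictedNormalHolonomy E g cov f p, φ z - z ∈ Submodule.span ℝ (range v))
    {B : Module.End ℝ (normalSpace E g f p)} (hB : B ∈ normalHolonomyAlgebra E g cov f p) :
    B z ∈ Submodule.span ℝ (range v) := by
  let Ξ := Submodule.span ℝ (range v)
  -- Invariance of `Ξ` is built into the condition because the bracket $ABz-BAz$ needs it to remain
  -- in `Ξ`.
  let 𝔥 : LieSubalgebra ℝ (Module.End ℝ (normalSpace E g f p)) :=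
    { carrier := {B | B z ∈ Ξ ∧ ∀ ξ ∈ Ξ, B ξ ∈ Ξ}
      add_mem' := fun hA hB ↦
        ⟨Ξ.add_mem hA.1 hB.1, fun ξ hξ ↦ Ξ.add_mem (hA.2 ξ hξ) (hB.2 ξ hξ)⟩
      zero_mem' := ⟨Ξ.zero_mem, fun ξ _ ↦ Ξ.zero_mem⟩
      smul_mem' := fun c A hA ↦ ⟨Ξ.smul_mem c hA.1, fun ξ hξ ↦ Ξ.smul_mem c (hA.2 ξ hξ)⟩
      lie_mem' := fun {A B} hA hB ↦ by
        refine ⟨?_, fun ξ hξ ↦ ?_⟩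
        · exact Ξ.sub_mem (hA.2 _ hB.1) (hB.2 _ hA.1)
        · exact Ξ.sub_mem (hA.2 _ (hB.2 ξ hξ)) (hB.2 _ (hA.2 ξ hξ)) }
  have h1 : normalHolonomyAlgebra E g cov f p ≤ 𝔥 := by
    refine LieSubalgebra.lieSpan_le.2 fun X hX ↦ ⟨?_, hb.invariant X (LieSubalgebra.subset_lieSpan hX)⟩
    obtain ⟨c, c', hc, -, rfl, hd⟩ := hX
    exact mem_of_hasDerivAt_submodule (F := F) (W := normalSpace E g f p) Ξ ((hd z).2 0)
      fun s ↦ hz _ (hc s)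
  exact (h1 hB).1

/-- If there are no algebraic curvature tensors with values in the `j`-th factor, then the displaced
curvature maps the `j`-th summand into `Ξ = span v`. -/
theorem isFlatOn (hb : IsScreenBasis E g cov f p v e w) {ℓ : ℕ}
    {W : Fin (ℓ + 1) → Submodule ℝ (EuclideanSpace ℝ (Fin q))}
    {h : Fin ℓ → LieSubalgebra ℝ (Module.End ℝ (EuclideanSpace ℝ (Fin q)))}
    (hBL : IsBorelLichnerowicz (screenHolonomyAlgebra cov e) W h) {j : Fin ℓ}
    (hK : curvatureTensors (h j) = ⊥) {c : EuclideanSpace ℝ (Fin q)} (hc : c ∈ W j.succ) :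
    IsFlatOn cov (screenInclusion e c) (Submodule.span ℝ (range v)) := by
  intro x₀ r Ω hbox x hx τ hτ X Y ξ hξ
  have hU := hbox.subset hx.2
  have hfx := hbox.map_mem_source hx
  obtain ⟨b, A, hA, hR⟩ := hbox.immersed.exists_matrix hU
  have hcongr : ∀ X Y, connCurvature (normalConnection (fderiv ℝ (locMap E F f x₀))
      (locMetric E g f x₀) (locConn cov f x₀)) (extChartAt 𝓘(ℝ, E) x₀ x) X Y =
        connCurvature Ω (extChartAt 𝓘(ℝ, E) x₀ x) X Y := by
    intro X Y
    refine (connCurvature_congr (𝔸 := F →L[ℝ] F) ?_ X Y).symm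
    filter_upwards [Metric.isOpen_ball.mem_nhds hx.2] with z hz using hbox.eqOn hz
  choose B hB hBR using fun i k ↦ hτ.exists_mem_normalHolonomyAlgebra hbox hx (b k) (b i)
  have hn : ∀ η, toCoord (f x₀) (f x) (τ η) ∈ locNormal E g f x₀ (extChartAt 𝓘(ℝ, E) x₀ x) :=
    fun η ↦ (mem_normalSpace_iff hbox.smooth hx.1 hfx _).1 (hτ.mem η)
  let 𝒜 : normalSpace E g f p →ₗ[ℝ] Matrix (Fin (Module.finrank ℝ E)) (Fin (Module.finrank ℝ E)) ℝ :=
    A ∘ₗ (toCoord (f x₀) (f x)).toLinearMap ∘ₗ τ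
  have hinner : ∀ i k (η ζ : normalSpace E g f p), g.inner (f p) (B i k η) ζ = (𝒜 η * 𝒜 ζ - 𝒜 ζ * 𝒜 η) i k := by
    intro i k η ζ
    rw [← hτ.inner_eq, ← locMetric_toCoord hx.1 hfx, hBR, ← hcongr]
    exact hR i k _ _ (hn η) (hn ζ)
  have hzero : ∀ i k, screenProjection e (B i k) c = 0 := by
    intro i k
    refine hBL.apply_eq_zero_of_curvatureTensors_eq_bot j hK (𝒜 ∘ₗ screenInclusion e)
      (fun _ ↦ hA _) (fun i k ↦ screenProjection e (B i k))
      (fun i k ↦ Submodule.mem_map_of_mem (hB i k)) (fun i k c d ↦ ?_) hc i k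
    rw [inner_screenProjection, hinner]
    rfl
  have hmem : ∀ i k, B i k ξ ∈ Submodule.span ℝ (range v) := by
    intro i k
    rcases hξ with rfl | hξ
    · refine hb.mem_span_of_inner_eq_zero (fun i' ↦ ?_) fun i' ↦ ?_
      -- The commutator formula makes `B i k` skew, so $\langle Bz,v\rangle=-\langle Bv,z\rangle$,
      -- and $Bv\in\Xi$ is orthogonal to the screen.
      · have h1 := hinner i k (v i') (screenInclusion e c)
        rw [hb.inner_screenInclusion_eq_zero
          (hb.invariant _ (hB i k) _ (Submodule.subset_span (mem_range_self i')))] at h1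
        rw [hinner, ← neg_eq_zero, ← Matrix.neg_apply, neg_sub]
        exact h1.symm
      · rw [← screenProjection_apply, hzero]
        rfl
    · exact hb.invariant _ (hB i k) _ hξ
  refine connCurvature_mem_of_basis b (fun i k ↦ ?_) X Y
  rw [← hBR]
  exact ⟨B i k ξ, hmem i k, rfl⟩

end IsScreenBasis

end Screen

end NormalHolonomy

end

/-! ### Conclusion. -/

theorem mainTheorem4
    {E : Type*} [NormedAddCommGroup E] [NormedSpace ℝ E] [FiniteDimensional ℝ E]
    {M : Type*} [TopologicalSpace M] [T2Space M] [ChartedSpace E M] [IsManifold 𝓘(ℝ, E) ∞ M]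
    {F : Type*} [NormedAddCommGroup F] [NormedSpace ℝ F] [FiniteDimensional ℝ F]
    {N : Type*} [TopologicalSpace N] [T2Space N] [ChartedSpace F N] [IsManifold 𝓘(ℝ, F) ∞ N]
    (g : NormalHolonomy.PseudoRiemannianMetric F N)
    (cov : CovariantDerivative 𝓘(ℝ, F) F (TangentSpace 𝓘(ℝ, F) : N → Type _))
    (hcov : NormalHolonomy.IsLeviCivita g cov)
    (κ : ℝ) (hκ : NormalHolonomy.HasConstantCurvature g cov κ)
    (f : M → N) (hf : NormalHolonomy.IsSpacelikeImmersion (E := E) g f)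
    (p : M) {r q : ℕ}
    (v : Fin r → NormalHolonomy.normalSpace E g f p)
    (e : Fin q → NormalHolonomy.normalSpace E g f p)
    (w : Fin r → NormalHolonomy.normalSpace E g f p)
    (hb : NormalHolonomy.IsScreenBasis E g cov f p v e w)
    {ℓ : ℕ} (W : Fin (ℓ + 1) → Submodule ℝ (EuclideanSpace ℝ (Fin q)))
    (h : Fin ℓ → LieSubalgebra ℝ (Module.End ℝ (EuclideanSpace ℝ (Fin q))))
    (hBL : NormalHolonomy.IsBorelLichnerowicz
      (NormalHolonomy.screenHolonomyAlgebra cov e) W h)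
    (j : Fin ℓ) :
    NormalHolonomy.curvatureTensors (h j) ≠ ⊥ := by
  intro hK
  have hzero : ∀ B ∈ NormalHolonomy.normalHolonomyAlgebra E g cov f p, ∀ c ∈ W j.succ,
      NormalHolonomy.screenProjection e B c = 0 := fun B hB c hc ↦
    hb.screenProjection_eq_zero (hb.apply_mem_of_holonomy (fun φ hφ ↦
      NormalHolonomy.restrictedNormalHolonomy_sub_mem (NormalHolonomy.exists_isBox hcov hκ hf)
        (hb.isFlatOn hBL hK hc) hφ) hB)
  -- An element of the `j`-th factor that acts nontrivially is the screen part of some holonomy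
  -- element, contrary to `hzero`.
  obtain ⟨A, hA, c, hc, hAc⟩ := (hBL.irreducible j).nontrivial
  have hA' : A ∈ NormalHolonomy.screenHolonomyAlgebra cov e := by
    rw [← hBL.iSup_eq]
    exact Submodule.mem_iSup_of_mem j hA
  obtain ⟨B, hB, rfl⟩ := hA'
  exact hAc (hzero B hB c hc)
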